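/- **Theorem 3 (Phase transition of PhaseMax).** Fix $\alpha>2$ and $\rho_{\mathrm{init}}>0$, and let $m=m(n)$ satisfy $m(n)/n\to\alpha$ as $n\to\infty$. For each $n\ge1$ let $a_1,\dots,a_m$ be i.i.d. $\mathcal N(0,I_n)$ sensing vectors in $\mathbb R^n$, and let the target signal $\xi\in\mathbb R^n\setminus\{0\}$ and the initial guess $x_{\mathrm{init}}\in\mathbb R^n\setminus\{0\}$ be (deterministic or random) vectors such that the pair $(\xi,x_{\mathrm{init}})$ is independent of $(a_1,\dots,a_m)$ and such that, for all sufficiently large $n$, almost surely $$\frac{|x_{\mathrm{init}}^T\xi|}{\|x_{\mathrm{init}}\|_2\,\|\xi\|_2}=\rho_{\mathrm{init}} .$$ Let $\hat x$ be an optimal solution of the PhaseMax program $$\max_{x\in\mathbb R^n}\ x_{\mathrm{init}}^Tx\quad\text{subject to}\quad |a_i^Tx|\le |a_i^T\xi|,\qquad 1\le i\le m,$$ (any choice of one whenever an optimal solution exists, and an arbitrary vector otherwise), and let $$\mathrm{NMSE}_n=\frac{\min\{\|\xi-\hat x\|_2^2,\ \|\xi+\hat x\|_2^2\}}{\|\xi\|_2^2}.$$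 Then $\mathrm{NMSE}_n\to 0$ in probability as $n\to\infty$ (that is, $\mathbb P(\mathrm{NMSE}_n>\varepsilon)\to0$ for every $\varepsilon>0$) if and only if $$\rho_{\mathrm{init}}\ \ge\ \rho_c(\alpha):=\sqrt{1-\frac{\pi/\alpha}{\tan(\pi/\alpha)}} .$$ -/

import Mathlib

open MeasureTheory ProbabilityTheory Filter Topology

noncomputable section

namespace PhaseMax

/-- The magnitude measurements `y i = |⟨a i, ξ⟩|` of the signal `ξ`. -/
def measurements {m n : ℕ} (a : Fin m → EuclideanSpace ℝ (Fin n))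
    (ξ : EuclideanSpace ℝ (Fin n)) : Fin m → ℝ :=
  fun i => |inner ℝ (a i) ξ|

/-- The PhaseMax feasible polytope: all `z` with `|⟨a i, z⟩| ≤ y i` for every `i`. -/
def feasible {m n : ℕ} (a : Fin m → EuclideanSpace ℝ (Fin n)) (y : Fin m → ℝ) :
    Set (EuclideanSpace ℝ (Fin n)) :=
  {z | ∀ i, |inner ℝ (a i) z| ≤ y i}

/-- `z` is an optimal solution of the PhaseMax program: it maximizes `⟨xinit, z⟩` over the
feasible polytope. -/
def IsSolution {m n : ℕ} (a : Fin m → EuclideanSpace ℝ (Fin n)) (y : Fin m → ℝ)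
    (xinit z : EuclideanSpace ℝ (Fin n)) : Prop :=
  z ∈ feasible a y ∧ ∀ w ∈ feasible a y, (inner ℝ xinit w : ℝ) ≤ inner ℝ xinit z

/-- The input cosine similarity `|⟨xinit, ξ⟩| / (‖xinit‖ ‖ξ‖)`. With the convention `t / 0 = 0`
it can be positive only if both vectors are nonzero. -/
def cosineSimilarity {n : ℕ} (xinit ξ : EuclideanSpace ℝ (Fin n)) : ℝ :=
  |inner ℝ xinit ξ| / (‖xinit‖ * ‖ξ‖)

/-- The normalized mean squared error, which does not distinguish `ξ` and `-ξ`. -/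
def nmse {n : ℕ} (ξ xhat : EuclideanSpace ℝ (Fin n)) : ℝ :=
  min (‖ξ - xhat‖ ^ 2) (‖ξ + xhat‖ ^ 2) / ‖ξ‖ ^ 2

/-- The critical cosine similarity at oversampling ratio `α`. -/
def criticalCosine (α : ℝ) : ℝ :=
  √(1 - (Real.pi / α) / Real.tan (Real.pi / α))

/-- Convergence in probability to a constant; the `n`-th variable may live on its own
probability space. -/
def TendstoInProb {Ω : ℕ → Type*} [∀ n, MeasurableSpace (Ω n)] (μ : ∀ n, Measure (Ω n))
    (X : ∀ n, Ω n → ℝ) (c : ℝ) : Prop :=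
  ∀ ε : ℝ, 0 < ε → Tendsto (fun n => μ n {ω | ε < |X n ω - c|}) atTop (𝓝 0)

end PhaseMax

end

/-!
The sensing vectors decompose along the plane spanned by the signal direction `e` and the initial
guess `ρ e + √(1 - ρ²) u`: the components `g`, `f` along `e`, `u` and the orthogonal parts are
independent. A candidate `s e + w u + r` with `r` orthogonal to the plane is feasible when
`s g + w f + B r` lies in the box with half-widths `|g i|`, where `B` is a Gaussian matrix. Gordon's
inequality (`gordon`), which follows from Gaussian integration by parts along a path between the two
processes, replaces `B r` by a Gaussian vector `‖r‖ h`, at the price of the term `⟪r, q⟫ ≥ -‖r‖ ‖q‖`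
and a factor `2`. By the law of large numbers, `dist² ≈ m D(s, w, τ)` and `‖q‖² ≈ n`, where
`τ = ‖r‖` and `D` is `meanSqDist`; so the question is whether `α D(s, w, τ)` exceeds `τ²`.

In polar coordinates `D` is an explicit function of an angle. For `ρ ≥ criticalCosine α` one has
`τ² < α D` at every point other than `(1, 0, 0)` that is at least as good for the objective
(`sq_lt_mul_meanSqDist`). By compactness no point of a small sphere around the signal is feasible
and at least as good as the signal (`eventually_errorSet_le`); by convexity there are then no such
points outside the sphere either, so that the program has solutions and they are all near the
signal. For `ρ < criticalCosine α` there are parameters with a strictly larger objective value and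
`α D < τ²` (`exists_mul_meanSqDist_lt_sq`). If no point with these parameters were feasible, a
separating hyperplane would provide multipliers, and Gordon's inequality applied to the multipliers
shows that this is unlikely (`exists_eventually_valueSet_compl_le`). Every solution then has an
objective value larger than that of `± ξ` by a fixed proportion, and is far from both.

The bounds hold uniformly over deterministic signals and initial guesses, and independence carries
them over to random ones (`measure_mem_le_of_indepFun`).
-/

noncomputable section

namespace PhaseMax

/-! ### Gaussian integration by parts -/

theorem hasDerivAt_gaussianPDFReal_zero_one (x : ℝ) :
    HasDerivAt (gaussianPDFReal 0 1) (-x * gaussianPDFReal 0 1 x) x := by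
  have h1 : HasDerivAt (fun x : ℝ => -(x - 0) ^ 2 / (2 * ((1 : NNReal) : ℝ))) (-x) x := by
    have := (((hasDerivAt_id x).sub_const (0 : ℝ)).pow 2).neg.div_const (2 * ((1 : NNReal) : ℝ))
    refine this.congr_deriv ?_
    simp
    ring
  have h2 := (h1.exp).const_mul (√(2 * Real.pi * ((1 : NNReal) : ℝ)))⁻¹
  rw [gaussianPDFReal_def]
  refine h2.congr_deriv ?_
  ring

/-- Stein's identity for a bounded function with bounded derivative. -/
theorem integral_id_mul_gaussianReal {k k' : ℝ → ℝ} {C C' : ℝ}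
    (hk : ∀ x, HasDerivAt k (k' x) x) (hC : ∀ x, |k x| ≤ C) (hC' : ∀ x, |k' x| ≤ C')
    (hm : Measurable k') :
    ∫ x, x * k x ∂(gaussianReal 0 1) = ∫ x, k' x ∂(gaussianReal 0 1) := by
  have hkc : Continuous k := continuous_iff_continuousAt.2 fun x => (hk x).continuousAt
  have hp : Integrable (gaussianPDFReal 0 1) := integrable_gaussianPDFReal 0 1
  have hxp : Integrable (fun x => -x * gaussianPDFReal 0 1 x) := by
    have h := (IsGaussian.integrable_id (μ := gaussianReal 0 1)).neg
    rw [gaussianReal_of_var_ne_zero _ one_ne_zero, integrable_withDensity_iff_integrable_smul']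
      at h
    · refine h.congr (ae_of_all _ fun x => ?_)
      simp [toReal_gaussianPDF, mul_comm]
    · exact measurable_gaussianPDF 0 1
    · exact ae_of_all _ fun _ => ENNReal.ofReal_lt_top
  rw [integral_gaussianReal_eq_integral_smul one_ne_zero,
    integral_gaussianReal_eq_integral_smul one_ne_zero]
  have h := integral_mul_deriv_eq_deriv_mul_of_integrable (u := gaussianPDFReal 0 1) (v := k)
    (u' := fun x => -x * gaussianPDFReal 0 1 x) (v' := k')
    (fun x _ => hasDerivAt_gaussianPDFReal_zero_one x) (fun x _ => hk x)
    (hp.mul_bdd (c := C') hm.aestronglyMeasurable (ae_of_all _ hC'))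
    (hxp.mul_bdd (c := C) hkc.aestronglyMeasurable (ae_of_all _ hC))
    (hp.mul_bdd (c := C) hkc.aestronglyMeasurable (ae_of_all _ hC))
  simp only [smul_eq_mul]
  rw [h, ← integral_neg]
  congr 1
  ext x
  ring

section Comparison

variable {E : Type*} [NormedAddCommGroup E] [InnerProductSpace ℝ E] [FiniteDimensional ℝ E]
  [MeasurableSpace E] [BorelSpace E]

/-- The standard Gaussian measure splits along any unit vector `e`: its component along `e` may be
replaced by an independent standard normal variable. -/
theorem map_axis_add_stdGaussian {e : E} (he : ‖e‖ = 1) :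
    ((gaussianReal 0 1).prod (stdGaussian E)).map
      (fun p : ℝ × E => p.1 • e + (p.2 - (inner ℝ e p.2 : ℝ) • e)) = stdGaussian E := by
  have hmeas : Measurable (fun p : ℝ × E => p.1 • e + (p.2 - (inner ℝ e p.2 : ℝ) • e)) := by
    fun_prop
  have : IsProbabilityMeasure (((gaussianReal 0 1).prod (stdGaussian E)).map
      (fun p : ℝ × E => p.1 • e + (p.2 - (inner ℝ e p.2 : ℝ) • e))) :=
    Measure.isProbabilityMeasure_map hmeas.aemeasurable
  apply Measure.ext_of_charFun
  ext t
  rw [charFun_apply, integral_map hmeas.aemeasurable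
    (Measurable.aestronglyMeasurable (by fun_prop))]
  have hsplit : ∀ p : ℝ × E,
      Complex.exp ((inner ℝ (p.1 • e + (p.2 - (inner ℝ e p.2 : ℝ) • e)) t : ℝ) * Complex.I)
        = Complex.exp ((inner ℝ e t : ℝ) * p.1 * Complex.I) *
          Complex.exp ((inner ℝ p.2 (t - (inner ℝ e t : ℝ) • e) : ℝ) * Complex.I) := by
    intro p
    rw [← Complex.exp_add]
    congr 1
    rw [inner_add_left, inner_sub_left, inner_sub_right, real_inner_smul_left,
      real_inner_smul_left, real_inner_smul_right, real_inner_comm p.2 e]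
    push_cast
    ring
  simp_rw [hsplit]
  rw [integral_prod_mul (fun x : ℝ => Complex.exp ((inner ℝ e t : ℝ) * x * Complex.I))
    (fun y : E => Complex.exp ((inner ℝ y (t - (inner ℝ e t : ℝ) • e) : ℝ) * Complex.I)),
    ← charFun_apply_real, ← charFun_apply, charFun_gaussianReal, charFun_stdGaussian,
    charFun_stdGaussian, ← Complex.exp_add]
  congr 1
  have hn : ‖t - (inner ℝ e t : ℝ) • e‖ ^ 2 = ‖t‖ ^ 2 - (inner ℝ e t : ℝ) ^ 2 := by
    rw [norm_sub_sq_real, norm_smul, he, real_inner_smul_right, real_inner_comm]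
    simp
    ring
  have hn' : ((‖t - (inner ℝ e t : ℝ) • e‖ : ℝ) : ℂ) ^ 2
      = (‖t‖ : ℂ) ^ 2 - ((inner ℝ e t : ℝ) : ℂ) ^ 2 := by
    exact_mod_cast hn
  rw [hn']
  simp
  ring

/-- Gaussian integration by parts along a single direction `c`. Only the derivative of `H` along
`c` is needed. -/
theorem integral_inner_mul_stdGaussian {H H' : E → ℝ} {c : E} {C C' : ℝ}
    (hH : Continuous H) (hH' : Continuous H')
    (hd : ∀ z, HasDerivAt (fun s : ℝ => H (z + s • c)) (H' z) 0)
    (hC : ∀ z, |H z| ≤ C) (hC' : ∀ z, |H' z| ≤ C') :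
    ∫ z, (inner ℝ c z : ℝ) * H z ∂(stdGaussian E) = ∫ z, H' z ∂(stdGaussian E) := by
  rcases eq_or_ne c 0 with rfl | hc
  · have : ∀ z, H' z = 0 := fun z => by
      have h1 := hd z
      simp only [smul_zero, add_zero] at h1
      exact h1.unique (hasDerivAt_const _ _)
    simp [this]
  obtain ⟨r, hr⟩ : ∃ r, r = ‖c‖ := ⟨_, rfl⟩
  have hr0 : r ≠ 0 := by simpa [hr] using hc
  obtain ⟨e, he, hce⟩ : ∃ e : E, ‖e‖ = 1 ∧ c = r • e := by
    refine ⟨r⁻¹ • c, ?_, by rw [smul_smul, mul_inv_cancel₀ hr0, one_smul]⟩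
    rw [norm_smul, norm_inv, hr, norm_norm]
    exact inv_mul_cancel₀ (hr ▸ hr0)
  have hT : Continuous (fun p : ℝ × E => p.1 • e + (p.2 - (inner ℝ e p.2 : ℝ) • e)) := by fun_prop
  have hi : Integrable (fun z : E => (inner ℝ c z : ℝ) * H z) (stdGaussian E) :=
    (IsGaussian.integrable_id.const_inner (𝕜 := ℝ) c).mul_bdd
      hH.aestronglyMeasurable (ae_of_all _ hC)
  have hi' : Integrable H' (stdGaussian E) :=
    Integrable.of_bound hH'.aestronglyMeasurable C' (ae_of_all _ hC')
  have key : ∀ (K : E → ℝ), Continuous K → Integrable K (stdGaussian E) →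
      ∫ z, K z ∂(stdGaussian E) = ∫ y, ∫ x, K (x • e + (y - (inner ℝ e y : ℝ) • e))
        ∂(gaussianReal 0 1) ∂(stdGaussian E) := by
    intro K hK hKi
    have h1 : Integrable (fun p : ℝ × E => K (p.1 • e + (p.2 - (inner ℝ e p.2 : ℝ) • e)))
        ((gaussianReal 0 1).prod (stdGaussian E)) := by
      rw [← map_axis_add_stdGaussian he] at hKi
      exact hKi.comp_measurable hT.measurable
    conv_lhs => rw [← map_axis_add_stdGaussian he]
    rw [integral_map hT.measurable.aemeasurable hK.aestronglyMeasurable, integral_prod_symm _ h1]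
  rw [key _ (by fun_prop) hi, key _ hH' hi']
  congr 1
  ext y
  have hin : ∀ x : ℝ, (inner ℝ c (x • e + (y - (inner ℝ e y : ℝ) • e)) : ℝ) = r * x := by
    intro x
    rw [hce, real_inner_smul_left, inner_add_right, inner_sub_right, real_inner_smul_right,
      real_inner_smul_right, real_inner_self_eq_norm_sq, he]
    ring
  have hder : ∀ x : ℝ, HasDerivAt (fun x : ℝ => r * H (x • e + (y - (inner ℝ e y : ℝ) • e)))
      (H' (x • e + (y - (inner ℝ e y : ℝ) • e))) x := by
    intro x
    have h1 := hd (x • e + (y - (inner ℝ e y : ℝ) • e))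
    have h2 : HasDerivAt (fun x' : ℝ => r⁻¹ * (x' - x)) r⁻¹ x := by
      simpa using ((hasDerivAt_id x).sub_const x).const_mul r⁻¹
    have h3 := HasDerivAt.comp (h := fun x' : ℝ => r⁻¹ * (x' - x)) x (by simpa using h1) h2
    have h4 := h3.const_mul r
    refine (h4.congr_deriv (by field_simp)).congr_of_eventuallyEq (Eventually.of_forall ?_)
    intro x'
    simp only [Function.comp]
    congr 2
    rw [hce, smul_smul]
    have : r⁻¹ * (x' - x) * r = x' - x := by field_simp
    rw [this, sub_smul]
    abel
  have := integral_id_mul_gaussianReal hder (C := |r| * C) (C' := C')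
    (fun x => by rw [abs_mul]; exact mul_le_mul_of_nonneg_left (hC _) (abs_nonneg _))
    (fun x => hC' _) (by fun_prop)
  rw [← this]
  congr 1
  ext x
  rw [hin]
  ring

/-! ### The Gaussian comparison inequality -/

theorem hasDerivAt_comp_of_partials {κ : Type*} [Fintype κ] {F : (κ → ℝ) → ℝ}
    {dF : κ → (κ → ℝ) → ℝ}
    (hF : ∀ p, HasFDerivAt F
      (∑ a, dF a p • (ContinuousLinearMap.proj a : (κ → ℝ) →L[ℝ] ℝ)) p)
    {p : ℝ → κ → ℝ} {p' : κ → ℝ} {t : ℝ} (hp : ∀ a, HasDerivAt (fun t => p t a) (p' a) t) :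
    HasDerivAt (fun t => F (p t)) (∑ a, dF a (p t) * p' a) t := by
  have h := (hF (p t)).comp_hasDerivAt t (hasDerivAt_pi.2 hp)
  refine h.congr_deriv ?_
  simp

theorem abs_prod_le_one {ι : Type*} {F : ι → ℝ} (s : Finset ι) (h0 : ∀ i, 0 ≤ F i)
    (h1 : ∀ i, F i ≤ 1) : |∏ i ∈ s, F i| ≤ 1 := by
  rw [abs_of_nonneg (Finset.prod_nonneg fun i _ => h0 i)]
  exact Finset.prod_le_one (fun i _ => h0 i) fun i _ => h1 i

/-- A Gaussian comparison inequality of Slepian–Gordon type. The blocks `⟪A i ·, z⟫` and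
`⟪B i ·, z⟫` have the same law for each single `i`, and the cross-covariances between different
blocks are ordered against the partial derivatives of the `F i`. Along the path
`cos θ • B + sin θ • A`, the increment of a block is independent of that block, so that after
integration by parts only products of first derivatives in different blocks survive. -/
theorem integral_prod_comparison {ι κ : Type*} [Fintype κ] [DecidableEq ι] (s : Finset ι)
    (A B : ι → κ → E)
    (hAB : ∀ i a j b, (inner ℝ (A i a) (B j b) : ℝ) = 0)
    (hsame : ∀ i a b, (inner ℝ (A i a) (A i b) : ℝ) = inner ℝ (B i a) (B i b))
    (F : ι → (κ → ℝ) → ℝ) (dF : ι → κ → (κ → ℝ) → ℝ)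
    (hF : ∀ i p, HasFDerivAt (F i)
      (∑ a, dF i a p • (ContinuousLinearMap.proj a : (κ → ℝ) →L[ℝ] ℝ)) p)
    (hdF : ∀ i a, Continuous (dF i a)) (hF0 : ∀ i p, 0 ≤ F i p) (hF1 : ∀ i p, F i p ≤ 1)
    {C : ℝ} (hC : ∀ i a p, |dF i a p| ≤ C)
    (hcross : ∀ i j, i ≠ j → ∀ p q, 0 ≤ ∑ a, ∑ b, dF i a p * dF j b q *
      ((inner ℝ (A i a) (A j b) : ℝ) - inner ℝ (B i a) (B j b))) :
    ∫ z, ∏ i ∈ s, F i (fun a => inner ℝ (B i a) z) ∂(stdGaussian E) ≤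
      ∫ z, ∏ i ∈ s, F i (fun a => inner ℝ (A i a) z) ∂(stdGaussian E) := by
  obtain ⟨w, hw⟩ : ∃ w : ℝ → ι → κ → E,
      ∀ θ i a, w θ i a = Real.cos θ • B i a + Real.sin θ • A i a := ⟨_, fun _ _ _ => rfl⟩
  obtain ⟨c, hc⟩ : ∃ c : ℝ → ι → κ → E,
      ∀ θ i a, c θ i a = -Real.sin θ • B i a + Real.cos θ • A i a := ⟨_, fun _ _ _ => rfl⟩
  have hFc : ∀ i, Continuous (F i) := fun i =>
    continuous_iff_continuousAt.2 fun p => (hF i p).continuousAt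
  -- inner products along the path
  have hBA : ∀ i a j b, (inner ℝ (B i a) (A j b) : ℝ) = 0 := fun i a j b => by
    rw [real_inner_comm, hAB]
  have hwc : ∀ θ i a j b, (inner ℝ (w θ j b) (c θ i a) : ℝ) = Real.sin θ * Real.cos θ *
      ((inner ℝ (A i a) (A j b) : ℝ) - inner ℝ (B i a) (B j b)) := by
    intro θ i a j b
    rw [hw, hc]
    simp only [inner_add_left, inner_add_right, real_inner_smul_left, real_inner_smul_right,
      hAB, hBA]
    rw [real_inner_comm (B j b), real_inner_comm (A j b)]
    ring
  have hwc0 : ∀ θ i a b, (inner ℝ (w θ i b) (c θ i a) : ℝ) = 0 := by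
    intro θ i a b
    rw [hwc, hsame, sub_self, mul_zero]
  have hWcont : ∀ θ i, Continuous fun z : E => (fun a => (inner ℝ (w θ i a) z : ℝ)) :=
    fun θ i => continuous_pi fun a => by fun_prop
  -- the derivative of the integrand along the path
  obtain ⟨D, hD⟩ : ∃ D : ℝ → E → ℝ, ∀ θ z, D θ z = ∑ i ∈ s,
      (∏ j ∈ s.erase i, F j (fun a => inner ℝ (w θ j a) z)) •
        ∑ a, dF i a (fun a => inner ℝ (w θ i a) z) * (inner ℝ (c θ i a) z : ℝ) :=
    ⟨_, fun _ _ => rfl⟩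
  have hDcont : ∀ θ, Continuous (D θ) := by
    intro θ
    simp only [funext (hD θ), smul_eq_mul]
    refine continuous_finsetSum _ fun i _ => Continuous.mul ?_ ?_
    · exact continuous_finsetProd _ fun j _ => (hFc j).comp (hWcont θ j)
    · exact continuous_finsetSum _ fun a _ =>
        ((hdF i a).comp (hWcont θ i)).mul (by fun_prop)
  have hpath : ∀ z θ, HasDerivAt
      (fun θ => ∏ i ∈ s, F i (fun a => (inner ℝ (w θ i a) z : ℝ))) (D θ z) θ := by
    intro z θ
    rw [hD]
    refine HasDerivAt.fun_finsetProd fun i _ => ?_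
    refine hasDerivAt_comp_of_partials (hF i) fun a => ?_
    have h1 := ((Real.hasDerivAt_cos θ).mul_const (inner ℝ (B i a) z : ℝ)).add
      ((Real.hasDerivAt_sin θ).mul_const (inner ℝ (A i a) z : ℝ))
    refine (h1.congr_deriv ?_).congr_of_eventuallyEq (Eventually.of_forall fun θ => ?_)
    · rw [hc, inner_add_left, real_inner_smul_left, real_inner_smul_left]
    · simp only [hw, inner_add_left, real_inner_smul_left, Pi.add_apply]
  have hcn : ∀ θ i a, ‖c θ i a‖ ≤ ‖B i a‖ + ‖A i a‖ := by
    intro θ i a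
    rw [hc]
    refine (norm_add_le _ _).trans (add_le_add ?_ ?_)
    · rw [norm_smul, norm_neg, Real.norm_eq_abs]
      exact mul_le_of_le_one_left (norm_nonneg _) (Real.abs_sin_le_one θ)
    · rw [norm_smul, Real.norm_eq_abs]
      exact mul_le_of_le_one_left (norm_nonneg _) (Real.abs_cos_le_one θ)
  have hDbound : ∀ θ z, ‖D θ z‖ ≤ (∑ i ∈ s, ∑ a, C * (‖B i a‖ + ‖A i a‖)) * ‖z‖ := by
    intro θ z
    rw [hD, Finset.sum_mul]
    refine (norm_sum_le _ _).trans (Finset.sum_le_sum fun i _ => ?_)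
    rw [norm_smul, Finset.sum_mul]
    have h1 : ‖∏ j ∈ s.erase i, F j (fun a => inner ℝ (w θ j a) z)‖ ≤ 1 :=
      abs_prod_le_one _ (fun j => hF0 j _) fun j => hF1 j _
    refine (mul_le_of_le_one_left (norm_nonneg _) h1).trans
      ((norm_sum_le _ _).trans (Finset.sum_le_sum fun a _ => ?_))
    rw [norm_mul, mul_assoc]
    refine mul_le_mul (hC i a _) ((norm_inner_le_norm _ _).trans ?_) (norm_nonneg _)
      ((abs_nonneg _).trans (hC i a 0))
    exact mul_le_mul_of_nonneg_right (hcn θ i a) (norm_nonneg _)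
  have hbi : Integrable (fun z : E => (∑ i ∈ s, ∑ a, C * (‖B i a‖ + ‖A i a‖)) * ‖z‖)
      (stdGaussian E) := (IsGaussian.integrable_id.norm).const_mul _
  have hprodc : ∀ θ, Continuous fun z : E =>
      ∏ i ∈ s, F i (fun a => (inner ℝ (w θ i a) z : ℝ)) := fun θ =>
    continuous_finsetProd _ fun j _ => (hFc j).comp (hWcont θ j)
  have hderiv : ∀ θ, HasDerivAt (fun θ => ∫ z, ∏ i ∈ s, F i (fun a => (inner ℝ (w θ i a) z : ℝ))
      ∂(stdGaussian E)) (∫ z, D θ z ∂(stdGaussian E)) θ := by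
    intro θ
    refine (hasDerivAt_integral_of_dominated_loc_of_deriv_le (s := Set.univ) (F' := D)
      univ_mem (Eventually.of_forall fun θ => (hprodc θ).aestronglyMeasurable) ?_
      (hDcont θ).aestronglyMeasurable (ae_of_all _ fun z θ _ => hDbound θ z) hbi
      (ae_of_all _ fun z θ _ => hpath z θ)).2
    exact Integrable.of_bound (hprodc θ).aestronglyMeasurable 1
      (ae_of_all _ fun z => abs_prod_le_one _ (fun j => hF0 j _) fun j => hF1 j _)
  -- integration by parts in each term of the derivative
  have hterm : ∀ θ, 0 ≤ Real.sin θ * Real.cos θ → ∀ i ∈ s, ∀ a,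
      ∃ H' : E → ℝ, Integrable H' (stdGaussian E) ∧
      (∫ z, (∏ j ∈ s.erase i, F j (fun a => inner ℝ (w θ j a) z)) *
        (dF i a (fun a => inner ℝ (w θ i a) z) * (inner ℝ (c θ i a) z : ℝ)) ∂(stdGaussian E)
        = ∫ z, H' z ∂(stdGaussian E)) ∧
      ∀ z, H' z = ∑ j ∈ s.erase i,
        (∏ k ∈ (s.erase i).erase j, F k (fun a => inner ℝ (w θ k a) z)) *
        (∑ b, dF i a (fun a => inner ℝ (w θ i a) z) * dF j b (fun a => inner ℝ (w θ j a) z) *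
          (Real.sin θ * Real.cos θ *
            ((inner ℝ (A i a) (A j b) : ℝ) - inner ℝ (B i a) (B j b)))) := by
    intro θ _ i _ a
    obtain ⟨H', hH'⟩ : ∃ H' : E → ℝ, ∀ z, H' z = ∑ j ∈ s.erase i,
        (∏ k ∈ (s.erase i).erase j, F k (fun a => inner ℝ (w θ k a) z)) *
        (∑ b, dF i a (fun a => inner ℝ (w θ i a) z) * dF j b (fun a => inner ℝ (w θ j a) z) *
          (Real.sin θ * Real.cos θ *
            ((inner ℝ (A i a) (A j b) : ℝ) - inner ℝ (B i a) (B j b)))) := ⟨_, fun _ => rfl⟩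
    have hH'c : Continuous H' := by
      simp only [funext hH']
      refine continuous_finsetSum _ fun j _ => Continuous.mul ?_ ?_
      · exact continuous_finsetProd _ fun k _ => (hFc k).comp (hWcont θ k)
      · exact continuous_finsetSum _ fun b _ =>
          (((hdF i a).comp (hWcont θ i)).mul ((hdF j b).comp (hWcont θ j))).mul continuous_const
    have hH'b : ∀ z, |H' z| ≤ ∑ j ∈ s.erase i, ∑ b, C * C * |Real.sin θ * Real.cos θ *
            ((inner ℝ (A i a) (A j b) : ℝ) - inner ℝ (B i a) (B j b))| := by
      intro z
      rw [hH']
      refine (Finset.abs_sum_le_sum_abs _ _).trans (Finset.sum_le_sum fun j _ => ?_)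
      rw [abs_mul]
      refine (mul_le_of_le_one_left (abs_nonneg _)
        (abs_prod_le_one _ (fun j => hF0 j _) fun j => hF1 j _)).trans
        ((Finset.abs_sum_le_sum_abs _ _).trans (Finset.sum_le_sum fun b _ => ?_))
      rw [abs_mul, abs_mul]
      gcongr
      · exact (abs_nonneg _).trans (hC i a 0)
      · exact hC _ _ _
      · exact hC _ _ _
    refine ⟨H', Integrable.of_bound hH'c.aestronglyMeasurable _ (ae_of_all _ hH'b), ?_, hH'⟩
    have hHc : Continuous fun z : E => dF i a (fun a => inner ℝ (w θ i a) z) *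
        ∏ j ∈ s.erase i, F j (fun a => (inner ℝ (w θ j a) z : ℝ)) :=
      ((hdF i a).comp (hWcont θ i)).mul
        (continuous_finsetProd _ fun k _ => (hFc k).comp (hWcont θ k))
    rw [← integral_inner_mul_stdGaussian (c := c θ i a) (C := C) hHc hH'c ?_ ?_ hH'b]
    · congr 1
      ext z
      ring
    · intro z
      -- the factor `dF i a` is constant along `c θ i a`
      have hconst : ∀ t : ℝ, (fun a' => (inner ℝ (w θ i a') (z + t • c θ i a) : ℝ))
          = fun a' => inner ℝ (w θ i a') z := by
        intro t
        ext a'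
        rw [inner_add_right, real_inner_smul_right, hwc0, mul_zero, add_zero]
      simp only [hconst]
      have h1 : HasDerivAt (fun t : ℝ => ∏ j ∈ s.erase i,
          F j (fun a' => (inner ℝ (w θ j a') (z + t • c θ i a) : ℝ)))
          (∑ j ∈ s.erase i, (∏ k ∈ (s.erase i).erase j,
            F k (fun a' => (inner ℝ (w θ k a') (z + (0 : ℝ) • c θ i a) : ℝ))) •
            ∑ b, dF j b (fun a' => (inner ℝ (w θ j a') (z + (0 : ℝ) • c θ i a) : ℝ)) *
              (inner ℝ (w θ j b) (c θ i a) : ℝ)) 0 := by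
        refine HasDerivAt.fun_finsetProd fun j _ => ?_
        refine hasDerivAt_comp_of_partials (hF j) fun b => ?_
        have h2 := ((hasDerivAt_id (0 : ℝ)).mul_const
          (inner ℝ (w θ j b) (c θ i a) : ℝ)).const_add (inner ℝ (w θ j b) z : ℝ)
        refine (h2.congr_deriv (one_mul _)).congr_of_eventuallyEq (Eventually.of_forall fun t => ?_)
        simp only [inner_add_right, real_inner_smul_right, id]
      refine (h1.const_mul (dF i a (fun a' => inner ℝ (w θ i a') z))).congr_deriv ?_
      rw [hH', Finset.mul_sum]
      refine Finset.sum_congr rfl fun j _ => ?_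
      simp only [zero_smul, add_zero, smul_eq_mul]
      rw [mul_left_comm, Finset.mul_sum]
      congr 1
      refine Finset.sum_congr rfl fun b _ => ?_
      rw [hwc]
      ring
    · intro z
      rw [abs_mul]
      exact (mul_le_of_le_one_right (abs_nonneg _)
        (abs_prod_le_one _ (fun j => hF0 j _) fun j => hF1 j _)).trans (hC _ _ _)
  have hnonneg : ∀ θ, 0 ≤ Real.sin θ * Real.cos θ → 0 ≤ ∫ z, D θ z ∂(stdGaussian E) := by
    intro θ hθ
    have hti : ∀ i ∈ s, ∀ a, Integrable (fun z : E =>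
        (∏ j ∈ s.erase i, F j (fun a => inner ℝ (w θ j a) z)) *
        (dF i a (fun a => inner ℝ (w θ i a) z) * (inner ℝ (c θ i a) z : ℝ))) (stdGaussian E) := by
      intro i _ a
      have h1 := (IsGaussian.integrable_id (μ := stdGaussian E)).const_inner (𝕜 := ℝ) (c θ i a)
      have h2 := h1.bdd_mul (c := C)
        (f := fun z : E => (∏ j ∈ s.erase i, F j (fun a => inner ℝ (w θ j a) z)) *
          dF i a (fun a => inner ℝ (w θ i a) z)) (Continuous.aestronglyMeasurable
          ((continuous_finsetProd _ fun k _ => (hFc k).comp (hWcont θ k)).mul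
            ((hdF i a).comp (hWcont θ i))))
        (ae_of_all _ fun z => by
          rw [norm_mul]
          exact (mul_le_of_le_one_left (norm_nonneg _)
            (abs_prod_le_one _ (fun j => hF0 j _) fun j => hF1 j _)).trans (hC _ _ _))
      refine h2.congr (ae_of_all _ fun z => ?_)
      simp only [id]
      ring
    simp only [hD, smul_eq_mul, Finset.mul_sum]
    rw [integral_finsetSum _ fun i hi => integrable_finsetSum _ fun a _ => hti i hi a]
    refine Finset.sum_nonneg fun i hi => ?_
    rw [integral_finsetSum _ fun a _ => hti i hi a]
    choose H' hH'i hH'e hH' using hterm θ hθ i hi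
    rw [Finset.sum_congr rfl fun a _ => hH'e a, ← integral_finsetSum _ fun a _ => hH'i a]
    refine integral_nonneg fun z => ?_
    simp only [hH', Pi.zero_apply]
    rw [Finset.sum_comm]
    refine Finset.sum_nonneg fun j hj => ?_
    rw [← Finset.mul_sum]
    refine mul_nonneg (Finset.prod_nonneg fun k _ => hF0 k _) ?_
    have h1 := mul_nonneg hθ (hcross i j (Finset.ne_of_mem_erase hj).symm
      (fun a => inner ℝ (w θ i a) z) (fun a => inner ℝ (w θ j a) z))
    rw [Finset.mul_sum] at h1
    refine h1.trans_eq (Finset.sum_congr rfl fun a _ => ?_)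
    rw [Finset.mul_sum]
    exact Finset.sum_congr rfl fun b _ => by ring
  have hmono := monotoneOn_of_deriv_nonneg (convex_Icc 0 (Real.pi / 2))
    (fun θ _ => (hderiv θ).continuousAt.continuousWithinAt)
    (fun θ _ => (hderiv θ).differentiableAt.differentiableWithinAt)
    (fun θ hθ => by
      rw [(hderiv θ).deriv]
      rw [interior_Icc] at hθ
      have := Real.pi_pos
      exact hnonneg θ (mul_nonneg (Real.sin_nonneg_of_nonneg_of_le_pi hθ.1.le (by linarith [hθ.2]))
        (Real.cos_nonneg_of_neg_pi_div_two_le_of_le (by linarith [hθ.1]) hθ.2.le)))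
  have hpi := Real.pi_pos
  have h := hmono (Set.left_mem_Icc.2 (by positivity)) (Set.right_mem_Icc.2 (by positivity))
    (show (0 : ℝ) ≤ Real.pi / 2 by positivity)
  simpa [hw] using h

end Comparison

/-! ### Products of standard Gaussian measures -/

theorem stdGaussian_real : stdGaussian ℝ = gaussianReal 0 1 := by
  apply Measure.ext_of_charFun
  ext t
  rw [charFun_stdGaussian, charFun_gaussianReal, ← Complex.ofReal_pow, Real.norm_eq_abs, sq_abs]
  congr 1
  push_cast
  simp [neg_div]

theorem map_toLp_prod_stdGaussian (E₁ E₂ : Type*)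
    [NormedAddCommGroup E₁] [InnerProductSpace ℝ E₁] [FiniteDimensional ℝ E₁]
    [MeasurableSpace E₁] [BorelSpace E₁]
    [NormedAddCommGroup E₂] [InnerProductSpace ℝ E₂] [FiniteDimensional ℝ E₂]
    [MeasurableSpace E₂] [BorelSpace E₂] :
    ((stdGaussian E₁).prod (stdGaussian E₂)).map (WithLp.toLp 2)
      = stdGaussian (WithLp 2 (E₁ × E₂)) := by
  have : IsProbabilityMeasure (((stdGaussian E₁).prod (stdGaussian E₂)).map (WithLp.toLp 2)) :=
    Measure.isProbabilityMeasure_map (by fun_prop)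
  apply Measure.ext_of_charFun
  ext t
  rw [charFun_prod, charFun_stdGaussian, charFun_stdGaussian, charFun_stdGaussian,
    ← Complex.exp_add, ← Complex.ofReal_pow, ← Complex.ofReal_pow, ← Complex.ofReal_pow,
    WithLp.prod_norm_sq_eq_of_L2]
  congr 1
  push_cast
  simp only [WithLp.ofLp_fst, WithLp.ofLp_snd]
  ring

theorem map_toLp_pi_stdGaussian (d E : Type*) [Fintype d]
    [NormedAddCommGroup E] [InnerProductSpace ℝ E] [FiniteDimensional ℝ E]
    [MeasurableSpace E] [BorelSpace E] :
    (Measure.pi fun _ : d => stdGaussian E).map (WithLp.toLp 2)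
      = stdGaussian (PiLp 2 fun _ : d => E) := by
  have : IsProbabilityMeasure ((Measure.pi fun _ : d => stdGaussian E).map (WithLp.toLp 2)) :=
    Measure.isProbabilityMeasure_map (by fun_prop)
  apply Measure.ext_of_charFun (E := PiLp 2 fun _ : d => E)
  ext t
  rw [charFun_pi, charFun_stdGaussian, ← Complex.ofReal_pow, PiLp.norm_sq_eq_of_L2]
  simp_rw [charFun_stdGaussian, ← Complex.exp_sum]
  congr 1
  push_cast
  rw [neg_div, Finset.sum_div, ← Finset.sum_neg_distrib]
  simp_rw [neg_div]

theorem half_le_gaussianReal_Iic : 2⁻¹ ≤ gaussianReal 0 1 (Set.Iic 0) := by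
  have h1 : gaussianReal 0 1 (Set.Ici 0) = gaussianReal 0 1 (Set.Iic 0) := by
    have h := gaussianReal_map_neg (μ := 0) (v := 1)
    rw [neg_zero] at h
    conv_lhs => rw [← h, Measure.map_apply measurable_neg measurableSet_Ici]
    simp
  have h2 : 1 ≤ gaussianReal 0 1 (Set.Iic 0) + gaussianReal 0 1 (Set.Ici 0) := by
    rw [← measure_univ (μ := gaussianReal 0 1), ← Set.Iic_union_Ici (a := (0 : ℝ))]
    exact measure_union_le _ _
  rw [h1, ← two_mul] at h2
  exact (ENNReal.inv_le_iff_le_mul (by simp) (by simp)).2 h2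

/-! ### Gordon's inequality -/

/-- A smooth approximation of the indicator function of `[0, ∞)`. -/
def softStep (M : ℕ) (x : ℝ) : ℝ := 1 / 2 + Real.arctan ((M : ℝ) ^ 2 * x + M) / Real.pi

theorem softStep_nonneg (M : ℕ) (x : ℝ) : 0 ≤ softStep M x := by
  have h := Real.neg_pi_div_two_lt_arctan ((M : ℝ) ^ 2 * x + M)
  have hp := Real.pi_pos
  rw [softStep]
  have : -(1 / 2) ≤ Real.arctan ((M : ℝ) ^ 2 * x + M) / Real.pi := by
    rw [le_div_iff₀ hp]; linarith
  linarith

theorem softStep_le_one (M : ℕ) (x : ℝ) : softStep M x ≤ 1 := by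
  have h := Real.arctan_lt_pi_div_two ((M : ℝ) ^ 2 * x + M)
  have hp := Real.pi_pos
  rw [softStep]
  have : Real.arctan ((M : ℝ) ^ 2 * x + M) / Real.pi ≤ 1 / 2 := by
    rw [div_le_iff₀ hp]; linarith
  linarith

theorem tendsto_softStep (x : ℝ) :
    Tendsto (fun M => softStep M x) atTop (𝓝 ((Set.Ici (0 : ℝ)).indicator 1 x)) := by
  have hM : Tendsto (fun M : ℕ => (M : ℝ)) atTop atTop := tendsto_natCast_atTop_atTop
  have hpi := Real.pi_ne_zero
  by_cases hx : 0 ≤ x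
  · have h1 : Tendsto (fun M : ℕ => (M : ℝ) ^ 2 * x + M) atTop atTop :=
      tendsto_atTop_mono (fun M => le_add_of_nonneg_left (by positivity)) hM
    have h2 := (((Real.tendsto_arctan_atTop.mono_right nhdsWithin_le_nhds).comp h1).div_const
      Real.pi).const_add (1 / 2)
    have h3 : (Set.Ici (0 : ℝ)).indicator (1 : ℝ → ℝ) x = 1 / 2 + Real.pi / 2 / Real.pi := by
      rw [Set.indicator_of_mem (show x ∈ Set.Ici (0 : ℝ) from hx)]
      simp only [Pi.one_apply]
      field_simp
      norm_num
    rw [h3]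
    exact h2
  · have h1 : Tendsto (fun M : ℕ => (M : ℝ) * ((M : ℝ) * x + 1)) atTop atBot :=
      hM.atTop_mul_atBot₀
        (tendsto_atBot_add_const_right _ 1 (hM.atTop_mul_const_of_neg (not_le.1 hx)))
    have h2 := (((Real.tendsto_arctan_atBot.mono_right nhdsWithin_le_nhds).comp h1).div_const
      Real.pi).const_add (1 / 2)
    have h3 : (Set.Ici (0 : ℝ)).indicator (1 : ℝ → ℝ) x = 1 / 2 + -(Real.pi / 2) / Real.pi := by
      rw [Set.indicator_of_notMem (show x ∉ Set.Ici (0 : ℝ) from hx)]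
      field_simp
      norm_num
    rw [h3]
    refine h2.congr fun M => ?_
    simp only [softStep, Function.comp]
    ring_nf

theorem hasDerivAt_softStep (M : ℕ) (x : ℝ) :
    HasDerivAt (softStep M)
      ((M : ℝ) ^ 2 / (1 + ((M : ℝ) ^ 2 * x + M) ^ 2) / Real.pi) x := by
  have h1 : HasDerivAt (fun x : ℝ => (M : ℝ) ^ 2 * x + M) ((M : ℝ) ^ 2) x := by
    simpa using ((hasDerivAt_id x).const_mul ((M : ℝ) ^ 2)).add_const (M : ℝ)
  have h2 := ((h1.arctan).div_const Real.pi).const_add (1 / 2)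
  refine h2.congr_deriv ?_
  ring

/-- The comparison inequality for two families of Gaussian blocks living on different spaces. -/
theorem integral_prod_comparison_of_prod {ι κ V₁ V₂ : Type*} [Fintype κ] [DecidableEq ι]
    [NormedAddCommGroup V₁] [InnerProductSpace ℝ V₁] [FiniteDimensional ℝ V₁]
    [MeasurableSpace V₁] [BorelSpace V₁]
    [NormedAddCommGroup V₂] [InnerProductSpace ℝ V₂] [FiniteDimensional ℝ V₂]
    [MeasurableSpace V₂] [BorelSpace V₂] (s : Finset ι)
    (A : ι → κ → V₁) (B : ι → κ → V₂)
    (hsame : ∀ i a b, (inner ℝ (A i a) (A i b) : ℝ) = inner ℝ (B i a) (B i b))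
    (F : ι → (κ → ℝ) → ℝ) (dF : ι → κ → (κ → ℝ) → ℝ)
    (hF : ∀ i p, HasFDerivAt (F i)
      (∑ a, dF i a p • (ContinuousLinearMap.proj a : (κ → ℝ) →L[ℝ] ℝ)) p)
    (hdF : ∀ i a, Continuous (dF i a)) (hF0 : ∀ i p, 0 ≤ F i p) (hF1 : ∀ i p, F i p ≤ 1)
    {C : ℝ} (hC : ∀ i a p, |dF i a p| ≤ C)
    (hcross : ∀ i j, i ≠ j → ∀ p q, 0 ≤ ∑ a, ∑ b, dF i a p * dF j b q *
      ((inner ℝ (A i a) (A j b) : ℝ) - inner ℝ (B i a) (B j b))) :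
    ∫ z, ∏ i ∈ s, F i (fun a => inner ℝ (B i a) z) ∂(stdGaussian V₂) ≤
      ∫ z, ∏ i ∈ s, F i (fun a => inner ℝ (A i a) z) ∂(stdGaussian V₁) := by
  have hFc : ∀ i, Continuous (F i) := fun i =>
    continuous_iff_continuousAt.2 fun p => (hF i p).continuousAt
  have h := integral_prod_comparison s
    (fun i a => (WithLp.toLp 2 (A i a, (0 : V₂)) : WithLp 2 (V₁ × V₂)))
    (fun i a => WithLp.toLp 2 ((0 : V₁), B i a))
    (fun i a j b => by simp [WithLp.prod_inner_apply])
    (fun i a b => by simp [WithLp.prod_inner_apply, hsame]) F dF hF hdF hF0 hF1 hC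
    (fun i j hij p q => by simpa [WithLp.prod_inner_apply] using hcross i j hij p q)
  have hint : ∀ (Z : ι → κ → WithLp 2 (V₁ × V₂)), AEStronglyMeasurable
      (fun z => ∏ i ∈ s, F i fun o => inner ℝ (Z i o) z)
      (((stdGaussian V₁).prod (stdGaussian V₂)).map (WithLp.toLp 2)) := fun Z =>
    (continuous_finsetProd _ fun i _ => (hFc i).comp
      (continuous_pi fun o => by fun_prop)).aestronglyMeasurable
  rw [← map_toLp_prod_stdGaussian V₁ V₂, integral_map (by fun_prop) (hint _),
    integral_map (by fun_prop) (hint _)] at h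
  simp only [WithLp.prod_inner_apply, inner_zero_left, add_zero, zero_add] at h
  have e1 := integral_fun_snd (μ := stdGaussian V₁) (ν := stdGaussian V₂)
    (fun y : V₂ => ∏ i ∈ s, F i (fun a => inner ℝ (B i a) y))
  have e2 := integral_fun_fst (μ := stdGaussian V₁) (ν := stdGaussian V₂)
    (fun y : V₁ => ∏ i ∈ s, F i (fun a => inner ℝ (A i a) y))
  rw [probReal_univ, one_smul] at e1 e2
  rw [← e1, ← e2]
  exact h

theorem measurable_comp_inner {ι κ V : Type*} [NormedAddCommGroup V] [InnerProductSpace ℝ V]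
    [MeasurableSpace V] [BorelSpace V] (Z : ι → κ → V) {f : (ι → κ → ℝ) → ℝ}
    (hf : Continuous f) : Measurable fun z : V => f fun i o => inner ℝ (Z i o) z :=
  (hf.comp (by fun_prop : Continuous fun z : V => fun i o => (inner ℝ (Z i o) z : ℝ))).measurable

section Gordon

variable {d E₁ F : Type*} [Fintype d] [DecidableEq d]
  [NormedAddCommGroup E₁] [InnerProductSpace ℝ E₁] [FiniteDimensional ℝ E₁]
  [MeasurableSpace E₁] [BorelSpace E₁]
  [NormedAddCommGroup F] [InnerProductSpace ℝ F] [FiniteDimensional ℝ F]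
  [MeasurableSpace F] [BorelSpace F]

/-- Gordon's inequality for finitely many indices, with smooth approximations of the indicator
functions. -/
theorem integral_prod_softStep_le (s : Finset ℕ) (M : ℕ) (x : ℕ → F) (α : ℕ → d → E₁)
    (hα : ∀ i j a b, (inner ℝ (α i a) (α j b) : ℝ) = if a = b then inner ℝ (x i) (x j) else 0)
    (Q : ℕ → (d → ℝ) → ℝ) (dQ : ℕ → d → (d → ℝ) → ℝ)
    (hQ : ∀ i v, HasFDerivAt (Q i)
      (∑ a, dQ i a v • (ContinuousLinearMap.proj a : (d → ℝ) →L[ℝ] ℝ)) v)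
    (hdQ : ∀ i a, Continuous (dQ i a)) (hQ1 : ∀ i v, ∑ a, dQ i a v ^ 2 ≤ 1) :
    ∫ p, ∏ i ∈ s, softStep M ((inner ℝ (x i) p.1 : ℝ) + Q i (‖x i‖ • p.2))
        ∂((stdGaussian F).prod (Measure.pi fun _ : d => gaussianReal 0 1)) ≤
      ∫ p, ∏ i ∈ s, softStep M (‖x i‖ * p.2 + Q i (fun a => inner ℝ (α i a) p.1))
        ∂((stdGaussian E₁).prod (gaussianReal 0 1)) := by
  obtain ⟨A, hAn, hAs⟩ : ∃ A : ℕ → Option d → WithLp 2 (E₁ × ℝ),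
      (∀ i, A i none = WithLp.toLp 2 (0, ‖x i‖)) ∧
      ∀ i a, A i (some a) = WithLp.toLp 2 (α i a, 0) :=
    ⟨fun i o => o.elim (WithLp.toLp 2 (0, ‖x i‖)) fun a => WithLp.toLp 2 (α i a, 0),
      fun _ => rfl, fun _ _ => rfl⟩
  obtain ⟨B, hBn, hBs⟩ : ∃ B : ℕ → Option d → WithLp 2 (F × EuclideanSpace ℝ d),
      (∀ i, B i none = WithLp.toLp 2 (x i, 0)) ∧
      ∀ i a, B i (some a) = WithLp.toLp 2 (0, ‖x i‖ • EuclideanSpace.single a (1 : ℝ)) :=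
    ⟨fun i o => o.elim (WithLp.toLp 2 (x i, 0)) fun a =>
      WithLp.toLp 2 (0, ‖x i‖ • EuclideanSpace.single a (1 : ℝ)), fun _ => rfl, fun _ _ => rfl⟩
  have hAB : ∀ i j a b, (inner ℝ (A i a) (A j b) : ℝ) - inner ℝ (B i a) (B j b) =
      a.elim (b.elim (‖x i‖ * ‖x j‖ - inner ℝ (x i) (x j)) fun _ => 0) fun a' =>
        b.elim 0 fun b' => if a' = b' then -(‖x i‖ * ‖x j‖ - inner ℝ (x i) (x j)) else 0 := by
    intro i j a b
    rcases a with _ | a <;> rcases b with _ | b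
    · simp [hAn, hBn, WithLp.prod_inner_apply, mul_comm]
    · simp [hAn, hBn, hAs, hBs, WithLp.prod_inner_apply]
    · simp [hAn, hBn, hAs, hBs, WithLp.prod_inner_apply]
    · by_cases h : a = b
      · subst h
        simp [hAs, hBs, WithLp.prod_inner_apply, hα, inner_smul_left, inner_smul_right]
        ring
      · simp [hAs, hBs, WithLp.prod_inner_apply, hα, inner_smul_left, inner_smul_right,
          EuclideanSpace.inner_single_left, h]
  let G : ℕ → (Option d → ℝ) → ℝ := fun i p => p none + Q i (fun a => p (some a))
  let D : (Option d → ℝ) → ℕ → ℝ := fun p i =>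
    (M : ℝ) ^ 2 / (1 + ((M : ℝ) ^ 2 * G i p + M) ^ 2) / Real.pi
  let dF : ℕ → Option d → (Option d → ℝ) → ℝ := fun i o p =>
    D p i * o.elim 1 (fun a => dQ i a (fun a => p (some a)))
  have hQc : ∀ i, Continuous (Q i) := fun i =>
    continuous_iff_continuousAt.2 fun p => (hQ i p).continuousAt
  have hGc : ∀ i, Continuous (G i) := fun i => by
    have := hQc i
    fun_prop
  have hGd : ∀ i p, HasFDerivAt (G i) (∑ o : Option d,
      (o.elim 1 (fun a => dQ i a (fun a => p (some a))) : ℝ) •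
        (ContinuousLinearMap.proj o : (Option d → ℝ) →L[ℝ] ℝ)) p := by
    intro i p
    have h1 : HasFDerivAt (fun p : Option d → ℝ => p none)
      (ContinuousLinearMap.proj none : (Option d → ℝ) →L[ℝ] ℝ) p :=
      (ContinuousLinearMap.proj none : (Option d → ℝ) →L[ℝ] ℝ).hasFDerivAt
    have h2 : HasFDerivAt (fun (p : Option d → ℝ) (a : d) => p (some a))
        (ContinuousLinearMap.pi fun a =>
          (ContinuousLinearMap.proj (some a) : (Option d → ℝ) →L[ℝ] ℝ)) p :=
      (ContinuousLinearMap.pi fun a =>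
          (ContinuousLinearMap.proj (some a) : (Option d → ℝ) →L[ℝ] ℝ)).hasFDerivAt
    refine (h1.add ((hQ i _).comp p h2)).congr_fderiv ?_
    ext v
    simp [Fintype.sum_option]
  have hD0 : ∀ p i, 0 ≤ D p i := fun p i => by
    have := Real.pi_pos
    positivity
  have hDle : ∀ p i, D p i ≤ (M : ℝ) ^ 2 / Real.pi := by
    intro p i
    have := Real.pi_pos
    refine div_le_div_of_nonneg_right (div_le_self (by positivity) ?_) this.le
    nlinarith [sq_nonneg ((M : ℝ) ^ 2 * G i p + M)]
  have hDc : ∀ i, Continuous fun p => D p i := fun i => by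
    have := hGc i
    refine Continuous.div_const (Continuous.div continuous_const (by fun_prop) fun p => ?_) _
    positivity
  have hcomp := integral_prod_comparison_of_prod s A B
    (fun i a b => by
      refine sub_eq_zero.1 ?_
      rw [hAB, real_inner_self_eq_norm_sq]
      rcases a with _ | a <;> rcases b with _ | b <;> simp [sq])
    (fun i p => softStep M (G i p)) dF
    (fun i p => by
      refine ((hasDerivAt_softStep M (G i p)).comp_hasFDerivAt p (hGd i p)).congr_fderiv ?_
      rw [Finset.smul_sum]
      refine Finset.sum_congr rfl fun o _ => ?_
      rw [smul_smul])
    (fun i o => by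
      refine (hDc i).mul ?_
      rcases o with _ | a
      · exact continuous_const
      · exact (hdQ i a).comp (by fun_prop))
    (fun i p => softStep_nonneg _ _) (fun i p => softStep_le_one _ _)
    (C := (M : ℝ) ^ 2 / Real.pi)
    (fun i o p => by
      simp only [dF]
      rw [abs_mul, abs_of_nonneg (hD0 p i)]
      refine (mul_le_of_le_one_right (hD0 p i) ?_).trans (hDle p i)
      rcases o with _ | a
      · simp
      · have h1 : dQ i a (fun a => p (some a)) ^ 2 ≤ 1 :=
          (Finset.single_le_sum (f := fun a => dQ i a (fun a => p (some a)) ^ 2)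
            (fun a _ => sq_nonneg _) (Finset.mem_univ a)).trans (hQ1 i _)
        exact abs_le_one_iff_mul_self_le_one.2 (by rw [← sq]; exact h1))
    (fun i j _ p q => by
      have hcs : ∑ a, dQ i a (fun a => p (some a)) * dQ j a (fun a => q (some a)) ≤ 1 := by
        have h1 := hQ1 i (fun a => p (some a))
        have h2 := hQ1 j (fun a => q (some a))
        have h3 : ∑ a, dQ i a (fun a => p (some a)) * dQ j a (fun a => q (some a)) ≤
            ∑ a, (dQ i a (fun a => p (some a)) ^ 2 + dQ j a (fun a => q (some a)) ^ 2) / 2 :=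
          Finset.sum_le_sum fun a _ => by nlinarith [sq_nonneg (dQ i a (fun a => p (some a)) -
            dQ j a (fun a => q (some a)))]
        rw [← Finset.sum_div, Finset.sum_add_distrib] at h3
        linarith
      have hval : ∑ a, ∑ b, dF i a p * dF j b q *
          ((inner ℝ (A i a) (A j b) : ℝ) - inner ℝ (B i a) (B j b)) =
          D p i * D q j * ((‖x i‖ * ‖x j‖ - inner ℝ (x i) (x j)) *
            (1 - ∑ a, dQ i a (fun a => p (some a)) * dQ j a (fun a => q (some a)))) := by
        simp only [Fintype.sum_option, hAB, Option.elim, mul_zero, Finset.sum_const_zero,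
          add_zero, zero_add, mul_ite, Finset.sum_ite_eq, Finset.mem_univ, if_true]
        simp only [dF, Option.elim]
        have hsum : ∑ a, D p i * dQ i a (fun a => p (some a)) *
            (D q j * dQ j a (fun a => q (some a))) * -(‖x i‖ * ‖x j‖ - inner ℝ (x i) (x j)) =
            -(D p i * D q j * (‖x i‖ * ‖x j‖ - inner ℝ (x i) (x j)) *
              ∑ a, dQ i a (fun a => p (some a)) * dQ j a (fun a => q (some a))) := by
          rw [Finset.mul_sum, ← Finset.sum_neg_distrib]
          exact Finset.sum_congr rfl fun a _ => by ring
        rw [hsum]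
        ring
      rw [hval]
      refine mul_nonneg (mul_nonneg (hD0 p i) (hD0 q j)) (mul_nonneg ?_ ?_)
      · exact sub_nonneg.2 (real_inner_le_norm _ _)
      · exact sub_nonneg.2 hcs)
  have hsc : Continuous (softStep M) := continuous_iff_continuousAt.2 fun x =>
    (hasDerivAt_softStep M x).continuousAt
  have hAe : ∀ (p : E₁ × ℝ) i, G i (fun o => inner ℝ (A i o) (WithLp.toLp 2 p))
      = ‖x i‖ * p.2 + Q i (fun a => inner ℝ (α i a) p.1) := by
    intro p i
    simp [G, hAn, hAs, WithLp.prod_inner_apply, mul_comm]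
  have hBe : ∀ (p : F × (d → ℝ)) i,
      G i (fun o => inner ℝ (B i o) (WithLp.toLp 2 (p.1, WithLp.toLp 2 p.2)))
      = (inner ℝ (x i) p.1 : ℝ) + Q i (‖x i‖ • p.2) := by
    intro p i
    simp [G, hBn, hBs, WithLp.prod_inner_apply, inner_smul_left, EuclideanSpace.inner_single_left]
    rfl
  have hprodc : Continuous (fun p : ℕ → Option d → ℝ => ∏ i ∈ s, softStep M (G i (p i))) :=
    continuous_finsetProd _ fun i _ => hsc.comp ((hGc i).comp (continuous_apply i))
  have e2 : (stdGaussian F).prod ((Measure.pi fun _ : d => gaussianReal 0 1).map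
      (WithLp.toLp 2)) = ((stdGaussian F).prod (Measure.pi fun _ : d => gaussianReal 0 1)).map
      (Prod.map id (WithLp.toLp 2)) := by
    rw [← Measure.map_prod_map _ _ measurable_id (by fun_prop), Measure.map_id]
  have e3 : stdGaussian (WithLp 2 (F × EuclideanSpace ℝ d)) =
      ((stdGaussian F).prod (Measure.pi fun _ : d => gaussianReal 0 1)).map
      (fun p => WithLp.toLp 2 (p.1, WithLp.toLp 2 p.2)) := by
    rw [← map_toLp_prod_stdGaussian, ← map_pi_eq_stdGaussian, e2,
      Measure.map_map (by fun_prop) (by fun_prop)]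
    rfl
  rw [← map_toLp_prod_stdGaussian E₁ ℝ, e3, stdGaussian_real, integral_map (by fun_prop)
      (measurable_comp_inner A hprodc).aestronglyMeasurable, integral_map (by fun_prop)
      (measurable_comp_inner B hprodc).aestronglyMeasurable] at hcomp
  simp only [hAe, hBe] at hcomp
  exact hcomp

theorem tendsto_integral_prod_softStep {Ω : Type*} [MeasurableSpace Ω] (μ : Measure Ω)
    [IsProbabilityMeasure μ] (s : Finset ℕ) {f : ℕ → Ω → ℝ} (hf : ∀ i, Measurable (f i)) :
    Tendsto (fun M => ∫ ω, ∏ i ∈ s, softStep M (f i ω) ∂μ) atTop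
      (𝓝 (1 - μ.real {ω | ∃ i ∈ s, f i ω < 0})) := by
  have hms : MeasurableSet {ω | ∃ i ∈ s, f i ω < 0} := by
    have : {ω | ∃ i ∈ s, f i ω < 0} = ⋃ i ∈ s, {ω | f i ω < 0} := by ext; simp
    rw [this]
    exact Finset.measurableSet_biUnion _ fun i _ => measurableSet_lt (hf i) measurable_const
  have hlim : ∀ ω, ∏ i ∈ s, (Set.Ici (0 : ℝ)).indicator 1 (f i ω) =
      ({ω | ∃ i ∈ s, f i ω < 0}ᶜ).indicator (1 : Ω → ℝ) ω := by
    intro ω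
    by_cases h : ∃ i ∈ s, f i ω < 0
    · obtain ⟨i, hi, hlt⟩ := h
      rw [Set.indicator_of_notMem (by simpa using ⟨i, hi, hlt⟩)]
      exact Finset.prod_eq_zero hi (Set.indicator_of_notMem (by simpa using hlt) _)
    · rw [Set.indicator_of_mem (by simpa using h)]
      push Not at h
      exact Finset.prod_eq_one fun i hi => Set.indicator_of_mem (by simpa using h i hi) _
  have hval : 1 - μ.real {ω | ∃ i ∈ s, f i ω < 0} =
      ∫ ω, ∏ i ∈ s, (Set.Ici (0 : ℝ)).indicator 1 (f i ω) ∂μ := by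
    rw [integral_congr_ae (ae_of_all _ hlim), integral_indicator_one hms.compl,
      probReal_compl_eq_one_sub hms]
  rw [hval]
  have hsm : ∀ M, Measurable (softStep M) := fun M =>
    (continuous_iff_continuousAt.2 fun x => (hasDerivAt_softStep M x).continuousAt).measurable
  refine tendsto_integral_of_dominated_convergence (fun _ => (1 : ℝ))
    (fun M => (Finset.measurable_prod _ fun i _ => (hsm M).comp (hf i)).aestronglyMeasurable)
    (integrable_const _) (fun M => ae_of_all _ fun ω => ?_) (ae_of_all _ fun ω => ?_)
  · exact abs_prod_le_one s (fun i => softStep_nonneg M _) fun i => softStep_le_one M _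
  · exact tendsto_finsetProd _ fun i _ => tendsto_softStep _

/-- **Gordon's inequality**, in the form due to Thrampoulidis, Oymak and Hassibi: for a Gaussian
matrix, given here by vectors `α k a` with the covariance structure of the entries of `G (x k)`,
and `1`-Lipschitz functions `Q k`, the event `∃ k, Q k (G (x k)) < 0` is at most twice as likely as
the decoupled event in which `G (x k)` is replaced by `‖x k‖ • h` and the linear term `⟪x k, q⟫`
is added. The factor `2` comes from removing the auxiliary scalar Gaussian. -/
theorem gordon (x : ℕ → F) (α : ℕ → d → E₁)
    (hα : ∀ i j a b, (inner ℝ (α i a) (α j b) : ℝ) = if a = b then inner ℝ (x i) (x j) else 0)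
    (Q : ℕ → (d → ℝ) → ℝ) (dQ : ℕ → d → (d → ℝ) → ℝ)
    (hQ : ∀ i v, HasFDerivAt (Q i)
      (∑ a, dQ i a v • (ContinuousLinearMap.proj a : (d → ℝ) →L[ℝ] ℝ)) v)
    (hdQ : ∀ i a, Continuous (dQ i a)) (hQ1 : ∀ i v, ∑ a, dQ i a v ^ 2 ≤ 1) :
    (stdGaussian E₁) {z | ∃ i, Q i (fun a => inner ℝ (α i a) z) < 0} ≤
      2 * ((stdGaussian F).prod (Measure.pi fun _ : d => gaussianReal 0 1))
        {p | ∃ i, (inner ℝ (x i) p.1 : ℝ) + Q i (‖x i‖ • p.2) < 0} := by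
  have hQc : ∀ i, Continuous (Q i) := fun i =>
    continuous_iff_continuousAt.2 fun p => (hQ i p).continuousAt
  set P₁ := (stdGaussian E₁).prod (gaussianReal 0 1) with hP₁
  set P₂ := (stdGaussian F).prod (Measure.pi fun _ : d => gaussianReal 0 1) with hP₂
  have hfin : ∀ s : Finset ℕ,
      P₁ {p | ∃ i ∈ s, ‖x i‖ * p.2 + Q i (fun a => inner ℝ (α i a) p.1) < 0} ≤
        P₂ {p | ∃ i ∈ s, (inner ℝ (x i) p.1 : ℝ) + Q i (‖x i‖ • p.2) < 0} := by
    intro s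
    have h1 := tendsto_integral_prod_softStep P₁ s
      (f := fun i p => ‖x i‖ * p.2 + Q i (fun a => inner ℝ (α i a) p.1))
      (fun i => Continuous.measurable (by have := hQc i; fun_prop))
    have h2 := tendsto_integral_prod_softStep P₂ s
      (f := fun i p => (inner ℝ (x i) p.1 : ℝ) + Q i (‖x i‖ • p.2))
      (fun i => Continuous.measurable (by have := hQc i; fun_prop))
    have h3 := le_of_tendsto_of_tendsto' h2 h1 fun M =>
      integral_prod_softStep_le s M x α hα Q dQ hQ hdQ hQ1
    have h4 := (sub_le_sub_iff_left 1).1 h3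
    rwa [measureReal_def, measureReal_def,
      ENNReal.toReal_le_toReal (measure_ne_top _ _) (measure_ne_top _ _)] at h4
  have hhalf : ∀ s : Finset ℕ,
      (stdGaussian E₁) {z | ∃ i ∈ s, Q i (fun a => inner ℝ (α i a) z) < 0} ≤
        2 * P₂ {p | ∃ i, (inner ℝ (x i) p.1 : ℝ) + Q i (‖x i‖ • p.2) < 0} := by
    intro s
    have h1 : (stdGaussian E₁) {z | ∃ i ∈ s, Q i (fun a => inner ℝ (α i a) z) < 0} * 2⁻¹ ≤
        P₁ {p | ∃ i ∈ s, ‖x i‖ * p.2 + Q i (fun a => inner ℝ (α i a) p.1) < 0} := by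
      refine (mul_le_mul_right half_le_gaussianReal_Iic _).trans ?_
      rw [← Measure.prod_prod]
      refine measure_mono ?_
      rintro ⟨z, γ⟩ ⟨⟨i, hi, hlt⟩, hγ⟩
      exact ⟨i, hi, (add_le_of_nonpos_left
        (mul_nonpos_of_nonneg_of_nonpos (norm_nonneg _) hγ)).trans_lt hlt⟩
    have h2 : P₂ {p | ∃ i ∈ s, (inner ℝ (x i) p.1 : ℝ) + Q i (‖x i‖ • p.2) < 0} ≤
        P₂ {p | ∃ i, (inner ℝ (x i) p.1 : ℝ) + Q i (‖x i‖ • p.2) < 0} :=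
      measure_mono fun p ⟨i, _, h⟩ => ⟨i, h⟩
    have h3 := h1.trans ((hfin s).trans h2)
    rw [← div_eq_mul_inv, ENNReal.div_le_iff (by simp) (by simp), mul_comm] at h3
    exact h3
  have hU : {z : E₁ | ∃ i, Q i (fun a => inner ℝ (α i a) z) < 0} =
      ⋃ N : ℕ, {z | ∃ i ∈ Finset.range N, Q i (fun a => inner ℝ (α i a) z) < 0} := by
    ext z
    simp only [Set.mem_ofPred_eq, Set.mem_iUnion, Finset.mem_range]
    exact ⟨fun ⟨i, h⟩ => ⟨i + 1, i, Nat.lt_succ_self i, h⟩, fun ⟨_, i, _, h⟩ => ⟨i, h⟩⟩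
  have hmono : Monotone fun N : ℕ =>
      {z : E₁ | ∃ i ∈ Finset.range N, Q i (fun a => inner ℝ (α i a) z) < 0} := by
    intro N N' hN z ⟨i, hi, h⟩
    exact ⟨i, Finset.range_mono hN hi, h⟩
  rw [hU, hmono.measure_iUnion]
  exact iSup_le fun N => hhalf _

end Gordon

/-! ### The mean squared distance to a random interval -/

/-- The squared distance from `y` to the interval `[-|g|, |g|]`. -/
def sqDist (g y : ℝ) : ℝ := max (|y| - |g|) 0 ^ 2

@[fun_prop]
theorem continuous_sqDist : Continuous fun p : ℝ × ℝ => sqDist p.1 p.2 := by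
  unfold sqDist
  fun_prop

theorem sqDist_nonneg (g y : ℝ) : 0 ≤ sqDist g y := sq_nonneg _

theorem sqDist_le_sq (g y : ℝ) : sqDist g y ≤ y ^ 2 := by
  rw [← sq_abs y, sqDist]
  exact pow_le_pow_left₀ (le_max_right _ _)
    (max_le (sub_le_self _ (abs_nonneg _)) (abs_nonneg _)) 2

/-- Gaussian integrals of positively `2`-homogeneous functions reduce to angular integrals. -/
theorem integral_gaussian_prod_of_homogeneous {Θ : ℝ × ℝ → ℝ}
    (hΘ : ∀ r : ℝ, 0 < r → ∀ p : ℝ × ℝ, Θ (r * p.1, r * p.2) = r ^ 2 * Θ p) :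
    ∫ p, Θ p ∂((gaussianReal 0 1).prod (gaussianReal 0 1)) =
      1 / Real.pi * ∫ θ in -Real.pi..Real.pi, Θ (Real.cos θ, Real.sin θ) := by
  have hpi := Real.pi_pos
  have hm : Measurable fun z : ℝ × ℝ => gaussianPDF 0 1 z.1 * gaussianPDF 0 1 z.2 :=
    ((measurable_gaussianPDF 0 1).comp measurable_fst).mul
      ((measurable_gaussianPDF 0 1).comp measurable_snd)
  rw [gaussianReal_of_var_ne_zero _ one_ne_zero, prod_withDensity (measurable_gaussianPDF 0 1)
    (measurable_gaussianPDF 0 1), integral_withDensity_eq_integral_toReal_smul hm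
    (ae_of_all _ fun _ => ENNReal.mul_lt_top ENNReal.ofReal_lt_top ENNReal.ofReal_lt_top),
    ← Measure.volume_eq_prod, ← integral_comp_polarCoord_symm]
  have hint : ∀ p ∈ polarCoord.target, p.1 • ((gaussianPDF 0 1 (polarCoord.symm p).1 *
      gaussianPDF 0 1 (polarCoord.symm p).2).toReal • Θ (polarCoord.symm p)) =
      (p.1 ^ (3 : ℝ) * Real.exp (-(1 / 2) * p.1 ^ (2 : ℝ))) *
        (1 / (2 * Real.pi) * Θ (Real.cos p.2, Real.sin p.2)) := by
    rintro ⟨r, θ⟩ hp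
    have hr : 0 < r := hp.1
    simp only [polarCoord_symm_apply, ENNReal.toReal_mul, toReal_gaussianPDF, smul_eq_mul,
      gaussianPDFReal_def]
    have h3 := hΘ r hr (Real.cos θ, Real.sin θ)
    simp only at h3
    rw [h3]
    have h4 : ∀ u v : ℝ, (√(2 * Real.pi * ((1 : NNReal) : ℝ)))⁻¹ * u *
        ((√(2 * Real.pi * ((1 : NNReal) : ℝ)))⁻¹ * v) = 1 / (2 * Real.pi) * (u * v) := by
      intro u v
      have : (√(2 * Real.pi * ((1 : NNReal) : ℝ)))⁻¹ * (√(2 * Real.pi * ((1 : NNReal) : ℝ)))⁻¹ =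
          1 / (2 * Real.pi) := by
        rw [← mul_inv, Real.mul_self_sqrt (by positivity), NNReal.coe_one, mul_one, one_div]
      rw [← this]
      ring
    rw [h4, ← Real.exp_add]
    have h5 : -(r * Real.cos θ - 0) ^ 2 / (2 * ((1 : NNReal) : ℝ)) +
        -(r * Real.sin θ - 0) ^ 2 / (2 * ((1 : NNReal) : ℝ)) = -(1 / 2) * r ^ 2 := by
      have := Real.sin_sq_add_cos_sq θ
      push_cast
      linear_combination (-(r ^ 2) / 2) * this
    rw [h5]
    norm_cast
    ring
  rw [setIntegral_congr_fun polarCoord.open_target.measurableSet hint, polarCoord_target,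
    Measure.volume_eq_prod, setIntegral_prod_mul (fun r : ℝ => r ^ (3 : ℝ) *
      Real.exp (-(1 / 2) * r ^ (2 : ℝ)))
      (fun θ : ℝ => 1 / (2 * Real.pi) * Θ (Real.cos θ, Real.sin θ)),
    integral_rpow_mul_exp_neg_mul_rpow (by norm_num) (by norm_num) (by norm_num),
    intervalIntegral.integral_of_le (by linarith), integral_Ioc_eq_integral_Ioo,
    integral_const_mul]
  have h6 : ((1 : ℝ) / 2) ^ (-((3 : ℝ) + 1) / 2) * (1 / 2) * Real.Gamma ((3 + 1) / 2) = 2 := by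
    have e1 : (-((3 : ℝ) + 1) / 2) = -(2 : ℕ) := by norm_num
    have e2 : ((3 : ℝ) + 1) / 2 = 2 := by norm_num
    rw [e1, e2, Real.Gamma_two, Real.rpow_neg (by norm_num), Real.rpow_natCast]
    norm_num
  rw [h6]
  field_simp

/-- The angular integral `∫ (t sin θ - δ cos θ)₊²` over the right half-circle. -/
def coneInt (δ t : ℝ) : ℝ :=
  ∫ θ in -(Real.pi / 2)..Real.pi / 2, max (t * Real.sin θ - δ * Real.cos θ) 0 ^ 2

theorem coneInt_nonneg (δ t : ℝ) : 0 ≤ coneInt δ t :=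
  intervalIntegral.integral_nonneg (by linarith [Real.pi_pos]) fun _ _ => sq_nonneg _

theorem coneInt_polar {l ψ : ℝ} (hl : 0 ≤ l) (h0 : 0 ≤ ψ) (hψ : ψ ≤ Real.pi) :
    coneInt (l * Real.cos ψ) (l * Real.sin ψ) =
      l ^ 2 * ((ψ - Real.sin ψ * Real.cos ψ) / 2) := by
  have hshift : ∀ θ, max (l * Real.sin ψ * Real.sin θ - l * Real.cos ψ * Real.cos θ) 0 ^ 2 =
      max (-(l * Real.cos (θ + ψ))) 0 ^ 2 := fun θ => by
    rw [Real.cos_add]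
    congr 2
    ring
  rw [coneInt]
  simp only [hshift]
  rw [intervalIntegral.integral_comp_add_right (fun x => max (-(l * Real.cos x)) 0 ^ 2)]
  have hint : ∀ a b, IntervalIntegrable (fun x => max (-(l * Real.cos x)) 0 ^ 2) volume a b :=
    fun a b => Continuous.intervalIntegrable (by fun_prop) a b
  rw [← intervalIntegral.integral_add_adjacent_intervals (hint _ (Real.pi / 2)) (hint _ _)]
  have h1 : ∫ x in -(Real.pi / 2) + ψ..Real.pi / 2, max (-(l * Real.cos x)) 0 ^ 2 = 0 := by
    rw [intervalIntegral.integral_congr (g := fun _ => (0 : ℝ)), intervalIntegral.integral_zero]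
    intro x hx
    rw [Set.uIcc_of_le (by linarith)] at hx
    have : 0 ≤ Real.cos x := Real.cos_nonneg_of_neg_pi_div_two_le_of_le (by linarith [hx.1]) hx.2
    change max (-(l * Real.cos x)) 0 ^ 2 = 0
    rw [max_eq_right (neg_nonpos.2 (mul_nonneg hl this))]
    norm_num
  have h2 : ∫ x in Real.pi / 2..Real.pi / 2 + ψ, max (-(l * Real.cos x)) 0 ^ 2 =
      ∫ x in Real.pi / 2..Real.pi / 2 + ψ, l ^ 2 * Real.cos x ^ 2 := by
    refine intervalIntegral.integral_congr fun x hx => ?_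
    rw [Set.uIcc_of_le (by linarith)] at hx
    have : Real.cos x ≤ 0 := Real.cos_nonpos_of_pi_div_two_le_of_le hx.1 (by linarith [hx.2])
    change max (-(l * Real.cos x)) 0 ^ 2 = l ^ 2 * Real.cos x ^ 2
    rw [max_eq_left (neg_nonneg.2 (mul_nonpos_of_nonneg_of_nonpos hl this))]
    ring
  rw [h1, h2, zero_add, intervalIntegral.integral_const_mul, integral_cos_sq,
    add_comm (Real.pi / 2) ψ, Real.cos_add_pi_div_two, Real.sin_add_pi_div_two,
    Real.cos_pi_div_two]
  ring

/-- The mean of `sqDist` at the Gaussian point `s g + t h`. -/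
theorem integral_sqDist_prod (s t : ℝ) :
    ∫ p, sqDist p.1 (s * p.1 + t * p.2) ∂((gaussianReal 0 1).prod (gaussianReal 0 1)) =
      2 / Real.pi * (coneInt (1 - s) t + coneInt (1 + s) t) := by
  rw [integral_gaussian_prod_of_homogeneous]
  swap
  · intro r hr p
    have h1 : |s * (r * p.1) + t * (r * p.2)| - |r * p.1| =
        r * (|s * p.1 + t * p.2| - |p.1|) := by
      rw [show s * (r * p.1) + t * (r * p.2) = r * (s * p.1 + t * p.2) by ring, abs_mul,
        abs_mul, abs_of_pos hr]
      ring
    simp only [sqDist]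
    have h2 : ∀ x : ℝ, max (r * x) 0 = r * max x 0 := fun x => by
      rw [mul_max_of_nonneg _ _ hr.le, mul_zero]
    rw [h1, h2, mul_pow]
  set φ : ℝ → ℝ := fun θ => sqDist (Real.cos θ) (s * Real.cos θ + t * Real.sin θ) with hφ
  have hφc : Continuous φ := by
    have := continuous_sqDist
    exact this.comp (f := fun θ : ℝ => (Real.cos θ, s * Real.cos θ + t * Real.sin θ))
      (by fun_prop)
  have hper : Function.Periodic φ Real.pi := by
    intro θ
    simp only [hφ, sqDist, Real.cos_add_pi, Real.sin_add_pi]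
    rw [show s * -Real.cos θ + t * -Real.sin θ = -(s * Real.cos θ + t * Real.sin θ) by ring,
      abs_neg, abs_neg]
  have hint : ∀ a b, IntervalIntegrable φ volume a b := fun a b => hφc.intervalIntegrable a b
  have e1 : ∫ θ in -Real.pi..Real.pi, φ θ = 2 * ∫ θ in -(Real.pi / 2)..Real.pi / 2, φ θ := by
    rw [← intervalIntegral.integral_add_adjacent_intervals (hint _ 0) (hint _ _)]
    have a1 := hper.intervalIntegral_add_eq (-Real.pi) (-(Real.pi / 2))
    have a2 := hper.intervalIntegral_add_eq 0 (-(Real.pi / 2))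
    rw [neg_add_cancel] at a1
    rw [zero_add] at a2
    rw [a1, a2, show -(Real.pi / 2) + Real.pi = Real.pi / 2 by ring]
    ring
  have e2 : ∫ θ in -(Real.pi / 2)..Real.pi / 2, φ θ = coneInt (1 - s) t + coneInt (1 + s) t := by
    have hneg : coneInt (1 + s) t = ∫ θ in -(Real.pi / 2)..Real.pi / 2,
        max (-(t * Real.sin θ) - (1 + s) * Real.cos θ) 0 ^ 2 := by
      have := intervalIntegral.integral_comp_neg (a := -(Real.pi / 2)) (b := Real.pi / 2)
        (fun θ => max (t * Real.sin θ - (1 + s) * Real.cos θ) 0 ^ 2)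
      rw [neg_neg] at this
      rw [coneInt, ← this]
      simp
    rw [hneg, coneInt, ← intervalIntegral.integral_add
      (Continuous.intervalIntegrable (by fun_prop) _ _)
      (Continuous.intervalIntegrable (by fun_prop) _ _)]
    refine intervalIntegral.integral_congr fun θ hθ => ?_
    rw [Set.uIcc_of_le (by linarith [Real.pi_pos])] at hθ
    have hc : 0 ≤ Real.cos θ := Real.cos_nonneg_of_neg_pi_div_two_le_of_le hθ.1 hθ.2
    simp only [hφ, sqDist, abs_of_nonneg hc]
    rcases le_total 0 (s * Real.cos θ + t * Real.sin θ) with h | h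
    · rw [abs_of_nonneg h, max_eq_right (a := -(t * Real.sin θ) - (1 + s) * Real.cos θ)
        (by linarith), show t * Real.sin θ - (1 - s) * Real.cos θ =
          s * Real.cos θ + t * Real.sin θ - Real.cos θ by ring]
      ring
    · rw [abs_of_nonpos h, max_eq_right (a := t * Real.sin θ - (1 - s) * Real.cos θ)
        (by linarith), show -(t * Real.sin θ) - (1 + s) * Real.cos θ =
          -(s * Real.cos θ + t * Real.sin θ) - Real.cos θ by ring]
      ring
  change 1 / Real.pi * ∫ θ in -Real.pi..Real.pi, φ θ = _
  rw [e1, e2]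
  ring

theorem map_linear_gaussian_prod (w τ : ℝ) :
    ((gaussianReal 0 1).prod (gaussianReal 0 1)).map (fun p : ℝ × ℝ => w * p.1 + τ * p.2) =
      (gaussianReal 0 1).map (fun x => √(w ^ 2 + τ ^ 2) * x) := by
  have h1 : (fun p : ℝ × ℝ => w * p.1 + τ * p.2) = (fun p : ℝ × ℝ => p.1 + p.2) ∘
      Prod.map (w * ·) (τ * ·) := rfl
  rw [h1, ← Measure.map_map (by fun_prop) (by fun_prop),
    ← Measure.map_prod_map _ _ (by fun_prop) (by fun_prop)]
  change (gaussianReal 0 1).map (w * ·) ∗ (gaussianReal 0 1).map (τ * ·) = _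
  rw [gaussianReal_map_const_mul, gaussianReal_map_const_mul, gaussianReal_map_const_mul,
    gaussianReal_conv_gaussianReal]
  congr 1
  · ring
  · ext
    simp [Real.sq_sqrt (add_nonneg (sq_nonneg w) (sq_nonneg τ))]

/-- The mean of `sqDist` at the Gaussian point `s g + w f + τ h`. -/
def meanSqDist (s w τ : ℝ) : ℝ :=
  ∫ z, sqDist z.1 (s * z.1 + w * z.2.1 + τ * z.2.2)
    ∂((gaussianReal 0 1).prod ((gaussianReal 0 1).prod (gaussianReal 0 1)))

theorem meanSqDist_eq (s w τ : ℝ) : meanSqDist s w τ =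
    2 / Real.pi * (coneInt (1 - s) √(w ^ 2 + τ ^ 2) + coneInt (1 + s) √(w ^ 2 + τ ^ 2)) := by
  rw [← integral_sqDist_prod, meanSqDist]
  have hc : Continuous fun p : ℝ × ℝ => sqDist p.1 (s * p.1 + p.2) :=
    continuous_sqDist.comp (f := fun p : ℝ × ℝ => (p.1, s * p.1 + p.2)) (by fun_prop)
  have key : ((gaussianReal 0 1).prod ((gaussianReal 0 1).prod (gaussianReal 0 1))).map
      (Prod.map id fun p : ℝ × ℝ => w * p.1 + τ * p.2) =
      ((gaussianReal 0 1).prod (gaussianReal 0 1)).map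
        (Prod.map id fun x : ℝ => √(w ^ 2 + τ ^ 2) * x) := by
    rw [← Measure.map_prod_map _ _ (by fun_prop) (by fun_prop), map_linear_gaussian_prod,
      Measure.map_prod_map _ _ (by fun_prop) (by fun_prop)]
  have h1 := integral_map (μ := (gaussianReal 0 1).prod
    ((gaussianReal 0 1).prod (gaussianReal 0 1)))
    (φ := Prod.map id fun p : ℝ × ℝ => w * p.1 + τ * p.2) (by fun_prop)
    hc.aestronglyMeasurable
  have h2 := integral_map (μ := (gaussianReal 0 1).prod (gaussianReal 0 1))
    (φ := Prod.map id fun x : ℝ => √(w ^ 2 + τ ^ 2) * x) (by fun_prop) hc.aestronglyMeasurable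
  rw [key, h2] at h1
  simp only [Prod.map, id] at h1
  rw [h1]
  simp only [add_assoc]

/-! ### The critical cosine similarity -/

section Critical

variable {α : ℝ}

theorem pi_div_mem_Ioo (hα : 2 < α) : Real.pi / α ∈ Set.Ioo 0 (Real.pi / 2) := by
  have hpi := Real.pi_pos
  exact ⟨by positivity, div_lt_div_of_pos_left hpi two_pos hα⟩

theorem one_sub_criticalCosine_sq (hα : 2 < α) :
    1 - criticalCosine α ^ 2 = Real.pi / α * (Real.cos (Real.pi / α) / Real.sin (Real.pi / α)) := by
  obtain ⟨h0, h1⟩ := pi_div_mem_Ioo hα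
  have htan := Real.lt_tan h0 h1
  rw [criticalCosine, Real.sq_sqrt, Real.tan_eq_sin_div_cos]
  · rw [sub_sub_cancel, div_div_eq_mul_div, mul_div_assoc]
  · rw [sub_nonneg, div_le_one (h0.trans htan)]
    exact htan.le

theorem one_sub_criticalCosine_sq_pos (hα : 2 < α) : 0 < 1 - criticalCosine α ^ 2 := by
  obtain ⟨h0, h1⟩ := pi_div_mem_Ioo hα
  have hpi := Real.pi_pos
  rw [one_sub_criticalCosine_sq hα]
  exact mul_pos h0 (div_pos (Real.cos_pos_of_mem_Ioo ⟨by linarith, h1⟩)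
    (Real.sin_pos_of_pos_of_lt_pi h0 (by linarith)))

theorem criticalCosine_nonneg : 0 ≤ criticalCosine α := Real.sqrt_nonneg _

/-- The trigonometric inequality behind the critical value: `cos ψ sin (ψ - a)` stays below its
tangent line at `ψ = a`. -/
theorem cos_mul_sin_sub_le {a ψ : ℝ} (ha0 : 0 < a) (ha : a < Real.pi / 2) (hψ : 0 ≤ ψ) :
    Real.cos ψ * Real.sin (ψ - a) ≤ Real.cos a * (ψ - a) := by
  have hpi := Real.pi_pos
  have hca : 0 < Real.cos a := Real.cos_pos_of_mem_Ioo ⟨by linarith, ha⟩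
  have hsa : 0 < Real.sin a := Real.sin_pos_of_pos_of_lt_pi ha0 (by linarith)
  rcases le_or_gt a ψ with h | h
  · obtain ⟨e, rfl⟩ : ∃ e, ψ = a + e := ⟨ψ - a, by ring⟩
    have he : 0 ≤ e := by linarith
    rw [add_sub_cancel_left, Real.cos_add]
    have h1 : 2 * Real.sin e * Real.cos e ≤ 2 * e := by
      rw [← Real.sin_two_mul]; exact Real.sin_le (by linarith)
    have h2 : Real.cos a * (2 * Real.sin e * Real.cos e) ≤ Real.cos a * (2 * e) :=
      mul_le_mul_of_nonneg_left h1 hca.le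
    have h3 : 0 ≤ Real.sin a * Real.sin e ^ 2 := by positivity
    linarith
  · obtain ⟨e, rfl⟩ : ∃ e, ψ = a - e := ⟨a - ψ, by ring⟩
    have he0 : 0 < e := by linarith
    have hea : e ≤ a := by linarith
    rw [sub_sub_cancel_left, Real.sin_neg]
    have hce : 0 < Real.cos e := Real.cos_pos_of_mem_Ioo ⟨by linarith, by linarith⟩
    have hse : 0 < Real.sin e := Real.sin_pos_of_pos_of_lt_pi he0 (by linarith)
    have h1 : e * Real.cos e ≤ Real.sin e := by
      have := Real.lt_tan he0 (by linarith)
      rw [Real.tan_eq_sin_div_cos, lt_div_iff₀ hce] at this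
      exact this.le
    have h2 : 0 ≤ Real.sin (a - e) :=
      Real.sin_nonneg_of_nonneg_of_le_pi (by linarith) (by linarith)
    rw [Real.sin_sub] at h2
    rw [Real.cos_sub]
    have h3 : Real.cos a * e ≤ (Real.cos a * Real.cos e + Real.sin a * Real.sin e) * Real.sin e := by
      have h4 : Real.cos a * (e * Real.cos e) ≤ Real.cos a * Real.sin e :=
        mul_le_mul_of_nonneg_left h1 hca.le
      have h5 : 0 ≤ (Real.sin a * Real.cos e - Real.cos a * Real.sin e) * Real.sin e ^ 2 := by
        positivity
      have h6 := Real.sin_sq_add_cos_sq e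
      refine le_of_mul_le_mul_right ?_ hce
      have h7 : Real.cos a * Real.sin e = Real.cos a * Real.sin e *
          (Real.sin e ^ 2 + Real.cos e ^ 2) := by rw [h6, mul_one]
      nlinarith
    linarith

/-- The gap in `sin_sq_sub_le`, in a form that shows its sign. -/
theorem sin_sq_sub_eq (hα : 2 < α) (ψ : ℝ) :
    (1 - criticalCosine α ^ 2) * (α / Real.pi * (ψ - Real.sin ψ * Real.cos ψ)) -
      (Real.sin ψ ^ 2 - criticalCosine α ^ 2) =
    (Real.cos (Real.pi / α) * (ψ - Real.pi / α) -
      Real.cos ψ * Real.sin (ψ - Real.pi / α)) / Real.sin (Real.pi / α) := by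
  obtain ⟨h0, h1⟩ := pi_div_mem_Ioo hα
  have hpi := Real.pi_pos
  have hs : Real.sin (Real.pi / α) ≠ 0 := (Real.sin_pos_of_pos_of_lt_pi h0 (by linarith)).ne'
  have h2 := one_sub_criticalCosine_sq hα
  have h3 : Real.pi / α * (α / Real.pi) = 1 := by field_simp
  have h4 : Real.sin ψ ^ 2 - criticalCosine α ^ 2 = Real.pi / α *
      (Real.cos (Real.pi / α) / Real.sin (Real.pi / α)) - Real.cos ψ ^ 2 := by
    have := Real.sin_sq_add_cos_sq ψ
    linarith
  rw [h4, h2, Real.sin_sub, show Real.pi / α * (Real.cos (Real.pi / α) / Real.sin (Real.pi / α)) *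
    (α / Real.pi * (ψ - Real.sin ψ * Real.cos ψ)) = (Real.pi / α * (α / Real.pi)) *
    ((Real.cos (Real.pi / α) / Real.sin (Real.pi / α)) * (ψ - Real.sin ψ * Real.cos ψ)) by ring, h3]
  field_simp
  ring

/-- The inequality that characterizes the critical cosine similarity; there is equality at
`ψ = π / α`. -/
theorem sin_sq_sub_le (hα : 2 < α) {ψ : ℝ} (hψ : 0 ≤ ψ) :
    Real.sin ψ ^ 2 - criticalCosine α ^ 2 ≤
      (1 - criticalCosine α ^ 2) * (α / Real.pi * (ψ - Real.sin ψ * Real.cos ψ)) := by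
  obtain ⟨h0, h1⟩ := pi_div_mem_Ioo hα
  have hpi := Real.pi_pos
  have hs : 0 < Real.sin (Real.pi / α) := Real.sin_pos_of_pos_of_lt_pi h0 (by linarith)
  rw [← sub_nonneg, sin_sq_sub_eq hα]
  exact div_nonneg (sub_nonneg.2 (cos_mul_sin_sub_le h0 h1 hψ)) hs.le

theorem sub_sin_mul_cos_pos {ψ : ℝ} (hψ : 0 < ψ) : 0 < ψ - Real.sin ψ * Real.cos ψ := by
  have := Real.sin_lt (show 0 < 2 * ψ by linarith)
  rw [Real.sin_two_mul] at this
  linarith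

theorem exists_polar (δ : ℝ) {t : ℝ} (ht : 0 ≤ t) (h : δ ≠ 0 ∨ t ≠ 0) :
    ∃ l ψ, 0 < l ∧ 0 ≤ ψ ∧ ψ ≤ Real.pi ∧ δ = l * Real.cos ψ ∧ t = l * Real.sin ψ := by
  set z : ℂ := ⟨δ, t⟩ with hz
  have hz0 : z ≠ 0 := by
    intro h0
    rcases h with h | h
    · exact h (congrArg Complex.re h0)
    · exact h (congrArg Complex.im h0)
  refine ⟨‖z‖, Complex.arg z, norm_pos_iff.2 hz0, Complex.arg_nonneg_iff.2 ht,
    Complex.arg_le_pi z, ?_, ?_⟩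
  · rw [Complex.norm_mul_cos_arg]
  · rw [Complex.norm_mul_sin_arg]

theorem coneInt_pos (δ : ℝ) {t : ℝ} (ht : 0 < t) : 0 < coneInt δ t := by
  obtain ⟨l, ψ, hl, h0, hψ, rfl, h2⟩ := exists_polar δ ht.le (Or.inr ht.ne')
  rw [h2, coneInt_polar hl.le h0 hψ]
  have : 0 < ψ := by
    refine h0.lt_of_ne ?_
    rintro rfl
    simp at h2
    exact ht.ne' h2
  have := sub_sin_mul_cos_pos this
  positivity

/-- For `δ ≥ 1` the cone is narrow, and the integral is of third order in `t`. -/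
theorem coneInt_le {δ t : ℝ} (hδ : 1 ≤ δ) (ht : 0 ≤ t) : coneInt δ t ≤ t ^ 3 / 2 := by
  obtain ⟨l, ψ, hl, h0, hψ, h1, h2⟩ := exists_polar δ ht (Or.inl (by linarith))
  rw [h1, h2, coneInt_polar hl.le h0 hψ]
  have hc : 0 < Real.cos ψ := by
    by_contra hc
    nlinarith
  have hψ2 : ψ < Real.pi / 2 := by
    by_contra hcon
    exact absurd (Real.cos_nonpos_of_pi_div_two_le_of_le (not_lt.1 hcon) (by linarith))
      (not_le.2 hc)
  have hs : 0 ≤ Real.sin ψ := Real.sin_nonneg_of_nonneg_of_le_pi h0 hψ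
  have htan : ψ * Real.cos ψ ≤ Real.sin ψ := by
    have := Real.le_tan h0 hψ2
    rwa [Real.tan_eq_sin_div_cos, le_div_iff₀ hc] at this
  have hsc := Real.sin_sq_add_cos_sq ψ
  -- `(ψ - sin ψ cos ψ) cos ψ ≤ sin³ ψ` and `1 ≤ l cos ψ`
  have h3 : (ψ - Real.sin ψ * Real.cos ψ) * Real.cos ψ ≤ Real.sin ψ ^ 3 := by
    have : Real.sin ψ ^ 3 = Real.sin ψ - Real.sin ψ * Real.cos ψ ^ 2 := by
      rw [← eq_sub_iff_add_eq] at hsc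
      rw [pow_succ, hsc]
      ring
    rw [this]
    linarith
  have hnn : 0 ≤ ψ - Real.sin ψ * Real.cos ψ := by
    rcases h0.eq_or_lt with rfl | h
    · simp
    · exact (sub_sin_mul_cos_pos h).le
  have h4 : ψ - Real.sin ψ * Real.cos ψ ≤ l * Real.sin ψ ^ 3 := by
    calc ψ - Real.sin ψ * Real.cos ψ ≤ (ψ - Real.sin ψ * Real.cos ψ) * (l * Real.cos ψ) :=
          le_mul_of_one_le_right hnn (h1 ▸ hδ)
      _ = l * ((ψ - Real.sin ψ * Real.cos ψ) * Real.cos ψ) := by ring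
      _ ≤ l * Real.sin ψ ^ 3 := mul_le_mul_of_nonneg_left h3 hl.le
  calc l ^ 2 * ((ψ - Real.sin ψ * Real.cos ψ) / 2)
      = l ^ 2 / 2 * (ψ - Real.sin ψ * Real.cos ψ) := by ring
    _ ≤ l ^ 2 / 2 * (l * Real.sin ψ ^ 3) := mul_le_mul_of_nonneg_left h4 (by positivity)
    _ = (l * Real.sin ψ) ^ 3 / 2 := by ring

/-- The part of `meanSqDist` that comes from the near face of the interval already dominates
`τ² / α`; the objective constraint bounds `w` from below in terms of `1 - s`. -/
theorem sq_le_mul_coneInt (hα : 2 < α) {ρ : ℝ} (hρ : 0 < ρ) (hρ1 : ρ ≤ 1)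
    (hρc : criticalCosine α ≤ ρ) {s w τ l ψ : ℝ} (hl : 0 < l) (h0 : 0 ≤ ψ) (hψ : ψ ≤ Real.pi)
    (h1 : 1 - s = l * Real.cos ψ) (ht2 : (l * Real.sin ψ) ^ 2 = w ^ 2 + τ ^ 2)
    (hobj : 0 ≤ ρ * (s - 1) + √(1 - ρ ^ 2) * w) :
    τ ^ 2 ≤ α * (l ^ 2 * ((ψ - Real.sin ψ * Real.cos ψ) / Real.pi)) := by
  have hpi := Real.pi_pos
  have hα0 : 0 < α := by linarith
  have hT := one_sub_criticalCosine_sq_pos hα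
  have hc0 := criticalCosine_nonneg (α := α)
  have hsc := Real.sin_sq_add_cos_sq ψ
  rcases le_or_gt 0 (1 - s) with hδ | hδ
  · have hw : ρ ^ 2 * (1 - s) ^ 2 ≤ (1 - ρ ^ 2) * w ^ 2 := by
      have h3 : ρ * (1 - s) ≤ √(1 - ρ ^ 2) * w := by linarith
      have h4 := pow_le_pow_left₀ (mul_nonneg hρ.le hδ) h3 2
      rw [mul_pow, mul_pow, Real.sq_sqrt (by nlinarith)] at h4
      exact h4
    have hcρ : criticalCosine α ^ 2 ≤ ρ ^ 2 := pow_le_pow_left₀ hc0 hρc 2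
    have hw2 : criticalCosine α ^ 2 * (1 - s) ^ 2 ≤ (1 - criticalCosine α ^ 2) * w ^ 2 := by
      exact (mul_le_mul_of_nonneg_right hcρ (sq_nonneg _)).trans
        (hw.trans (mul_le_mul_of_nonneg_right (by linarith) (sq_nonneg _)))
    have h5 := mul_le_mul_of_nonneg_left (sin_sq_sub_le hα h0) (sq_nonneg l)
    rw [h1] at hw2
    refine le_of_mul_le_mul_left ?_ hT
    calc (1 - criticalCosine α ^ 2) * τ ^ 2
        = (1 - criticalCosine α ^ 2) * (l * Real.sin ψ) ^ 2 -
            (1 - criticalCosine α ^ 2) * w ^ 2 := by rw [ht2]; ring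
      _ ≤ (1 - criticalCosine α ^ 2) * (l * Real.sin ψ) ^ 2 -
            criticalCosine α ^ 2 * (l * Real.cos ψ) ^ 2 := by linarith
      _ = l ^ 2 * (Real.sin ψ ^ 2 - criticalCosine α ^ 2 *
            (Real.sin ψ ^ 2 + Real.cos ψ ^ 2)) := by ring
      _ = l ^ 2 * (Real.sin ψ ^ 2 - criticalCosine α ^ 2) := by rw [hsc, mul_one]
      _ ≤ _ := h5
      _ = _ := by ring
  · have hcos : Real.cos ψ < 0 := by
      rw [h1] at hδ
      by_contra hcon
      exact absurd (mul_nonneg hl.le (not_lt.1 hcon)) (not_le.2 hδ)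
    have hψ2 : Real.pi / 2 ≤ ψ := by
      by_contra hcon
      exact absurd (Real.cos_nonneg_of_neg_pi_div_two_le_of_le (x := ψ) (by linarith)
        (by linarith)) (not_le.2 hcos)
    have hs : 0 ≤ Real.sin ψ := Real.sin_nonneg_of_nonneg_of_le_pi h0 hψ
    have h3 : 1 ≤ α * ((ψ - Real.sin ψ * Real.cos ψ) / Real.pi) := by
      rw [← mul_div_assoc, le_div_iff₀ hpi]
      have : Real.sin ψ * Real.cos ψ ≤ 0 := mul_nonpos_of_nonneg_of_nonpos hs hcos.le
      nlinarith
    calc τ ^ 2 ≤ w ^ 2 + τ ^ 2 := le_add_of_nonneg_left (sq_nonneg w)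
      _ = l ^ 2 * Real.sin ψ ^ 2 := by rw [← ht2]; ring
      _ ≤ l ^ 2 * 1 := mul_le_mul_of_nonneg_left (Real.sin_sq_le_one ψ) (sq_nonneg l)
      _ ≤ l ^ 2 * (α * ((ψ - Real.sin ψ * Real.cos ψ) / Real.pi)) :=
          mul_le_mul_of_nonneg_left h3 (sq_nonneg l)
      _ = _ := by ring

/-- At or above the critical cosine similarity, every candidate point other than the signal that
is at least as good for the objective violates the constraints on average. -/
theorem sq_lt_mul_meanSqDist (hα : 2 < α) {ρ : ℝ} (hρ : 0 < ρ) (hρ1 : ρ ≤ 1)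
    (hρc : criticalCosine α ≤ ρ) {s w τ : ℝ} (hτ : 0 ≤ τ)
    (hne : ¬ (s = 1 ∧ w = 0 ∧ τ = 0)) (hobj : 0 ≤ ρ * (s - 1) + √(1 - ρ ^ 2) * w) :
    τ ^ 2 < α * meanSqDist s w τ := by
  have hpi := Real.pi_pos
  have hα0 : 0 < α := by linarith
  obtain ⟨t, ht⟩ : ∃ t, t = √(w ^ 2 + τ ^ 2) := ⟨_, rfl⟩
  have ht0 : 0 ≤ t := ht ▸ Real.sqrt_nonneg _
  have ht2 : t ^ 2 = w ^ 2 + τ ^ 2 := by rw [ht, Real.sq_sqrt (by positivity)]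
  rw [meanSqDist_eq, ← ht]
  have hne' : 1 - s ≠ 0 ∨ t ≠ 0 := by
    by_contra hcon
    push Not at hcon
    rw [hcon.2] at ht2
    refine hne ⟨by linarith [hcon.1], ?_, ?_⟩ <;> nlinarith [sq_nonneg w, sq_nonneg τ]
  obtain ⟨l, ψ, hl, h0, hψ, h1, h2⟩ := exists_polar (1 - s) ht0 hne'
  have hcone : 2 / Real.pi * coneInt (1 - s) t =
      l ^ 2 * ((ψ - Real.sin ψ * Real.cos ψ) / Real.pi) := by
    rw [h1, h2, coneInt_polar hl.le h0 hψ]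
    ring
  have hfirst : τ ^ 2 ≤ α * (2 / Real.pi * coneInt (1 - s) t) := by
    rw [hcone]
    exact sq_le_mul_coneInt hα hρ hρ1 hρc hl h0 hψ h1 (h2 ▸ ht2) hobj
  rcases ht0.eq_or_lt with ht0' | ht0'
  · -- here `w = τ = 0`, so that `s > 1` and the first cone is the whole half-circle
    have hw0 : w = 0 := by nlinarith [sq_nonneg w, sq_nonneg τ]
    have hτ0 : τ = 0 := by nlinarith [sq_nonneg w, sq_nonneg τ]
    have hs1 : 1 - s < 0 := by
      rcases hne' with h | h
      · refine lt_of_le_of_ne ?_ h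
        rw [hw0] at hobj
        by_contra hcon
        nlinarith
      · exact absurd ht0'.symm h
    have hψ0 : 0 < ψ := by
      refine h0.lt_of_ne ?_
      rintro rfl
      rw [Real.cos_zero] at h1
      linarith
    have h3 : 0 < 2 / Real.pi * coneInt (1 - s) t := by
      rw [hcone]
      have := sub_sin_mul_cos_pos hψ0
      positivity
    have h4 := coneInt_nonneg (1 + s) t
    rw [hτ0, mul_add]
    have h5 : 0 ≤ 2 / Real.pi * coneInt (1 + s) t := by positivity
    have := mul_pos hα0 (add_pos_of_pos_of_nonneg h3 h5)
    rwa [zero_pow two_ne_zero]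
  · have h3 : 0 < 2 / Real.pi * coneInt (1 + s) t := by
      have := coneInt_pos (1 + s) ht0'
      positivity
    rw [mul_add, mul_add]
    linarith [mul_pos hα0 h3]

/-- Below the critical cosine similarity there is a point that satisfies the constraints on
average and beats the signal for the objective. -/
theorem exists_mul_meanSqDist_lt_sq (hα : 2 < α) {ρ : ℝ} (hρ : 0 < ρ)
    (hρc : ρ < criticalCosine α) :
    ∃ s w τ : ℝ, 0 < τ ∧ α * meanSqDist s w τ < τ ^ 2 ∧ ρ < ρ * s + √(1 - ρ ^ 2) * w := by
  have hpi := Real.pi_pos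
  have hα0 : 0 < α := by linarith
  have hT := one_sub_criticalCosine_sq_pos hα
  obtain ⟨hψ0, hψ1⟩ := pi_div_mem_Ioo hα
  set ψ := Real.pi / α with hψ
  set c := criticalCosine α with hc
  have hcos : 0 < Real.cos ψ := Real.cos_pos_of_mem_Ioo ⟨by linarith, hψ1⟩
  have hsin : 0 < Real.sin ψ := Real.sin_pos_of_pos_of_lt_pi hψ0 (by linarith)
  have hsc := Real.sin_sq_add_cos_sq ψ
  have hρ2 : 0 < 1 - ρ ^ 2 := by nlinarith
  have hsq : 0 < √(1 - ρ ^ 2) := Real.sqrt_pos.2 hρ2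
  have hsqc : 0 < √(1 - c ^ 2) := Real.sqrt_pos.2 hT
  obtain ⟨κ, hκ1, hκ2⟩ : ∃ κ, ρ / √(1 - ρ ^ 2) < κ ∧ κ < c / √(1 - c ^ 2) := by
    apply exists_between
    rw [div_lt_div_iff₀ hsq hsqc]
    exact mul_lt_mul hρc (Real.sqrt_le_sqrt (by nlinarith)) hsqc (by linarith)
  have hκ0 : 0 < κ := (div_pos hρ hsq).trans hκ1
  have hκρ : ρ < √(1 - ρ ^ 2) * κ := by rw [div_lt_iff₀ hsq] at hκ1; linarith
  have hκc : κ ^ 2 < c ^ 2 / (1 - c ^ 2) := by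
    have := pow_lt_pow_left₀ hκ2 hκ0.le two_ne_zero
    rwa [div_pow, Real.sq_sqrt hT.le] at this
  -- the slope `κ` lies strictly between the values for `ρ` and for the critical similarity, so the
  -- constraint has a slack `l ^ 2 * η`; the far face only costs `O(l ^ 3)`
  obtain ⟨η, hη⟩ : ∃ η, η = (c ^ 2 / (1 - c ^ 2) - κ ^ 2) * Real.cos ψ ^ 2 := ⟨_, rfl⟩
  have hη0 : 0 < η := by rw [hη]; exact mul_pos (by linarith) (by positivity)
  obtain ⟨l, hl⟩ : ∃ l, l = min 1 (η * Real.pi / (2 * α)) := ⟨_, rfl⟩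
  have hl0 : 0 < l := by rw [hl]; exact lt_min one_pos (by positivity)
  have hl1 : l ≤ 1 := hl ▸ min_le_left _ _
  have hl2 : l * (2 * α) ≤ η * Real.pi := by
    rw [← le_div_iff₀ (by positivity), hl]; exact min_le_right _ _
  -- equality in `sin_sq_sub_le` at the critical angle
  have hψeq : α / Real.pi * (ψ - Real.sin ψ * Real.cos ψ) =
      Real.sin ψ ^ 2 - c ^ 2 / (1 - c ^ 2) * Real.cos ψ ^ 2 := by
    have h := sin_sq_sub_eq hα ψ
    rw [← hψ, ← hc, sub_self, Real.sin_zero, mul_zero, sub_zero, zero_div,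
      sub_eq_zero] at h
    have h' : Real.sin ψ ^ 2 - c ^ 2 = (1 - c ^ 2) *
        (Real.sin ψ ^ 2 - c ^ 2 / (1 - c ^ 2) * Real.cos ψ ^ 2) := by
      rw [mul_sub, ← mul_assoc, mul_div_cancel₀ _ hT.ne']
      linear_combination c ^ 2 * hsc
    rw [h'] at h
    exact mul_left_cancel₀ hT.ne' h
  have hpos : 0 < α / Real.pi * (ψ - Real.sin ψ * Real.cos ψ) := by
    have := sub_sin_mul_cos_pos hψ0
    positivity
  have hdiff : Real.sin ψ ^ 2 - κ ^ 2 * Real.cos ψ ^ 2 =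
      α / Real.pi * (ψ - Real.sin ψ * Real.cos ψ) + η := by
    rw [hψeq, hη]; ring
  obtain ⟨τ, hτ⟩ : ∃ τ, τ = l * √(Real.sin ψ ^ 2 - κ ^ 2 * Real.cos ψ ^ 2) := ⟨_, rfl⟩
  have hτ2 : τ ^ 2 = l ^ 2 * (Real.sin ψ ^ 2 - κ ^ 2 * Real.cos ψ ^ 2) := by
    rw [hτ, mul_pow, Real.sq_sqrt (by rw [hdiff]; positivity)]
  refine ⟨1 - l * Real.cos ψ, κ * (l * Real.cos ψ), τ, ?_, ?_, ?_⟩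
  · rw [hτ, hdiff]; positivity
  · have ht : √((κ * (l * Real.cos ψ)) ^ 2 + τ ^ 2) = l * Real.sin ψ := by
      rw [hτ2, show (κ * (l * Real.cos ψ)) ^ 2 + l ^ 2 *
        (Real.sin ψ ^ 2 - κ ^ 2 * Real.cos ψ ^ 2) = (l * Real.sin ψ) ^ 2 by ring]
      exact Real.sqrt_sq (by positivity)
    have h1 : coneInt (1 + (1 - l * Real.cos ψ)) (l * Real.sin ψ) ≤ (l * Real.sin ψ) ^ 3 / 2 :=
      coneInt_le (by nlinarith [Real.cos_le_one ψ]) (by positivity)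
    have h2 : (l * Real.sin ψ) ^ 3 ≤ l ^ 3 := by
      have := Real.sin_le_one ψ
      exact pow_le_pow_left₀ (by positivity) (by nlinarith) 3
    rw [meanSqDist_eq, ht, sub_sub_cancel, coneInt_polar hl0.le hψ0.le (by linarith), hτ2, hdiff]
    have h3 : α * (2 / Real.pi * (l ^ 2 * ((ψ - Real.sin ψ * Real.cos ψ) / 2) +
        coneInt (1 + (1 - l * Real.cos ψ)) (l * Real.sin ψ))) =
        l ^ 2 * (α / Real.pi * (ψ - Real.sin ψ * Real.cos ψ)) +
          2 * α / Real.pi * coneInt (1 + (1 - l * Real.cos ψ)) (l * Real.sin ψ) := by ring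
    rw [h3, mul_add]
    have h4 : 2 * α / Real.pi * coneInt (1 + (1 - l * Real.cos ψ)) (l * Real.sin ψ) ≤
        2 * α / Real.pi * (l ^ 3 / 2) := mul_le_mul_of_nonneg_left (by linarith) (by positivity)
    have h5 : 2 * α / Real.pi * (l ^ 3 / 2) ≤ l ^ 2 * η / 2 := by
      rw [div_mul_eq_mul_div, div_le_iff₀ hpi]
      linarith [mul_le_mul_of_nonneg_left hl2 (sq_nonneg l)]
    have h6 : 0 < l ^ 2 * η := by positivity
    linarith
  · have : 0 < l * Real.cos ψ := by positivity
    linarith [mul_lt_mul_of_pos_right hκρ this]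

end Critical

/-! ### Laws of large numbers for the comparison process -/

/-- A weak law of large numbers for triangular arrays of i.i.d. samples. -/
theorem tendsto_measure_sum_sub_ge {S : Type*} [MeasurableSpace S] (ν : Measure S)
    [IsProbabilityMeasure ν] {F : S → ℝ} (hF : MemLp F 2 ν) {k : ℕ → ℕ}
    (hk : Tendsto k atTop atTop) {Ω : ℕ → Type*} [∀ n, MeasurableSpace (Ω n)]
    (P : ∀ n, Measure (Ω n)) {Z : ∀ n, Ω n → Fin (k n) → S}
    (hZ : ∀ n, MeasurePreserving (Z n) (P n) (Measure.pi fun _ => ν)) {c : ℝ} (hc : 0 < c) :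
    Tendsto (fun n => P n {ω | c * k n ≤ |∑ i, F (Z n ω i) - k n * ∫ x, F x ∂ν|})
      atTop (𝓝 0) := by
  have hbound : ∀ᶠ n in atTop, P n {ω | c * k n ≤ |∑ i, F (Z n ω i) - k n * ∫ x, F x ∂ν|} ≤
      ENNReal.ofReal (Var[F; ν] / c ^ 2 * (k n : ℝ)⁻¹) := by
    filter_upwards [hk.eventually_gt_atTop 0] with n hn
    have hn' : (0 : ℝ) < k n := by exact_mod_cast hn
    have hmem : ∀ i : Fin (k n), MemLp (fun z : Fin (k n) → S => F (z i)) 2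
        (Measure.pi fun _ => ν) := fun i => hF.comp_measurePreserving (measurePreserving_eval _ i)
    have hsum : MemLp (∑ i : Fin (k n), fun z : Fin (k n) → S => F (z i)) 2
        (Measure.pi fun _ => ν) := memLp_finsetSum' _ fun i _ => hmem i
    have hmean : (Measure.pi fun _ : Fin (k n) => ν)[∑ i : Fin (k n),
        fun z : Fin (k n) → S => F (z i)] = k n * ∫ x, F x ∂ν := by
      simp only [Finset.sum_apply]
      rw [integral_finsetSum _ fun i _ => (hmem i).integrable (by norm_num)]
      have : ∀ i : Fin (k n), ∫ z : Fin (k n) → S, F (z i) ∂(Measure.pi fun _ => ν) =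
          ∫ x, F x ∂ν := fun i => by
        have hev := (measurePreserving_eval (fun _ : Fin (k n) => ν) i)
        have h := integral_map (μ := Measure.pi fun _ : Fin (k n) => ν) (f := F)
          hev.measurable.aemeasurable (by rw [hev.map_eq]; exact hF.1)
        rw [hev.map_eq] at h
        exact h.symm
      simp [this]
    have hcheb := meas_ge_le_variance_div_sq hsum (mul_pos hc hn')
    rw [hmean, variance_sum_pi fun _ => hF] at hcheb
    simp only [Finset.sum_apply, Finset.sum_const, Finset.card_univ, Fintype.card_fin,
      nsmul_eq_mul] at hcheb
    refine (measure_mono (t := Z n ⁻¹' {z | c * k n ≤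
      |∑ i, F (z i) - k n * ∫ x, F x ∂ν|}) fun ω h => h).trans ?_
    refine ((hZ n).measure_preimage_le _).trans (hcheb.trans_eq ?_)
    congr 1
    field_simp
  refine tendsto_of_tendsto_of_tendsto_of_le_of_le' tendsto_const_nhds ?_
    (Eventually.of_forall fun _ => zero_le) hbound
  have h1 : Tendsto (fun n => Var[F; ν] / c ^ 2 * (k n : ℝ)⁻¹) atTop
      (𝓝 (Var[F; ν] / c ^ 2 * 0)) :=
    ((tendsto_natCast_atTop_atTop.comp hk).inv_tendsto_atTop).const_mul _
  simpa using ENNReal.tendsto_ofReal h1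

theorem memLp_sq_gaussianReal : MemLp (fun x : ℝ => x ^ 2) 2 (gaussianReal 0 1) := by
  have h := (memLp_id_gaussianReal' (μ := 0) (v := 1) 4 (by norm_num)).integrable_norm_pow
    (p := 4) (by norm_num)
  rw [memLp_two_iff_integrable_sq (by fun_prop)]
  refine h.congr (ae_of_all _ fun x => ?_)
  simp only [id, Real.norm_eq_abs]
  rw [← pow_mul, ← abs_pow, abs_of_nonneg (by positivity)]

theorem integral_sq_gaussianReal : ∫ x, x ^ 2 ∂(gaussianReal 0 1) = 1 := by
  have h := variance_fun_id_gaussianReal (μ := 0) (v := 1)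
  rw [variance_eq_integral (by fun_prop)] at h
  simpa using h

/-- The law of a triple of independent standard Gaussian variables. -/
abbrev gaussianTriple : Measure (ℝ × ℝ × ℝ) :=
  (gaussianReal 0 1).prod ((gaussianReal 0 1).prod (gaussianReal 0 1))

/-- The sum of the squares of the three coordinates. -/
def tripleSq (z : ℝ × ℝ × ℝ) : ℝ := z.1 ^ 2 + z.2.1 ^ 2 + z.2.2 ^ 2

theorem memLp_tripleSq : MemLp tripleSq 2 gaussianTriple := by
  have h1 := memLp_sq_gaussianReal.comp_measurePreserving
    (measurePreserving_fst (μ := gaussianReal 0 1)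
      (ν := (gaussianReal 0 1).prod (gaussianReal 0 1)))
  have h2 := memLp_sq_gaussianReal.comp_measurePreserving
    ((measurePreserving_fst (μ := gaussianReal 0 1) (ν := gaussianReal 0 1)).comp
    (measurePreserving_snd (μ := gaussianReal 0 1)
      (ν := (gaussianReal 0 1).prod (gaussianReal 0 1))))
  have h3 := memLp_sq_gaussianReal.comp_measurePreserving
    ((measurePreserving_snd (μ := gaussianReal 0 1) (ν := gaussianReal 0 1)).comp
    (measurePreserving_snd (μ := gaussianReal 0 1)
      (ν := (gaussianReal 0 1).prod (gaussianReal 0 1))))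
  exact (h1.add h2).add h3

theorem memLp_sqDist (s w τ : ℝ) :
    MemLp (fun z : ℝ × ℝ × ℝ => sqDist z.1 (s * z.1 + w * z.2.1 + τ * z.2.2)) 2
      gaussianTriple := by
  have hc : Continuous fun z : ℝ × ℝ × ℝ => sqDist z.1 (s * z.1 + w * z.2.1 + τ * z.2.2) :=
    continuous_sqDist.comp
      (f := fun z : ℝ × ℝ × ℝ => (z.1, s * z.1 + w * z.2.1 + τ * z.2.2)) (by fun_prop)
  refine (memLp_tripleSq.const_mul (s ^ 2 + w ^ 2 + τ ^ 2)).mono hc.aestronglyMeasurable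
    (ae_of_all _ fun z => ?_)
  simp only [tripleSq, Real.norm_eq_abs]
  rw [abs_of_nonneg (sqDist_nonneg _ _), abs_of_nonneg (by positivity)]
  refine (sqDist_le_sq _ _).trans ?_
  nlinarith [sq_nonneg (s * z.2.1 - w * z.1), sq_nonneg (s * z.2.2 - τ * z.1),
    sq_nonneg (w * z.2.2 - τ * z.2.1)]

theorem measurePreserving_triple (k : ℕ) :
    MeasurePreserving (fun p : (Fin k → ℝ) × (Fin k → ℝ) × (Fin k → ℝ) => fun i =>
      (p.1 i, p.2.1 i, p.2.2 i))
      ((Measure.pi fun _ => gaussianReal 0 1).prod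
        ((Measure.pi fun _ => gaussianReal 0 1).prod (Measure.pi fun _ => gaussianReal 0 1)))
      (Measure.pi fun _ => gaussianTriple) := by
  have h1 := (measurePreserving_arrowProdEquivProdArrow ℝ ℝ (Fin k) (fun _ => gaussianReal 0 1)
    (fun _ => gaussianReal 0 1)).symm
  have h2 := (measurePreserving_arrowProdEquivProdArrow ℝ (ℝ × ℝ) (Fin k)
    (fun _ => gaussianReal 0 1) (fun _ => (gaussianReal 0 1).prod (gaussianReal 0 1))).symm
  exact h2.comp ((MeasurePreserving.id _).prod h1)

theorem measurePreserving_ofLp (k : ℕ) :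
    MeasurePreserving (fun q : EuclideanSpace ℝ (Fin k) => (fun i => q i : Fin k → ℝ))
      (stdGaussian (EuclideanSpace ℝ (Fin k))) (Measure.pi fun _ => gaussianReal 0 1) := by
  have h := map_toLp_pi_stdGaussian (Fin k) ℝ
  rw [stdGaussian_real] at h
  refine ⟨by fun_prop, ?_⟩
  change ((stdGaussian (PiLp 2 fun _ : Fin k => ℝ)).map fun q i => q i) = _
  rw [← h, Measure.map_map (by fun_prop) (by fun_prop)]
  exact Measure.map_id

/-- The law of the Gaussian data `((g, f), (q, h))` of the comparison process: two samples of
size `m`, a standard Gaussian vector in `ℝᵏ` and a sample of size `l`. -/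
abbrev auxMeasure (m k l : ℕ) : Measure (((Fin m → ℝ) × (Fin m → ℝ)) ×
    (EuclideanSpace ℝ (Fin k) × (Fin l → ℝ))) :=
  ((Measure.pi fun _ => gaussianReal 0 1).prod (Measure.pi fun _ => gaussianReal 0 1)).prod
    ((stdGaussian (EuclideanSpace ℝ (Fin k))).prod (Measure.pi fun _ => gaussianReal 0 1))

theorem measurePreserving_auxMeasure_right (m k : ℕ) :
    MeasurePreserving (fun p : ((Fin m → ℝ) × (Fin m → ℝ)) ×
      (EuclideanSpace ℝ (Fin k) × (Fin m → ℝ)) => fun i => (p.1.1 i, p.1.2 i, p.2.2 i))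
      (auxMeasure m k m) (Measure.pi fun _ => gaussianTriple) :=
  ((measurePreserving_triple m).comp (measurePreserving_prodAssoc _ _ _)).comp
    ((MeasurePreserving.id _).prod measurePreserving_snd)

theorem measurePreserving_auxMeasure_left (m l : ℕ) :
    MeasurePreserving (fun p : ((Fin m → ℝ) × (Fin m → ℝ)) ×
      (EuclideanSpace ℝ (Fin m) × (Fin l → ℝ)) => fun i => (p.1.1 i, p.1.2 i, p.2.1 i))
      (auxMeasure m m l) (Measure.pi fun _ => gaussianTriple) :=
  ((measurePreserving_triple m).comp (measurePreserving_prodAssoc _ _ _)).comp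
    ((MeasurePreserving.id _).prod ((measurePreserving_ofLp m).comp measurePreserving_fst))

/-- The Euclidean distance from `y` to the box `∏ i, [-|g i|, |g i|]`. -/
def boxDist {k : ℕ} (g y : Fin k → ℝ) : ℝ := √(∑ i, sqDist (g i) (y i))

theorem boxDist_le_add {k : ℕ} (g y y' : Fin k → ℝ) :
    boxDist g y ≤ boxDist g y' + √(∑ i, (y i - y' i) ^ 2) := by
  have h1 := norm_add_le (WithLp.toLp 2 fun i => max (|y' i| - |g i|) 0 :
    EuclideanSpace ℝ (Fin k)) (WithLp.toLp 2 fun i => |y i - y' i|)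
  rw [EuclideanSpace.norm_eq, EuclideanSpace.norm_eq, EuclideanSpace.norm_eq] at h1
  simp only [PiLp.add_apply, Real.norm_eq_abs, sq_abs] at h1
  refine le_trans ?_ h1
  refine Real.sqrt_le_sqrt (Finset.sum_le_sum fun i _ => ?_)
  refine pow_le_pow_left₀ (le_max_right _ _) (max_le ?_ (by positivity)) 2
  have h2 := abs_sub_abs_le_abs_sub (y i) (y' i)
  have h3 := le_max_left (|y' i| - |g i|) 0
  linarith

/-! ### Asymptotics of the comparison events -/

section Asymptotics

variable {α : ℝ} {m : ℕ → ℕ}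

theorem tendsto_sampleSize (hα : 2 < α)
    (hm : Tendsto (fun n : ℕ => (m n : ℝ) / (n : ℝ)) atTop (𝓝 α)) : Tendsto m atTop atTop := by
  rw [← tendsto_natCast_atTop_iff (R := ℝ)]
  have h := hm.pos_mul_atTop (by linarith) (tendsto_natCast_atTop_atTop (R := ℝ))
  refine h.congr' ?_
  filter_upwards [eventually_gt_atTop 0] with n hn
  have : (n : ℝ) ≠ 0 := by exact_mod_cast hn.ne'
  field_simp

theorem measurePreserving_auxMeasure_vec (m k l : ℕ) :
    MeasurePreserving (fun p : ((Fin m → ℝ) × (Fin m → ℝ)) ×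
      (EuclideanSpace ℝ (Fin k) × (Fin l → ℝ)) => fun i => p.2.1 i)
      (auxMeasure m k l) (Measure.pi fun _ => gaussianReal 0 1) :=
  ((measurePreserving_ofLp k).comp measurePreserving_fst).comp measurePreserving_snd

theorem measurePreserving_auxMeasure_snd (m k l : ℕ) :
    MeasurePreserving (fun p : ((Fin m → ℝ) × (Fin m → ℝ)) ×
      (EuclideanSpace ℝ (Fin k) × (Fin l → ℝ)) => p.2.2)
      (auxMeasure m k l) (Measure.pi fun _ => gaussianReal 0 1) :=
  measurePreserving_snd.comp measurePreserving_snd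

/-- Near a parameter where `τ² < α meanSqDist s w τ`, the distance to the box exceeds `τ ‖q‖ + 2`
simultaneously for all parameters, with probability tending to one. -/
theorem exists_nhds_tendsto_auxMeasure (hα : 2 < α)
    (hm : Tendsto (fun n : ℕ => (m n : ℝ) / (n : ℝ)) atTop (𝓝 α)) {s₀ w₀ τ₀ : ℝ}
    (hτ₀ : 0 ≤ τ₀) (h₀ : τ₀ ^ 2 < α * meanSqDist s₀ w₀ τ₀) :
    ∃ U ∈ 𝓝 ((s₀, w₀, τ₀) : ℝ × ℝ × ℝ), Tendsto (fun n => auxMeasure (m n) n (m n)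
      {p | ∃ x ∈ U ∩ {x | 0 ≤ x.2.2}, boxDist p.1.1 (fun i => x.1 * p.1.1 i + x.2.1 * p.1.2 i +
        x.2.2 * p.2.2 i) < x.2.2 * ‖p.2.1‖ + 2}) atTop (𝓝 0) := by
  obtain ⟨D, hD⟩ : ∃ D, D = meanSqDist s₀ w₀ τ₀ := ⟨_, rfl⟩
  obtain ⟨C, hC⟩ : ∃ C, C = ∫ z, tripleSq z ∂gaussianTriple := ⟨_, rfl⟩
  have hC0 : 0 ≤ C := by
    rw [hC]
    refine integral_nonneg fun z => ?_
    change 0 ≤ z.1 ^ 2 + z.2.1 ^ 2 + z.2.2 ^ 2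
    positivity
  rw [← hD] at h₀
  -- the radius `c` is so small that the limiting inequality is stable under it
  obtain ⟨c, hc, hφ⟩ : ∃ c : ℝ, 0 < c ∧
      0 < √(α * (D - c)) - c * √(3 * α * (C + 1)) - (τ₀ + c) * √(1 + c) := by
    have hcont : ContinuousAt (fun c : ℝ =>
        √(α * (D - c)) - c * √(3 * α * (C + 1)) - (τ₀ + c) * √(1 + c)) 0 := by fun_prop
    have hpos : 0 < (fun c : ℝ =>
        √(α * (D - c)) - c * √(3 * α * (C + 1)) - (τ₀ + c) * √(1 + c)) 0 := by
      have := (Real.lt_sqrt hτ₀).2 h₀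
      simpa using this
    have := (hcont.eventually (lt_mem_nhds hpos)).filter_mono
      (nhdsWithin_le_nhds (s := Set.Ioi 0))
    obtain ⟨c, h1, h2⟩ := (this.and self_mem_nhdsWithin).exists
    exact ⟨c, h2, h1⟩
  have hkm := tendsto_sampleSize hα hm
  have t1 := tendsto_measure_sum_sub_ge gaussianTriple (memLp_sqDist s₀ w₀ τ₀) hkm _
    (fun n => measurePreserving_auxMeasure_right (m n) n) hc
  have t2 := tendsto_measure_sum_sub_ge gaussianTriple memLp_tripleSq hkm _
    (fun n => measurePreserving_auxMeasure_right (m n) n) one_pos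
  have t3 := tendsto_measure_sum_sub_ge (gaussianReal 0 1) memLp_sq_gaussianReal tendsto_id _
    (fun n => measurePreserving_auxMeasure_vec (m n) n (m n)) hc
  refine ⟨Metric.ball (s₀, w₀, τ₀) c, Metric.ball_mem_nhds _ hc, ?_⟩
  have t := (t1.add t2).add t3
  rw [add_zero, add_zero] at t
  have hev : ∀ᶠ n : ℕ in atTop, (τ₀ + c) * √(n * (1 + c)) + 2 + c * √(3 * (m n * (C + 1))) ≤
      √(m n * (D - c)) := by
    have l1 : Tendsto (fun n : ℕ => √((m n : ℝ) / n * (D - c)) -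
        c * √(3 * ((m n : ℝ) / n) * (C + 1)) - (τ₀ + c) * √(1 + c) - 2 * (√(n : ℝ))⁻¹) atTop
        (𝓝 (√(α * (D - c)) - c * √(3 * α * (C + 1)) - (τ₀ + c) * √(1 + c) - 2 * 0)) := by
      have l2 : Tendsto (fun n : ℕ => (√(n : ℝ))⁻¹) atTop (𝓝 0) :=
        (Real.tendsto_sqrt_atTop.comp tendsto_natCast_atTop_atTop).inv_tendsto_atTop
      exact (((hm.mul_const _).sqrt.sub (((hm.const_mul 3).mul_const _).sqrt.const_mul c)).sub_const
        _).sub (l2.const_mul 2)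
    rw [mul_zero, sub_zero] at l1
    filter_upwards [l1.eventually (lt_mem_nhds hφ), eventually_gt_atTop 0] with n hn hn0
    have hn' : (0 : ℝ) < n := by exact_mod_cast hn0
    have hs : 0 < √(n : ℝ) := Real.sqrt_pos.2 hn'
    have e1 : √(m n * (D - c)) = √(n : ℝ) * √((m n : ℝ) / n * (D - c)) := by
      rw [← Real.sqrt_mul hn'.le]; congr 1; field_simp
    have e2 : √(3 * (m n * (C + 1))) = √(n : ℝ) * √(3 * ((m n : ℝ) / n) * (C + 1)) := by
      rw [← Real.sqrt_mul hn'.le]; congr 1; field_simp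
    rw [e1, e2, Real.sqrt_mul hn'.le]
    have := mul_pos hs hn
    have e3 : √(n : ℝ) * (√(n : ℝ))⁻¹ = 1 := mul_inv_cancel₀ hs.ne'
    nlinarith
  refine tendsto_of_tendsto_of_tendsto_of_le_of_le' tendsto_const_nhds t
    (Eventually.of_forall fun _ => zero_le) ?_
  filter_upwards [hev] with n hn
  refine (measure_mono ?_).trans ((measure_union_le _ _).trans
    (add_le_add_left (measure_union_le _ _) _))
  rintro p ⟨⟨s, w, τ⟩, ⟨hball, hτ⟩, hlt⟩
  by_contra hcon
  simp only [Set.mem_union, Set.mem_ofPred_eq, not_or, not_le] at hcon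
  obtain ⟨⟨b1, b2⟩, b3⟩ := hcon
  simp only [Set.mem_ofPred_eq] at hτ hlt
  rw [Metric.mem_ball, Prod.dist_eq, Prod.dist_eq, max_lt_iff, max_lt_iff, Real.dist_eq,
    Real.dist_eq, Real.dist_eq] at hball
  obtain ⟨d1, d2, d3⟩ := hball
  simp only at d1 d2 d3
  rw [← hC] at b2
  change |_ - _ * meanSqDist s₀ w₀ τ₀| < _ at b1
  rw [← hD] at b1
  rw [integral_sq_gaussianReal] at b3
  have hq : ‖p.2.1‖ ≤ √(n * (1 + c)) := by
    rw [EuclideanSpace.norm_eq]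
    refine Real.sqrt_le_sqrt ?_
    have := (abs_lt.1 b3).2
    simp only [Real.norm_eq_abs, sq_abs, id] at this ⊢
    linarith
  have hΔ0 : √(m n * (D - c)) ≤
      boxDist p.1.1 (fun i => s₀ * p.1.1 i + w₀ * p.1.2 i + τ₀ * p.2.2 i) := by
    refine Real.sqrt_le_sqrt ?_
    have := (abs_lt.1 b1).1
    linarith
  have hΔ := boxDist_le_add p.1.1 (fun i => s₀ * p.1.1 i + w₀ * p.1.2 i + τ₀ * p.2.2 i)
    (fun i => s * p.1.1 i + w * p.1.2 i + τ * p.2.2 i)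
  have hdiff : √(∑ i, (s₀ * p.1.1 i + w₀ * p.1.2 i + τ₀ * p.2.2 i -
      (s * p.1.1 i + w * p.1.2 i + τ * p.2.2 i)) ^ 2) ≤ c * √(3 * (m n * (C + 1))) := by
    have hcs : c * √(3 * (m n * (C + 1))) = √(c ^ 2 * (3 * (m n * (C + 1)))) := by
      rw [Real.sqrt_mul (sq_nonneg c), Real.sqrt_sq hc.le]
    rw [hcs]
    refine Real.sqrt_le_sqrt ?_
    have hb := (abs_lt.1 b2).2
    have hsum : ∑ i, (s₀ * p.1.1 i + w₀ * p.1.2 i + τ₀ * p.2.2 i -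
        (s * p.1.1 i + w * p.1.2 i + τ * p.2.2 i)) ^ 2 ≤
        ∑ i, c ^ 2 * 3 * tripleSq (p.1.1 i, p.1.2 i, p.2.2 i) := by
      refine Finset.sum_le_sum fun i _ => ?_
      have q1 : (s - s₀) ^ 2 ≤ c ^ 2 := sq_le_sq' (by linarith [(abs_lt.1 d1).1])
        (abs_lt.1 d1).2.le
      have q2 : (w - w₀) ^ 2 ≤ c ^ 2 := sq_le_sq' (by linarith [(abs_lt.1 d2).1])
        (abs_lt.1 d2).2.le
      have q3 : (τ - τ₀) ^ 2 ≤ c ^ 2 := sq_le_sq' (by linarith [(abs_lt.1 d3).1])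
        (abs_lt.1 d3).2.le
      have r1 := mul_le_mul_of_nonneg_right q1 (sq_nonneg (p.1.1 i))
      have r2 := mul_le_mul_of_nonneg_right q2 (sq_nonneg (p.1.2 i))
      have r3 := mul_le_mul_of_nonneg_right q3 (sq_nonneg (p.2.2 i))
      rw [← mul_pow] at r1 r2 r3
      have h3 : ∀ a b d : ℝ, (a + b + d) ^ 2 ≤ 3 * (a ^ 2 + b ^ 2 + d ^ 2) := fun a b d => by
        nlinarith [sq_nonneg (a - b), sq_nonneg (a - d), sq_nonneg (b - d)]
      have h4 := h3 ((s - s₀) * p.1.1 i) ((w - w₀) * p.1.2 i) ((τ - τ₀) * p.2.2 i)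
      have h5 : (s₀ * p.1.1 i + w₀ * p.1.2 i + τ₀ * p.2.2 i -
        (s * p.1.1 i + w * p.1.2 i + τ * p.2.2 i)) ^ 2 =
        ((s - s₀) * p.1.1 i + (w - w₀) * p.1.2 i + (τ - τ₀) * p.2.2 i) ^ 2 := by ring
      rw [h5, tripleSq]
      simp only
      linarith
    rw [← Finset.mul_sum] at hsum
    refine hsum.trans ?_
    rw [mul_assoc]
    refine mul_le_mul_of_nonneg_left ?_ (sq_nonneg c)
    linarith
  have hτq : τ * ‖p.2.1‖ ≤ (τ₀ + c) * √(n * (1 + c)) :=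
    mul_le_mul (by linarith [(abs_lt.1 d3).2]) hq (norm_nonneg _) (by linarith)
  linarith

/-- The uniform version of `exists_nhds_tendsto_auxMeasure` over a compact set of parameters. -/
theorem tendsto_auxMeasure_exists_boxDist_lt (hα : 2 < α)
    (hm : Tendsto (fun n : ℕ => (m n : ℝ) / (n : ℝ)) atTop (𝓝 α)) {K : Set (ℝ × ℝ × ℝ)}
    (hK : IsCompact K) (hτ : ∀ x ∈ K, 0 ≤ x.2.2)
    (hKlt : ∀ x ∈ K, x.2.2 ^ 2 < α * meanSqDist x.1 x.2.1 x.2.2) :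
    Tendsto (fun n => auxMeasure (m n) n (m n)
      {p | ∃ x ∈ K, boxDist p.1.1 (fun i => x.1 * p.1.1 i + x.2.1 * p.1.2 i +
        x.2.2 * p.2.2 i) < x.2.2 * ‖p.2.1‖ + 2}) atTop (𝓝 0) := by
  refine hK.induction_on (p := fun S => Tendsto (fun n => auxMeasure (m n) n (m n)
      {p | ∃ x ∈ S, boxDist p.1.1 (fun i => x.1 * p.1.1 i + x.2.1 * p.1.2 i +
        x.2.2 * p.2.2 i) < x.2.2 * ‖p.2.1‖ + 2}) atTop (𝓝 0)) ?_ ?_ ?_ ?_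
  · simp
  · intro S T hST hT
    refine tendsto_of_tendsto_of_tendsto_of_le_of_le tendsto_const_nhds hT
      (fun _ => zero_le) fun n => measure_mono ?_
    rintro p ⟨x, hx, h⟩
    exact ⟨x, hST hx, h⟩
  · intro S T hS hT
    have h := hS.add hT
    rw [add_zero] at h
    refine tendsto_of_tendsto_of_tendsto_of_le_of_le tendsto_const_nhds h
      (fun _ => zero_le) fun n => (measure_mono ?_).trans (measure_union_le _ _)
    rintro p ⟨x, hx | hx, h⟩
    exacts [Or.inl ⟨x, hx, h⟩, Or.inr ⟨x, hx, h⟩]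
  · rintro ⟨s, w, τ⟩ hx
    obtain ⟨U, hU, h⟩ := exists_nhds_tendsto_auxMeasure hα hm (hτ _ hx) (hKlt _ hx)
    refine ⟨U ∩ K, Filter.inter_mem (mem_nhdsWithin_of_mem_nhds hU) self_mem_nhdsWithin, ?_⟩
    refine tendsto_of_tendsto_of_tendsto_of_le_of_le tendsto_const_nhds h
      (fun _ => zero_le) fun n => measure_mono ?_
    rintro p ⟨x, hx, h⟩
    exact ⟨x, ⟨hx.1, hτ x hx.2⟩, h⟩

/-- Chebyshev's inequality for the projection of a Gaussian vector to a line. -/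
theorem measure_sq_sum_mul_ge {n : ℕ} {e : Fin n → ℝ} (he : ∑ i, e i ^ 2 = 1) {r : ℝ}
    (hr : 0 < r) : (Measure.pi fun _ : Fin n => gaussianReal 0 1)
      {h | r ≤ (∑ i, e i * h i) ^ 2} ≤ ENNReal.ofReal (1 / r) := by
  have hmem : ∀ i : Fin n, MemLp (fun x : ℝ => e i * x) 2 (gaussianReal 0 1) := fun i =>
    IsGaussian.memLp_two_id.const_mul (e i)
  have hmem' : ∀ i : Fin n, MemLp (fun h : Fin n → ℝ => e i * h i) 2
      (Measure.pi fun _ : Fin n => gaussianReal 0 1) := fun i =>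
    (hmem i).comp_measurePreserving (measurePreserving_eval _ i)
  have hsum : MemLp (∑ i : Fin n, fun h : Fin n → ℝ => e i * h i) 2
      (Measure.pi fun _ : Fin n => gaussianReal 0 1) := memLp_finsetSum' _ fun i _ => hmem' i
  have hmean : (Measure.pi fun _ : Fin n => gaussianReal 0 1)[∑ i : Fin n,
      fun h : Fin n → ℝ => e i * h i] = 0 := by
    simp only [Finset.sum_apply]
    rw [integral_finsetSum _ fun i _ => (hmem' i).integrable (by norm_num)]
    refine Finset.sum_eq_zero fun i _ => ?_
    have hev := (measurePreserving_eval (fun _ : Fin n => gaussianReal 0 1) i)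
    have h := integral_map (μ := Measure.pi fun _ : Fin n => gaussianReal 0 1)
      (f := fun x : ℝ => e i * x) hev.measurable.aemeasurable
      (by rw [hev.map_eq]; exact (hmem i).1)
    rw [hev.map_eq, integral_const_mul, integral_id_gaussianReal, mul_zero] at h
    exact h.symm
  have hcheb := meas_ge_le_variance_div_sq hsum (Real.sqrt_pos.2 hr)
  rw [hmean, variance_sum_pi hmem] at hcheb
  have hvar : ∀ i : Fin n, Var[fun x : ℝ => e i * x; gaussianReal 0 1] = e i ^ 2 := fun i => by
    have h := variance_const_mul (e i) (fun x : ℝ => x) (gaussianReal 0 1)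
    rw [variance_fun_id_gaussianReal] at h
    simpa using h
  simp only [hvar, he, Real.sq_sqrt hr.le] at hcheb
  refine (measure_mono fun h hh => ?_).trans hcheb
  simp only [Set.mem_ofPred_eq, sub_zero, Finset.sum_apply] at hh ⊢
  rw [← Real.sqrt_sq_eq_abs]
  exact Real.sqrt_le_sqrt hh

/-- At a parameter where `α meanSqDist s w τ < τ²`, the distance to the box is exceeded by `τ`
times the norm of the projection of `h` to the orthogonal complement of `e` and `u`. -/
theorem eventually_auxMeasure_lt_boxDist_le (hα : 2 < α)
    (hm : Tendsto (fun n : ℕ => (m n : ℝ) / (n : ℝ)) atTop (𝓝 α)) {s w τ : ℝ}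
    (hτ : 0 < τ) (h₀ : α * meanSqDist s w τ < τ ^ 2) {η : ENNReal} (hη : 0 < η) :
    ∀ᶠ n in atTop, ∀ e u : Fin n → ℝ, ∑ i, e i ^ 2 = 1 → ∑ i, u i ^ 2 = 1 →
      auxMeasure (m n) (m n) n {p | τ * √(∑ i, p.2.2 i ^ 2 - (∑ i, e i * p.2.2 i) ^ 2 -
        (∑ i, u i * p.2.2 i) ^ 2) - τ < boxDist p.1.1 (fun i => s * p.1.1 i + w * p.1.2 i +
        -τ * p.2.1 i)} ≤ η := by
  obtain ⟨D, hD⟩ : ∃ D, D = meanSqDist s w τ := ⟨_, rfl⟩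
  have hD' : D = meanSqDist s w (-τ) := by rw [hD, meanSqDist_eq, meanSqDist_eq, neg_sq]
  rw [← hD] at h₀
  obtain ⟨c, hc, hφ⟩ : ∃ c : ℝ, 0 < c ∧ 0 < τ * √(1 - 3 * c) - √(α * (D + c)) := by
    have hcont : ContinuousAt (fun c : ℝ => τ * √(1 - 3 * c) - √(α * (D + c))) 0 := by fun_prop
    have hpos : 0 < (fun c : ℝ => τ * √(1 - 3 * c) - √(α * (D + c))) 0 := by
      have := (Real.sqrt_lt' hτ).2 h₀
      simpa using this
    have := (hcont.eventually (lt_mem_nhds hpos)).filter_mono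
      (nhdsWithin_le_nhds (s := Set.Ioi 0))
    obtain ⟨c, h1, h2⟩ := (this.and self_mem_nhdsWithin).exists
    exact ⟨c, h2, h1⟩
  have hkm := tendsto_sampleSize hα hm
  have t1 := tendsto_measure_sum_sub_ge gaussianTriple (memLp_sqDist s w (-τ)) hkm _
    (fun n => measurePreserving_auxMeasure_left (m n) n) hc
  have t2 := tendsto_measure_sum_sub_ge (gaussianReal 0 1) memLp_sq_gaussianReal tendsto_id _
    (fun n => measurePreserving_auxMeasure_snd (m n) (m n) n) hc
  have t3 : Tendsto (fun n : ℕ => ENNReal.ofReal (1 / (c * n))) atTop (𝓝 0) := by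
    have h1 : Tendsto (fun n : ℕ => 1 / (c * (n : ℝ))) atTop (𝓝 0) :=
      (tendsto_natCast_atTop_atTop.const_mul_atTop hc).const_div_atTop 1
    simpa using ENNReal.tendsto_ofReal h1
  have t := (t1.add t2).add (t3.add t3)
  simp only [add_zero] at t
  have hev : ∀ᶠ n : ℕ in atTop, √(m n * (D + c)) ≤ τ * √(n * (1 - 3 * c)) - τ := by
    have l1 : Tendsto (fun n : ℕ => τ * √(1 - 3 * c) - √((m n : ℝ) / n * (D + c)) -
        τ * (√(n : ℝ))⁻¹) atTop (𝓝 (τ * √(1 - 3 * c) - √(α * (D + c)) - τ * 0)) := by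
      have l2 : Tendsto (fun n : ℕ => (√(n : ℝ))⁻¹) atTop (𝓝 0) :=
        (Real.tendsto_sqrt_atTop.comp tendsto_natCast_atTop_atTop).inv_tendsto_atTop
      exact ((hm.mul_const _).sqrt.const_sub _).sub (l2.const_mul τ)
    rw [mul_zero, sub_zero] at l1
    filter_upwards [l1.eventually (lt_mem_nhds hφ), eventually_gt_atTop 0] with n hn hn0
    have hn' : (0 : ℝ) < n := by exact_mod_cast hn0
    have hs : 0 < √(n : ℝ) := Real.sqrt_pos.2 hn'
    have e1 : √(m n * (D + c)) = √(n : ℝ) * √((m n : ℝ) / n * (D + c)) := by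
      rw [← Real.sqrt_mul hn'.le]; congr 1; field_simp
    rw [e1, Real.sqrt_mul hn'.le]
    have := mul_pos hs hn
    have e3 : √(n : ℝ) * (√(n : ℝ))⁻¹ = 1 := mul_inv_cancel₀ hs.ne'
    nlinarith
  filter_upwards [hev, t.eventually (gt_mem_nhds hη), eventually_gt_atTop 0] with n hn hlt hn0
  intro e u he hu
  have hr : 0 < c * n := mul_pos hc (by exact_mod_cast hn0)
  have hproj : ∀ e : Fin n → ℝ, ∑ i, e i ^ 2 = 1 → auxMeasure (m n) (m n) n
      {p | c * n ≤ (∑ i, e i * p.2.2 i) ^ 2} ≤ ENNReal.ofReal (1 / (c * n)) := fun e he =>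
    ((measurePreserving_auxMeasure_snd (m n) (m n) n).measure_preimage_le
      {h | c * n ≤ (∑ i, e i * h i) ^ 2}).trans (measure_sq_sum_mul_ge he hr)
  refine le_trans ?_ hlt.le
  refine (measure_mono ?_).trans ((measure_union_le _ _).trans (add_le_add
    (measure_union_le _ _) ((measure_union_le _ _).trans (add_le_add (hproj e he) (hproj u hu)))))
  intro p hp
  by_contra hcon
  simp only [Set.mem_union, Set.mem_ofPred_eq, not_or, not_le] at hcon hp
  obtain ⟨⟨b1, b2⟩, b3, b4⟩ := hcon
  change |_ - _ * meanSqDist s w (-τ)| < _ at b1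
  rw [← hD'] at b1
  rw [integral_sq_gaussianReal] at b2
  have hΔ : boxDist p.1.1 (fun i => s * p.1.1 i + w * p.1.2 i + -τ * p.2.1 i) ≤
      √(m n * (D + c)) := by
    refine Real.sqrt_le_sqrt ?_
    have := (abs_lt.1 b1).2
    linarith
  have hP : √(n * (1 - 3 * c)) ≤ √(∑ i, p.2.2 i ^ 2 - (∑ i, e i * p.2.2 i) ^ 2 -
        (∑ i, u i * p.2.2 i) ^ 2) := by
    refine Real.sqrt_le_sqrt ?_
    have := (abs_lt.1 b2).1
    simp only [id] at this
    linarith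
  have := mul_le_mul_of_nonneg_left hP hτ.le
  linarith

end Asymptotics

/-! ### Smoothness of the squared distance to an interval -/

theorem hasDerivAt_max_zero_sq (x : ℝ) :
    HasDerivAt (fun x : ℝ => max x 0 ^ 2) (2 * max x 0) x := by
  rcases lt_trichotomy x 0 with h | h | h
  · rw [max_eq_right h.le, mul_zero]
    refine (hasDerivAt_const x (0 : ℝ)).congr_of_eventuallyEq ?_
    filter_upwards [gt_mem_nhds h] with y hy
    rw [max_eq_right hy.le]
    norm_num
  · subst h
    rw [max_self, mul_zero]
    refine HasDerivAt.of_isLittleO ?_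
    have : (fun x' : ℝ => max x' 0 ^ 2 - max (0 : ℝ) 0 ^ 2 - (x' - 0) • (0 : ℝ)) =O[𝓝 0]
        fun x' => x' ^ 2 := by
      refine Asymptotics.IsBigO.of_bound 1 (Eventually.of_forall fun y => ?_)
      simp only [max_self, smul_zero, sub_zero, Real.norm_eq_abs, abs_pow, one_mul, ne_eq,
        OfNat.ofNat_ne_zero, not_false_eq_true, zero_pow]
      refine pow_le_pow_left₀ (abs_nonneg _) ?_ 2
      rcases le_total y 0 with h | h
      · rw [max_eq_right h]; simp
      · rw [max_eq_left h]
    refine this.trans_isLittleO ?_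
    simpa using Asymptotics.isLittleO_pow_id (𝕜 := ℝ) (by norm_num : 1 < 2)
  · rw [max_eq_left h.le]
    have := hasDerivAt_pow 2 x
    refine (this.congr_deriv (by norm_num)).congr_of_eventuallyEq ?_
    filter_upwards [lt_mem_nhds h] with y hy
    rw [max_eq_left hy.le]

/-- The displacement from `y` to the nearest point of `[-|g|, |g|]`. -/
def clipResidual (g y : ℝ) : ℝ := max (y - |g|) 0 - max (-y - |g|) 0

theorem sqDist_eq_add (g y : ℝ) :
    sqDist g y = max (y - |g|) 0 ^ 2 + max (-y - |g|) 0 ^ 2 := by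
  have hg := abs_nonneg g
  rw [sqDist]
  rcases le_total 0 y with h | h
  · rw [abs_of_nonneg h, max_eq_right (a := -y - |g|) (by linarith)]; ring
  · rw [abs_of_nonpos h, max_eq_right (a := y - |g|) (by linarith)]; ring

theorem clipResidual_sq (g y : ℝ) : clipResidual g y ^ 2 = sqDist g y := by
  have hg := abs_nonneg g
  rw [sqDist, clipResidual]
  rcases le_total 0 y with h | h
  · rw [abs_of_nonneg h, max_eq_right (a := -y - |g|) (by linarith)]; ring
  · rw [abs_of_nonpos h, max_eq_right (a := y - |g|) (by linarith)]; ring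

theorem hasDerivAt_sqDist (g y : ℝ) : HasDerivAt (sqDist g) (2 * clipResidual g y) y := by
  have h1 := (hasDerivAt_max_zero_sq (y - |g|)).comp y ((hasDerivAt_id y).sub_const |g|)
  have h2 := (hasDerivAt_max_zero_sq (-y - |g|)).comp y ((hasDerivAt_neg y).sub_const |g|)
  have h3 := h1.add h2
  have he : sqDist g = (fun x : ℝ => max x 0 ^ 2) ∘ (fun x => id x - |g|) +
      (fun x : ℝ => max x 0 ^ 2) ∘ (fun x => -x - |g|) := by
    ext x
    exact sqDist_eq_add g x
  rw [he]
  refine h3.congr_deriv ?_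
  rw [clipResidual]
  ring

/-- A smooth `1`-Lipschitz substitute for the distance from `c + v` to the box with half-widths
`|g i|`. -/
def smoothBoxDist {d : Type*} [Fintype d] (g c v : d → ℝ) : ℝ :=
  √(1 + ∑ i, sqDist (g i) (c i + v i))

theorem hasFDerivAt_sqrt_one_add_sum {d : Type*} [Fintype d] {S : (d → ℝ) → ℝ}
    {r : d → (d → ℝ) → ℝ} {v : d → ℝ} (hS : HasFDerivAt S
      (∑ a, (2 * r a v) • (ContinuousLinearMap.proj a : (d → ℝ) →L[ℝ] ℝ)) v) (h0 : 0 ≤ S v) :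
    HasFDerivAt (fun v => √(1 + S v))
      (∑ a, (r a v / √(1 + S v)) • (ContinuousLinearMap.proj a : (d → ℝ) →L[ℝ] ℝ)) v := by
  have hne : 1 + S v ≠ 0 := by positivity
  refine ((hS.const_add 1).sqrt hne).congr_fderiv ?_
  rw [Finset.smul_sum]
  refine Finset.sum_congr rfl fun a _ => ?_
  rw [smul_smul]
  congr 1
  have : √(1 + S v) ≠ 0 := (Real.sqrt_pos.2 (by positivity)).ne'
  field_simp

theorem hasFDerivAt_smoothBoxDist {d : Type*} [Fintype d] (g c v : d → ℝ) :
    HasFDerivAt (smoothBoxDist g c)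
      (∑ a, (clipResidual (g a) (c a + v a) / smoothBoxDist g c v) •
        (ContinuousLinearMap.proj a : (d → ℝ) →L[ℝ] ℝ)) v := by
  refine hasFDerivAt_sqrt_one_add_sum (S := fun v : d → ℝ => ∑ i, sqDist (g i) (c i + v i))
    (r := fun a v => clipResidual (g a) (c a + v a)) ?_
    (Finset.sum_nonneg fun _ _ => sqDist_nonneg _ _)
  refine HasFDerivAt.fun_sum fun a _ => ?_
  exact (hasDerivAt_sqDist (g a) (c a + v a)).comp_hasFDerivAt v
    ((ContinuousLinearMap.proj (R := ℝ) (φ := fun _ : d => ℝ) a).hasFDerivAt.const_add (c a))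

theorem smoothBoxDist_pos {d : Type*} [Fintype d] (g c v : d → ℝ) : 0 < smoothBoxDist g c v :=
  Real.sqrt_pos.2 (add_pos_of_pos_of_nonneg one_pos
    (Finset.sum_nonneg fun _ _ => sqDist_nonneg _ _))

theorem continuous_smoothBoxDist {d X : Type*} [Fintype d] [TopologicalSpace X]
    {g c v : X → d → ℝ} (hg : Continuous g) (hc : Continuous c) (hv : Continuous v) :
    Continuous fun x => smoothBoxDist (g x) (c x) (v x) := by
  unfold smoothBoxDist
  refine Continuous.sqrt (continuous_const.add (continuous_finsetSum _ fun i _ => ?_))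
  exact continuous_sqDist.comp (f := fun x => (g x i, c x i + v x i)) (by fun_prop)

theorem continuous_clipResidual_div {d : Type*} [Fintype d] (g c : d → ℝ) (a : d) :
    Continuous fun v : d → ℝ => clipResidual (g a) (c a + v a) / smoothBoxDist g c v := by
  unfold clipResidual
  refine Continuous.div (by fun_prop)
    (continuous_smoothBoxDist continuous_const continuous_const continuous_id) fun v => ?_
  exact (smoothBoxDist_pos g c v).ne'

theorem sum_clipResidual_div_sq_le {d : Type*} [Fintype d] (g c v : d → ℝ) :
    ∑ a, (clipResidual (g a) (c a + v a) / smoothBoxDist g c v) ^ 2 ≤ 1 := by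
  simp only [div_pow, clipResidual_sq]
  rw [← Finset.sum_div]
  have h0 : 0 ≤ ∑ i, sqDist (g i) (c i + v i) := Finset.sum_nonneg fun _ _ => sqDist_nonneg _ _
  rw [smoothBoxDist, Real.sq_sqrt (by positivity), div_le_one (by positivity)]
  linarith

theorem boxDist_le_smoothBoxDist {k : ℕ} (g c v : Fin k → ℝ) :
    boxDist g (fun i => c i + v i) ≤ smoothBoxDist g c v :=
  Real.sqrt_le_sqrt (by linarith)

theorem sqDist_eq_zero {g y : ℝ} (h : |y| ≤ |g|) : sqDist g y = 0 := by
  rw [sqDist, max_eq_right (by linarith)]; norm_num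

/-! ### The sensing vectors in coordinates -/

section Rows

variable {E : Type*} [NormedAddCommGroup E] [InnerProductSpace ℝ E]

/-- The component of `b` orthogonal to `e` and `u` (for orthonormal `e`, `u`). -/
def orthPart (e u b : E) : E := b - (inner ℝ e b : ℝ) • e - (inner ℝ u b : ℝ) • u

variable {e u : E}

theorem inner_orthPart_left (b z : E) : (inner ℝ (orthPart e u b) z : ℝ) =
    inner ℝ b (orthPart e u z) := by
  simp only [orthPart, inner_sub_left, inner_sub_right, real_inner_smul_left,
    real_inner_smul_right]
  rw [real_inner_comm b e, real_inner_comm b u]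
  ring

theorem inner_left_orthPart (he : ‖e‖ = 1) (heu : (inner ℝ e u : ℝ) = 0) (b : E) :
    (inner ℝ e (orthPart e u b) : ℝ) = 0 := by
  simp only [orthPart, inner_sub_right, real_inner_smul_right, heu, real_inner_self_eq_norm_sq, he]
  ring

theorem inner_right_orthPart (hu : ‖u‖ = 1) (heu : (inner ℝ e u : ℝ) = 0) (b : E) :
    (inner ℝ u (orthPart e u b) : ℝ) = 0 := by
  rw [real_inner_comm] at heu
  simp only [orthPart, inner_sub_right, real_inner_smul_right, heu, real_inner_self_eq_norm_sq, hu]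
  ring

theorem orthPart_orthPart (he : ‖e‖ = 1) (hu : ‖u‖ = 1) (heu : (inner ℝ e u : ℝ) = 0) (b : E) :
    orthPart e u (orthPart e u b) = orthPart e u b := by
  conv_lhs => rw [orthPart]
  rw [inner_left_orthPart he heu, inner_right_orthPart hu heu]
  simp

theorem norm_orthPart_sq (he : ‖e‖ = 1) (hu : ‖u‖ = 1) (heu : (inner ℝ e u : ℝ) = 0) (b : E) :
    ‖orthPart e u b‖ ^ 2 = ‖b‖ ^ 2 - (inner ℝ e b : ℝ) ^ 2 - (inner ℝ u b : ℝ) ^ 2 := by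
  rw [← real_inner_self_eq_norm_sq, inner_orthPart_left, orthPart_orthPart he hu heu]
  simp only [orthPart, inner_sub_right, real_inner_smul_right, real_inner_self_eq_norm_sq]
  rw [real_inner_comm b e, real_inner_comm b u]
  ring

theorem norm_orthPart_le (he : ‖e‖ = 1) (hu : ‖u‖ = 1) (heu : (inner ℝ e u : ℝ) = 0) (b : E) :
    ‖orthPart e u b‖ ≤ ‖b‖ := by
  refine le_of_sq_le_sq ?_ (norm_nonneg _)
  rw [norm_orthPart_sq he hu heu]
  nlinarith [sq_nonneg (inner ℝ e b : ℝ), sq_nonneg (inner ℝ u b : ℝ)]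

@[fun_prop]
theorem continuous_orthPart : Continuous (orthPart e u) := by
  unfold orthPart
  fun_prop

variable [FiniteDimensional ℝ E] [MeasurableSpace E] [BorelSpace E]

/-- Splitting off both axes: a standard Gaussian vector is assembled from its components along `e`
and `u`, which are independent, and an independent orthogonal part. -/
theorem measurePreserving_coords (he : ‖e‖ = 1) (hu : ‖u‖ = 1) (heu : (inner ℝ e u : ℝ) = 0) :
    MeasurePreserving (fun p : ℝ × ℝ × E => p.1 • e + p.2.1 • u + orthPart e u p.2.2)
      ((gaussianReal 0 1).prod ((gaussianReal 0 1).prod (stdGaussian E))) (stdGaussian E) := by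
  have h1 : MeasurePreserving (fun p : ℝ × E => p.1 • u + (p.2 - (inner ℝ u p.2 : ℝ) • u))
      ((gaussianReal 0 1).prod (stdGaussian E)) (stdGaussian E) :=
    ⟨by fun_prop, map_axis_add_stdGaussian hu⟩
  have h2 : MeasurePreserving (fun p : ℝ × E => p.1 • e + (p.2 - (inner ℝ e p.2 : ℝ) • e))
      ((gaussianReal 0 1).prod (stdGaussian E)) (stdGaussian E) :=
    ⟨by fun_prop, map_axis_add_stdGaussian he⟩
  have h3 := h2.comp ((MeasurePreserving.id (gaussianReal 0 1)).prod h1)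
  convert h3 using 1
  ext p
  simp only [Function.comp, Prod.map, id, orthPart, inner_add_right, inner_sub_right,
    real_inner_smul_right, heu]
  module

/-- Sensing vectors with prescribed components along `e` and `u`. -/
def rows {m : ℕ} (e u : E) (p : ((Fin m → ℝ) × (Fin m → ℝ)) × PiLp 2 fun _ : Fin m => E) :
    Fin m → E :=
  fun i => p.1.1 i • e + p.1.2 i • u + orthPart e u (p.2 i)

theorem measurePreserving_rows (m : ℕ) (he : ‖e‖ = 1) (hu : ‖u‖ = 1)
    (heu : (inner ℝ e u : ℝ) = 0) :
    MeasurePreserving (rows (m := m) e u)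
      (((Measure.pi fun _ => gaussianReal 0 1).prod (Measure.pi fun _ => gaussianReal 0 1)).prod
        (stdGaussian (PiLp 2 fun _ : Fin m => E))) (Measure.pi fun _ => stdGaussian E) := by
  have h1 := (measurePreserving_arrowProdEquivProdArrow ℝ E (Fin m) (fun _ => gaussianReal 0 1)
    (fun _ => stdGaussian E)).symm
  have h2 := (measurePreserving_arrowProdEquivProdArrow ℝ (ℝ × E) (Fin m)
    (fun _ => gaussianReal 0 1) (fun _ => (gaussianReal 0 1).prod (stdGaussian E))).symm
  have h3 : MeasurePreserving (fun z : PiLp 2 fun _ : Fin m => E => fun i => z i)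
      (stdGaussian (PiLp 2 fun _ : Fin m => E)) (Measure.pi fun _ => stdGaussian E) := by
    refine ⟨by fun_prop, ?_⟩
    rw [← map_toLp_pi_stdGaussian (Fin m) E, Measure.map_map (by fun_prop) (by fun_prop)]
    exact Measure.map_id
  exact (measurePreserving_pi _ _ fun _ => measurePreserving_coords he hu heu).comp
    ((h2.comp ((MeasurePreserving.id _).prod h1)).comp
      ((measurePreserving_prodAssoc _ _ _).comp ((MeasurePreserving.id _).prod h3)))

end Rows

/-! ### From the sensing vectors to the comparison process: error directions -/

/-- The projection of a closed set along a compact set is closed. -/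
theorem isClosed_exists_mem {X Y : Type*} [TopologicalSpace X] [TopologicalSpace Y] {K : Set X}
    (hK : IsCompact K) {C : Set (X × Y)} (hC : IsClosed C) :
    IsClosed {y | ∃ x ∈ K, (x, y) ∈ C} := by
  have : CompactSpace K := isCompact_iff_compactSpace.1 hK
  have h := isClosedMap_snd_of_compactSpace (X := K) (Y := Y)
    ((fun p : K × Y => ((p.1 : X), p.2)) ⁻¹' C)
    (hC.preimage ((continuous_subtype_val.comp continuous_fst).prodMk continuous_snd))
  convert h using 1
  ext y
  constructor
  · rintro ⟨x, hx, h⟩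
    exact ⟨(⟨x, hx⟩, y), h, rfl⟩
  · rintro ⟨⟨x, y'⟩, h, rfl⟩
    exact ⟨x, x.2, h⟩

/-- Gordon's inequality over a separable index space. -/
theorem gordon_of_separable {d E₁ F S : Type*} [Fintype d] [DecidableEq d]
    [NormedAddCommGroup E₁] [InnerProductSpace ℝ E₁] [FiniteDimensional ℝ E₁]
    [MeasurableSpace E₁] [BorelSpace E₁]
    [NormedAddCommGroup F] [InnerProductSpace ℝ F] [FiniteDimensional ℝ F]
    [MeasurableSpace F] [BorelSpace F] [TopologicalSpace S] [TopologicalSpace.SeparableSpace S]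
    (x : S → F) (α : S → d → E₁)
    (hα : ∀ i j a b, (inner ℝ (α i a) (α j b) : ℝ) = if a = b then inner ℝ (x i) (x j) else 0)
    (Q : S → (d → ℝ) → ℝ) (dQ : S → d → (d → ℝ) → ℝ)
    (hQ : ∀ i v, HasFDerivAt (Q i)
      (∑ a, dQ i a v • (ContinuousLinearMap.proj a : (d → ℝ) →L[ℝ] ℝ)) v)
    (hdQ : ∀ i a, Continuous (dQ i a)) (hQ1 : ∀ i v, ∑ a, dQ i a v ^ 2 ≤ 1)
    (hcont : ∀ z, Continuous fun i => Q i fun a => inner ℝ (α i a) z) :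
    (stdGaussian E₁) {z | ∃ i, Q i (fun a => inner ℝ (α i a) z) < 0} ≤
      2 * ((stdGaussian F).prod (Measure.pi fun _ : d => gaussianReal 0 1))
        {p | ∃ i, (inner ℝ (x i) p.1 : ℝ) + Q i (‖x i‖ • p.2) < 0} := by
  rcases isEmpty_or_nonempty S with hS | hS
  · simp
  obtain ⟨t, ht⟩ : ∃ t, t = TopologicalSpace.denseSeq S := ⟨_, rfl⟩
  have hd : DenseRange t := ht ▸ TopologicalSpace.denseRange_denseSeq S
  have h := gordon (fun k => x (t k)) (fun k => α (t k)) (fun i j => hα (t i) (t j))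
    (fun k => Q (t k)) (fun k => dQ (t k)) (fun k => hQ (t k)) (fun k => hdQ (t k))
    (fun k => hQ1 (t k))
  refine (measure_mono ?_).trans (h.trans (mul_le_mul_right (measure_mono ?_) _))
  · rintro z ⟨i, hi⟩
    obtain ⟨k, hk⟩ := hd.exists_mem_open ((isOpen_Iio (a := (0 : ℝ))).preimage (hcont z)) ⟨i, hi⟩
    exact ⟨k, hk⟩
  · rintro p ⟨k, hk⟩
    exact ⟨t k, hk⟩

/-- Fibrewise comparison of two measures of sets; the dominating set need not be measurable. -/
theorem measure_prod_le_of_sections {X Y₁ Y₂ : Type*} [MeasurableSpace X] [MeasurableSpace Y₁]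
    [MeasurableSpace Y₂] (μ : Measure X) (ν₁ : Measure Y₁) (ν₂ : Measure Y₂) [SFinite ν₁]
    [SFinite ν₂] {S : Set (X × Y₁)} (hS : MeasurableSet S) {T : Set (X × Y₂)}
    (h : ∀ x, ν₁ (Prod.mk x ⁻¹' S) ≤ 2 * ν₂ (Prod.mk x ⁻¹' T)) :
    μ.prod ν₁ S ≤ 2 * μ.prod ν₂ T := by
  rw [Measure.prod_apply hS, ← measure_toMeasurable T,
    Measure.prod_apply (measurableSet_toMeasurable _ _), ← lintegral_const_mul' _ _ (by simp)]
  exact lintegral_mono fun x => (h x).trans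
    (mul_le_mul_right (measure_mono (Set.preimage_mono (subset_toMeasurable _ _))) _)

/-- The parameters of the error directions: with `x = s e + w u + r`, where `r` is orthogonal to
`e` and `u` and `τ = ‖r‖`, these are the points at distance `ε` from `e` whose objective value is
at least that of `e`. -/
def errorParams (ρ ε : ℝ) : Set (ℝ × ℝ × ℝ) :=
  {x | (x.1 - 1) ^ 2 + x.2.1 ^ 2 + x.2.2 ^ 2 = ε ^ 2 ∧ 0 ≤ x.2.2 ∧
    0 ≤ ρ * (x.1 - 1) + √(1 - ρ ^ 2) * x.2.1}

theorem isCompact_errorParams (ρ ε : ℝ) : IsCompact (errorParams ρ ε) := by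
  refine Metric.isCompact_of_isClosed_isBounded ?_ ?_
  · exact IsClosed.and (isClosed_eq (by fun_prop) (by fun_prop))
      (IsClosed.and (isClosed_le (by fun_prop) (by fun_prop))
        (isClosed_le (by fun_prop) (by fun_prop)))
  · refine (Metric.isBounded_closedBall (x := ((1, 0, 0) : ℝ × ℝ × ℝ)) (r := |ε|)).subset ?_
    rintro ⟨s, w, τ⟩ ⟨h, -, -⟩
    simp only at h
    rw [Metric.mem_closedBall, Prod.dist_eq, Prod.dist_eq, max_le_iff, max_le_iff, Real.dist_eq,
      Real.dist_eq, Real.dist_eq]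
    simp only [sub_zero]
    refine ⟨?_, ?_, ?_⟩ <;> refine sq_le_sq.1 ?_ <;>
      nlinarith [sq_nonneg (s - 1), sq_nonneg w, sq_nonneg τ]

theorem isClosed_forall {X ι : Type*} [TopologicalSpace X] {p : ι → X → Prop}
    (h : ∀ i, IsClosed {x | p i x}) : IsClosed {x | ∀ i, p i x} := by
  rw [Set.ofPred_forall]
  exact isClosed_iInter h

theorem inner_toLp_single {d E : Type*} [Fintype d] [DecidableEq d] [NormedAddCommGroup E]
    [InnerProductSpace ℝ E] (i : d) (r : E) (z : PiLp 2 fun _ : d => E) :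
    (inner ℝ (WithLp.toLp 2 (Pi.single i r) : PiLp 2 fun _ : d => E) z : ℝ) =
      inner ℝ r (z i) := by
  rw [PiLp.inner_apply, Finset.sum_eq_single i]
  · simp
  · intro k _ hk
    simp [Pi.single_eq_of_ne hk]
  · simp

section Error

variable {E : Type*} [NormedAddCommGroup E] [InnerProductSpace ℝ E]

/-- The sensing vectors for which some point at distance `r` from `ξ` is feasible and has an
objective value at least that of `ξ`. -/
def errorSet {m : ℕ} (ξ x₀ : E) (r : ℝ) : Set (Fin m → E) :=
  {a | ∃ v : E, ‖v‖ = 1 ∧ 0 ≤ (inner ℝ x₀ v : ℝ) ∧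
    ∀ i, |(inner ℝ (a i) (ξ + r • v) : ℝ)| ≤ |(inner ℝ (a i) ξ : ℝ)|}

variable {e u : E}

theorem inner_rows {m : ℕ} (he : ‖e‖ = 1) (hu : ‖u‖ = 1) (heu : (inner ℝ e u : ℝ) = 0)
    (p : ((Fin m → ℝ) × (Fin m → ℝ)) × PiLp 2 fun _ : Fin m => E) (i : Fin m) (s w : ℝ) (r : E) :
    (inner ℝ (rows e u p i) (s • e + w • u + orthPart e u r) : ℝ) =
      s * p.1.1 i + w * p.1.2 i + inner ℝ (orthPart e u r) (p.2 i) := by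
  have h1 : (inner ℝ u e : ℝ) = 0 := by rw [real_inner_comm]; exact heu
  simp only [rows, inner_add_left, inner_add_right, real_inner_smul_left, real_inner_smul_right,
    real_inner_self_eq_norm_sq, he, hu, heu, h1, inner_left_orthPart he heu,
    inner_right_orthPart hu heu]
  rw [real_inner_comm e (orthPart e u (p.2 i)), real_inner_comm u (orthPart e u (p.2 i)),
    inner_left_orthPart he heu, inner_right_orthPart hu heu,
    ← inner_orthPart_left, orthPart_orthPart he hu heu, inner_orthPart_left,
    real_inner_comm (p.2 i) (orthPart e u r)]
  ring

variable [FiniteDimensional ℝ E]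

theorem isClosed_setOf_mem_errorSet (m : ℕ) (ε : ℝ) :
    IsClosed {p : (E × E) × (Fin m → E) | p.2 ∈ errorSet p.1.1 p.1.2 (ε * ‖p.1.1‖)} := by
  have h := isClosed_exists_mem (Y := (E × E) × (Fin m → E)) (isCompact_sphere (0 : E) 1)
    (C := {q | 0 ≤ (inner ℝ q.2.1.2 q.1 : ℝ) ∧ ∀ i, |(inner ℝ (q.2.2 i) (q.2.1.1 +
      (ε * ‖q.2.1.1‖) • q.1) : ℝ)| ≤ |(inner ℝ (q.2.2 i) q.2.1.1 : ℝ)|})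
    (IsClosed.and (isClosed_le (by fun_prop) (by fun_prop)) (isClosed_forall fun i =>
      isClosed_le (by fun_prop) (by fun_prop)))
  convert h using 1
  ext p
  simp [errorSet]

theorem isClosed_errorSet (m : ℕ) (ξ x₀ : E) (r : ℝ) :
    IsClosed (errorSet ξ x₀ r : Set (Fin m → E)) := by
  have h := isClosed_exists_mem (Y := Fin m → E) (isCompact_sphere (0 : E) 1)
    (C := {q | 0 ≤ (inner ℝ x₀ q.1 : ℝ) ∧ ∀ i, |(inner ℝ (q.2 i) (ξ +
      r • q.1) : ℝ)| ≤ |(inner ℝ (q.2 i) ξ : ℝ)|})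
    (IsClosed.and (isClosed_le (by fun_prop) (by fun_prop)) (isClosed_forall fun i =>
      isClosed_le (by fun_prop) (by fun_prop)))
  convert h using 1
  ext p
  simp [errorSet]

variable [MeasurableSpace E] [BorelSpace E]

/-- Gordon's comparison for fixed components of the sensing vectors along `e` and `u`. If `e + ε v`
is feasible, the smooth distance to the box is exactly `1`, so that subtracting `2` makes the
functional negative and leaves room for passing to a dense set of directions. -/
theorem stdGaussian_errorSet_le {m : ℕ} (he : ‖e‖ = 1) (hu : ‖u‖ = 1)
    (heu : (inner ℝ e u : ℝ) = 0) (ρ : ℝ) {ε : ℝ}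
    (hε : 0 ≤ ε) (gf : (Fin m → ℝ) × (Fin m → ℝ)) :
    stdGaussian (PiLp 2 fun _ : Fin m => E)
      {b | rows e u (gf, b) ∈ errorSet e (ρ • e + √(1 - ρ ^ 2) • u) ε} ≤
    2 * ((stdGaussian E).prod (Measure.pi fun _ : Fin m => gaussianReal 0 1))
      {p | ∃ x ∈ errorParams ρ ε, boxDist gf.1 (fun i => x.1 * gf.1 i + x.2.1 * gf.2 i +
        x.2.2 * p.2 i) < x.2.2 * ‖p.1‖ + 2} := by
  classical
  obtain ⟨cv, hcv⟩ : ∃ cv : E → Fin m → ℝ, cv = fun v i => (1 + ε * inner ℝ e v) * gf.1 i +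
    (ε * inner ℝ u v) * gf.2 i := ⟨_, rfl⟩
  have hdec : ∀ v : E, e + ε • v = (1 + ε * (inner ℝ e v : ℝ)) • e +
      (ε * (inner ℝ u v : ℝ)) • u + orthPart e u (ε • v) := fun v => by
    simp only [orthPart, real_inner_smul_right]
    module
  have h := gordon_of_separable (d := Fin m) (E₁ := PiLp 2 fun _ : Fin m => E) (F := E)
    (S := {v : E // ‖v‖ = 1 ∧ 0 ≤ (inner ℝ (ρ • e + √(1 - ρ ^ 2) • u) v : ℝ)})
    (fun v => orthPart e u (ε • (v : E)))
    (fun v i => WithLp.toLp 2 (Pi.single i (orthPart e u (ε • (v : E)))))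
    (fun v v' i j => by
      rw [inner_toLp_single]
      by_cases hij : i = j
      · subst hij; simp
      · simp [hij])
    (fun v y => smoothBoxDist gf.1 (cv v) y - 2)
    (fun v i y => clipResidual (gf.1 i) (cv v i + y i) / smoothBoxDist gf.1 (cv v) y)
    (fun v y => (hasFDerivAt_smoothBoxDist gf.1 (cv v) y).sub_const 2)
    (fun v i => continuous_clipResidual_div gf.1 (cv v) i)
    (fun v y => sum_clipResidual_div_sq_le gf.1 (cv v) y)
    (fun z => by
      simp only [inner_toLp_single]
      refine Continuous.sub (continuous_smoothBoxDist continuous_const ?_ ?_) continuous_const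
      · rw [hcv]; fun_prop
      · fun_prop)
  refine (measure_mono ?_).trans (h.trans (mul_le_mul_right (measure_mono ?_) _))
  · rintro z ⟨v, hv1, hv2, hv⟩
    refine ⟨⟨v, hv1, hv2⟩, ?_⟩
    have h0 : ∑ i, sqDist (gf.1 i) (cv v i + inner ℝ (orthPart e u (ε • v)) (z i)) = 0 := by
      refine Finset.sum_eq_zero fun i _ => sqDist_eq_zero ?_
      have h1 := hv i
      rw [hdec, inner_rows he hu heu] at h1
      have h2 := inner_rows he hu heu (gf, z) i 1 0 0
      simp only [one_smul, zero_smul, add_zero, orthPart, inner_zero_right, sub_zero,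
        inner_zero_left, one_mul, zero_mul] at h2
      rw [h2] at h1
      rw [hcv]
      exact h1
    simp only [inner_toLp_single]
    rw [smoothBoxDist, h0]
    norm_num
  · rintro p ⟨⟨v, hv1, hv2⟩, hlt⟩
    simp only at hlt
    refine ⟨(1 + ε * inner ℝ e v, ε * inner ℝ u v, ‖orthPart e u (ε • v)‖), ⟨?_, ?_, ?_⟩, ?_⟩
    · simp only
      rw [norm_orthPart_sq he hu heu, norm_smul, hv1, real_inner_smul_right,
        real_inner_smul_right, mul_one, Real.norm_eq_abs, sq_abs]
      ring
    · exact norm_nonneg _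
    · simp only [inner_add_left, real_inner_smul_left] at hv2 ⊢
      have h1 := mul_nonneg hε hv2
      linarith
    · simp only
      have h1 := boxDist_le_smoothBoxDist gf.1 (cv v) (‖orthPart e u (ε • v)‖ • p.2)
      have h2 := abs_real_inner_le_norm (orthPart e u (ε • v)) p.1
      have h3 := (abs_le.1 h2).1
      rw [hcv] at h1 hlt
      simp only [Pi.smul_apply, smul_eq_mul] at h1
      linarith

/-- Gordon's comparison, integrated over the components along `e` and `u`. -/
theorem pi_stdGaussian_errorSet_le {m : ℕ} (he : ‖e‖ = 1) (hu : ‖u‖ = 1)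
    (heu : (inner ℝ e u : ℝ) = 0) (ρ : ℝ) {ε : ℝ} (hε : 0 ≤ ε) :
    (Measure.pi fun _ : Fin m => stdGaussian E) (errorSet e (ρ • e + √(1 - ρ ^ 2) • u) ε) ≤
    2 * (((Measure.pi fun _ : Fin m => gaussianReal 0 1).prod
      (Measure.pi fun _ : Fin m => gaussianReal 0 1)).prod
      ((stdGaussian E).prod (Measure.pi fun _ : Fin m => gaussianReal 0 1)))
      {p | ∃ x ∈ errorParams ρ ε, boxDist p.1.1 (fun i => x.1 * p.1.1 i + x.2.1 * p.1.2 i +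
        x.2.2 * p.2.2 i) < x.2.2 * ‖p.2.1‖ + 2} := by
  have hmp := measurePreserving_rows m he hu heu
  have hS := (isClosed_errorSet m e (ρ • e + √(1 - ρ ^ 2) • u) ε).measurableSet
  rw [← hmp.measure_preimage hS.nullMeasurableSet]
  exact measure_prod_le_of_sections _ _ _ (hmp.measurable hS) fun gf =>
    stdGaussian_errorSet_le he hu heu ρ hε gf

end Error

/-! ### From the sensing vectors to the comparison process: a feasible point -/

/-- Linear programming duality: if no `r` with `‖r‖ ≤ τ` moves `c` into the box, a unit vector
of multipliers certifies this. -/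
theorem exists_certificate {m : ℕ} {E : Type*} [NormedAddCommGroup E] [InnerProductSpace ℝ E]
    [FiniteDimensional ℝ E] (g c : Fin m → ℝ) (B : Fin m → E) {τ : ℝ} (hτ : 0 ≤ τ)
    (h : ¬ ∃ r : E, ‖r‖ ≤ τ ∧ ∀ i, |c i + inner ℝ (B i) r| ≤ |g i|) :
    ∃ l : EuclideanSpace ℝ (Fin m), ‖l‖ = 1 ∧
      τ * ‖∑ i, l i • B i‖ + ∑ i, |l i| * |g i| - ∑ i, l i * c i < 0 := by
  obtain ⟨T, hT⟩ : ∃ T : E → Fin m → ℝ, T = fun r i => c i + inner ℝ (B i) r := ⟨_, rfl⟩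
  have hTc : Continuous T := by rw [hT]; fun_prop
  have hTconv : Convex ℝ (T '' Metric.closedBall 0 τ) := by
    rintro _ ⟨r, hr, rfl⟩ _ ⟨r', hr', rfl⟩ a b ha hb hab
    refine ⟨a • r + b • r', convex_closedBall (0 : E) τ hr hr' ha hb hab, ?_⟩
    rw [hT]
    ext i
    simp only [inner_add_right, real_inner_smul_right, Pi.add_apply, Pi.smul_apply, smul_eq_mul]
    linear_combination (-(c i)) * hab
  obtain ⟨f, p, q, hf1, hpq, hf2⟩ := geometric_hahn_banach_compact_closed hTconv
    ((isCompact_closedBall (0 : E) τ).image hTc)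
    (t := {y : Fin m → ℝ | ∀ i, |y i| ≤ |g i|})
    (by
      intro y hy z hz a b ha hb hab i
      have h1 := abs_add_le (a * y i) (b * z i)
      rw [abs_mul, abs_mul, abs_of_nonneg ha, abs_of_nonneg hb] at h1
      have h2 := mul_le_mul_of_nonneg_left (hy i) ha
      have h3 := mul_le_mul_of_nonneg_left (hz i) hb
      have h4 : a * |g i| + b * |g i| = |g i| := by rw [← add_mul, hab, one_mul]
      simp only [Pi.add_apply, Pi.smul_apply, smul_eq_mul]
      linarith)
    (isClosed_forall fun i => isClosed_le (by fun_prop) (by fun_prop))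
    (by
      rw [Set.disjoint_left]
      rintro _ ⟨r, hr, rfl⟩ hy
      refine h ⟨r, by simpa using hr, fun i => ?_⟩
      have := hy i
      rw [hT] at this
      exact this)
  obtain ⟨μ, hμ⟩ : ∃ μ : EuclideanSpace ℝ (Fin m),
      μ = WithLp.toLp 2 fun i => f (Pi.single i 1) := ⟨_, rfl⟩
  have hf : ∀ y : Fin m → ℝ, f y = ∑ i, μ i * y i := fun y => by
    conv_lhs => rw [pi_eq_sum_univ' y]
    rw [map_sum, hμ]
    refine Finset.sum_congr rfl fun i _ => ?_
    rw [map_smul, smul_eq_mul, mul_comm]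
  -- the worst point of the ball in the direction of the separating functional
  obtain ⟨V, hV⟩ : ∃ V : E, V = ∑ i, μ i • B i := ⟨_, rfl⟩
  have hball : ∑ i, μ i * c i + τ * ‖V‖ < p := by
    have h1 := hf1 (T ((τ / ‖V‖) • V)) ⟨_, by
      rw [mem_closedBall_zero_iff, norm_smul, Real.norm_eq_abs, abs_of_nonneg (by positivity)]
      rcases eq_or_ne ‖V‖ 0 with h0 | h0
      · rw [h0, mul_zero]; exact hτ
      · exact (div_mul_cancel₀ τ h0).le, rfl⟩
    rw [hf, hT] at h1
    simp only [mul_add, Finset.sum_add_distrib] at h1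
    have h2 : ∑ i, μ i * (inner ℝ (B i) ((τ / ‖V‖) • V) : ℝ) = τ * ‖V‖ := by
      have : ∑ i, μ i * (inner ℝ (B i) ((τ / ‖V‖) • V) : ℝ) = inner ℝ V ((τ / ‖V‖) • V) := by
        conv_rhs => rw [hV]
        rw [sum_inner, ← hV]
        exact Finset.sum_congr rfl fun i _ => (real_inner_smul_left _ _ _).symm
      rw [this, real_inner_smul_right, real_inner_self_eq_norm_sq]
      by_cases h0 : ‖V‖ = 0
      · rw [h0]; ring
      · field_simp
    linarith
  have hbox : q < -∑ i, |μ i| * |g i| := by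
    have h1 := hf2 (fun i => if 0 ≤ μ i then -|g i| else |g i|) fun i => by
      simp only
      split_ifs <;> simp
    rw [hf, ← sub_pos] at h1
    rw [← sub_pos]
    refine h1.trans_eq ?_
    rw [← Finset.sum_neg_distrib]
    congr 1
    refine Finset.sum_congr rfl fun i _ => ?_
    split_ifs with h
    · rw [abs_of_nonneg h]; ring
    · rw [abs_of_neg (not_le.1 h)]; ring
  have hneg : τ * ‖V‖ + ∑ i, |μ i| * |g i| + ∑ i, μ i * c i < 0 := by linarith
  have hμ0 : 0 < ‖μ‖ := by
    refine norm_pos_iff.2 fun h0 => ?_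
    rw [hV, h0] at hneg
    simp at hneg
  refine ⟨(-‖μ‖⁻¹) • μ, ?_, ?_⟩
  · rw [norm_smul, norm_neg, norm_inv, norm_norm, inv_mul_cancel₀ hμ0.ne']
  · have h1 : ∑ i, ((-‖μ‖⁻¹) • μ) i • B i = (-‖μ‖⁻¹) • V := by
      rw [hV, Finset.smul_sum]
      exact Finset.sum_congr rfl fun i _ => by rw [smul_smul]; rfl
    have h2 : ∑ i, |((-‖μ‖⁻¹) • μ) i| * |g i| = ‖μ‖⁻¹ * ∑ i, |μ i| * |g i| := by
      rw [Finset.mul_sum]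
      refine Finset.sum_congr rfl fun i _ => ?_
      rw [PiLp.smul_apply, smul_eq_mul, abs_mul, abs_neg, abs_inv, abs_norm, mul_assoc]
    have h3 : ∑ i, ((-‖μ‖⁻¹) • μ) i * c i = -‖μ‖⁻¹ * ∑ i, μ i * c i := by
      rw [Finset.mul_sum]
      refine Finset.sum_congr rfl fun i _ => ?_
      rw [PiLp.smul_apply, smul_eq_mul, mul_assoc]
    rw [h1, h2, h3, norm_smul, norm_neg, norm_inv, norm_norm]
    have := mul_neg_of_pos_of_neg (inv_pos.2 hμ0) hneg
    linarith

/-- Weak duality for the distance to the box. -/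
theorem sum_mul_sub_le_boxDist {m : ℕ} (g y : Fin m → ℝ) (l : EuclideanSpace ℝ (Fin m))
    (hl : ‖l‖ = 1) : ∑ i, l i * y i - ∑ i, |l i| * |g i| ≤ boxDist g y := by
  have h1 := Real.sum_mul_le_sqrt_mul_sqrt Finset.univ (fun i => |l i|)
    (fun i => max (|y i| - |g i|) 0)
  rw [EuclideanSpace.norm_eq] at hl
  simp only [Real.norm_eq_abs] at hl
  rw [hl, one_mul] at h1
  refine le_trans ?_ h1
  rw [← Finset.sum_sub_distrib]
  refine Finset.sum_le_sum fun i _ => ?_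
  have h2 : l i * y i ≤ |l i| * |y i| := by rw [← abs_mul]; exact le_abs_self _
  have h3 := mul_le_mul_of_nonneg_left (le_max_left (|y i| - |g i|) 0) (abs_nonneg (l i))
  linarith

section Witness

variable {m n : ℕ} {e u : EuclideanSpace ℝ (Fin n)}

/-- The sensing vectors for which some point `s e + w u + r`, with `r` orthogonal to `e` and `u`
and `‖r‖ ≤ τ`, is feasible. -/
def witnessSet (e u : EuclideanSpace ℝ (Fin n)) (s w τ : ℝ) :
    Set (Fin m → EuclideanSpace ℝ (Fin n)) :=
  {a | ∃ r, ‖r‖ ≤ τ ∧ ∀ i, |(inner ℝ (a i) (s • e + w • u + orthPart e u r) : ℝ)| ≤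
    |(inner ℝ (a i) e : ℝ)|}

theorem isClosed_witnessSet (s w τ : ℝ) :
    IsClosed (witnessSet e u s w τ : Set (Fin m → EuclideanSpace ℝ (Fin n))) := by
  have h := isClosed_exists_mem (Y := Fin m → EuclideanSpace ℝ (Fin n))
    (isCompact_closedBall (0 : EuclideanSpace ℝ (Fin n)) τ)
    (C := {q | ∀ i, |(inner ℝ (q.2 i) (s • e + w • u + orthPart e u q.1) : ℝ)| ≤
      |(inner ℝ (q.2 i) e : ℝ)|})
    (isClosed_forall fun i => isClosed_le (by fun_prop) (by fun_prop))
  convert h using 1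
  ext p
  simp [witnessSet]

theorem sum_mul_eq_inner (x y : EuclideanSpace ℝ (Fin n)) :
    ∑ i, x i * y i = (inner ℝ x y : ℝ) := by
  rw [PiLp.inner_apply]
  exact Finset.sum_congr rfl fun i _ => by simp [mul_comm]

theorem orthPart_toLp_apply (v : Fin n → ℝ) (j : Fin n) :
    orthPart e u (WithLp.toLp 2 v) j =
      v j - (∑ i, e i * v i) * e j - (∑ i, u i * v i) * u j := by
  simp [orthPart, ← sum_mul_eq_inner]

theorem orthPart_sum_smul {ι E : Type*} [Fintype ι] [NormedAddCommGroup E]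
    [InnerProductSpace ℝ E] (e u : E) (l : ι → ℝ) (z : ι → E) :
    orthPart e u (∑ i, l i • z i) = ∑ i, l i • orthPart e u (z i) := by
  simp only [orthPart, inner_sum, real_inner_smul_right, smul_sub, Finset.sum_sub_distrib,
    Finset.sum_smul, smul_smul]

/-- The squared norm of `orthPart e u v`, in coordinates. -/
def orthSq (e u : EuclideanSpace ℝ (Fin n)) (v : Fin n → ℝ) : ℝ :=
  ∑ i, v i ^ 2 - (∑ i, e i * v i) ^ 2 - (∑ i, u i * v i) ^ 2

theorem orthSq_eq (he : ‖e‖ = 1) (hu : ‖u‖ = 1) (heu : (inner ℝ e u : ℝ) = 0)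
    (v : Fin n → ℝ) : orthSq e u v = ‖orthPart e u (WithLp.toLp 2 v)‖ ^ 2 := by
  rw [norm_orthPart_sq he hu heu, EuclideanSpace.norm_sq_eq, ← sum_mul_eq_inner,
    ← sum_mul_eq_inner]
  simp [orthSq]

theorem hasFDerivAt_orthSq (v : Fin n → ℝ) : HasFDerivAt (orthSq e u)
    (∑ a, (2 * orthPart e u (WithLp.toLp 2 v) a) •
      (ContinuousLinearMap.proj a : (Fin n → ℝ) →L[ℝ] ℝ)) v := by
  have hp : ∀ a : Fin n, HasFDerivAt (fun v : Fin n → ℝ => v a)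
      (ContinuousLinearMap.proj a : (Fin n → ℝ) →L[ℝ] ℝ) v := fun a =>
    (ContinuousLinearMap.proj (R := ℝ) (φ := fun _ : Fin n => ℝ) a).hasFDerivAt
  have h1 := HasFDerivAt.fun_sum fun (a : Fin n) (_ : a ∈ Finset.univ) => (hp a).pow 2
  have h2 : ∀ x : EuclideanSpace ℝ (Fin n), HasFDerivAt (fun v : Fin n → ℝ => (∑ i, x i * v i) ^ 2)
      _ v := fun x =>
    (HasFDerivAt.fun_sum fun (a : Fin n) (_ : a ∈ Finset.univ) => (hp a).const_mul (x a)).pow 2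
  refine ((h1.sub (h2 e)).sub (h2 u)).congr_fderiv ?_
  refine ContinuousLinearMap.ext fun y => ?_
  simp only [orthPart_toLp_apply, sub_apply, sum_apply, smul_apply, ContinuousLinearMap.proj_apply,
    smul_eq_mul]
  generalize ∑ i, e i * v i = p
  generalize ∑ i, u i * v i = q
  simp only [Finset.mul_sum, ← Finset.sum_sub_distrib]
  refine Finset.sum_congr rfl fun a _ => ?_
  norm_num
  ring

/-- Gordon's comparison on the dual side, for fixed components along `e` and `u`. The index is the
vector `l` of multipliers, and the roles of rows and columns of the Gaussian matrix are exchanged.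
Smoothing `‖·‖` to `√(1 + ‖·‖²) - 1` costs the additive `τ` on the right. -/
theorem stdGaussian_witnessSet_compl_le (he : ‖e‖ = 1) (hu : ‖u‖ = 1)
    (heu : (inner ℝ e u : ℝ) = 0) (s w : ℝ) {τ : ℝ} (hτ : 0 < τ)
    (gf : (Fin m → ℝ) × (Fin m → ℝ)) :
    stdGaussian (PiLp 2 fun _ : Fin m => EuclideanSpace ℝ (Fin n))
      {b | rows e u (gf, b) ∈ (witnessSet e u s w τ)ᶜ} ≤
    2 * ((stdGaussian (EuclideanSpace ℝ (Fin m))).prod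
      (Measure.pi fun _ : Fin n => gaussianReal 0 1))
      {p | τ * √(orthSq e u p.2) - τ < boxDist gf.1 (fun i => s * gf.1 i + w * gf.2 i +
        -τ * p.1 i)} := by
  classical
  obtain ⟨c, hc⟩ : ∃ c : Fin m → ℝ, c = fun i => s * gf.1 i + w * gf.2 i := ⟨_, rfl⟩
  obtain ⟨L, hL⟩ : ∃ L : EuclideanSpace ℝ (Fin m) → ℝ,
      L = fun l => ∑ i, |l i| * |gf.1 i| - ∑ i, l i * c i := ⟨_, rfl⟩
  obtain ⟨A, hA⟩ : ∃ A : EuclideanSpace ℝ (Fin m) → Fin n →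
      PiLp 2 fun _ : Fin m => EuclideanSpace ℝ (Fin n),
      A = fun l j => WithLp.toLp 2 fun i => l i • EuclideanSpace.single j (1 : ℝ) := ⟨_, rfl⟩
  have hAz : ∀ l j z, (inner ℝ (A l j) z : ℝ) = (∑ i, l i • z i) j := fun l j z => by
    rw [hA, PiLp.inner_apply]
    simp [real_inner_smul_left, EuclideanSpace.inner_single_left]
  have hS0 : ∀ v, 0 ≤ orthSq e u v := fun v => by rw [orthSq_eq he hu heu]; positivity
  have hSc : Continuous (orthSq e u) := by unfold orthSq; fun_prop
  have h := gordon_of_separable (d := Fin n)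
    (E₁ := PiLp 2 fun _ : Fin m => EuclideanSpace ℝ (Fin n)) (F := EuclideanSpace ℝ (Fin m))
    (S := {l : EuclideanSpace ℝ (Fin m) // ‖l‖ = 1}) (fun l => l) (fun l => A l)
    (fun l l' i j => by
      rw [hAz, hA]
      by_cases hij : i = j
      · subst hij
        simp [← sum_mul_eq_inner]
      · simp [hij])
    (fun l v => √(1 + orthSq e u v) - (1 - L l / τ))
    (fun l j v => orthPart e u (WithLp.toLp 2 v) j / √(1 + orthSq e u v))
    (fun l v => (hasFDerivAt_sqrt_one_add_sum (r := fun j v => orthPart e u (WithLp.toLp 2 v) j)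
      (hasFDerivAt_orthSq v) (hS0 v)).sub_const _)
    (fun l j => by
      refine Continuous.div ?_ (by fun_prop) fun v => ?_
      · simp only [orthPart_toLp_apply]
        fun_prop
      · exact (Real.sqrt_pos.2 (by linarith [hS0 v])).ne')
    (fun l v => by
      simp only [div_pow]
      rw [← Finset.sum_div, Real.sq_sqrt (by linarith [hS0 v]), div_le_one (by linarith [hS0 v]),
        orthSq_eq he hu heu, EuclideanSpace.norm_sq_eq]
      simp)
    (fun z => by
      simp only [hAz]
      refine Continuous.sub (Continuous.sqrt (continuous_const.add (hSc.comp ?_))) ?_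
      · simp only [WithLp.ofLp_sum, WithLp.ofLp_smul, Finset.sum_apply, Pi.smul_apply]
        fun_prop
      · rw [hL]
        fun_prop)
  refine (measure_mono ?_).trans (h.trans (mul_le_mul_right (measure_mono ?_) _))
  · rintro z hz
    obtain ⟨l, hl, hneg⟩ := exists_certificate gf.1 c (fun i => orthPart e u (z i)) hτ.le (by
      rintro ⟨r, hr, h1⟩
      refine hz ⟨r, hr, fun i => ?_⟩
      rw [inner_rows he hu heu]
      have h2 := inner_rows he hu heu (gf, z) i 1 0 0
      simp only [one_smul, zero_smul, add_zero, orthPart, inner_zero_right, sub_zero,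
        inner_zero_left, one_mul, zero_mul] at h2
      have h3 := h1 i
      rw [hc, inner_orthPart_left, real_inner_comm] at h3
      rw [h2]
      exact h3)
    refine ⟨⟨l, hl⟩, ?_⟩
    have h1 : orthSq e u (fun j => inner ℝ (A l j) z) = ‖∑ i, l i • orthPart e u (z i)‖ ^ 2 := by
      rw [orthSq_eq he hu heu, ← orthPart_sum_smul]
      congr 3
      ext j
      exact hAz l j z
    have h2 : √(1 + ‖∑ i, l i • orthPart e u (z i)‖ ^ 2) ≤
        1 + ‖∑ i, l i • orthPart e u (z i)‖ := by
      refine Real.sqrt_le_iff.2 ⟨by positivity, ?_⟩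
      nlinarith [norm_nonneg (∑ i, l i • orthPart e u (z i))]
    have h3 : ‖∑ i, l i • orthPart e u (z i)‖ + L l / τ < 0 := by
      rw [← mul_lt_mul_iff_right₀ hτ, mul_add, mul_div_cancel₀ _ hτ.ne', mul_zero, hL]
      linarith
    simp only [h1]
    linarith
  · rintro p ⟨⟨l, hl⟩, hlt⟩
    simp only [hl, one_smul] at hlt
    have h1 := sum_mul_sub_le_boxDist gf.1 (fun i => s * gf.1 i + w * gf.2 i + -τ * p.1 i) l hl
    have h2 : √(orthSq e u p.2) ≤ √(1 + orthSq e u p.2) := Real.sqrt_le_sqrt (by linarith)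
    refine lt_of_lt_of_le ?_ h1
    rw [← sum_mul_eq_inner, hL, hc] at hlt
    have h3 : ∑ i, l i * (s * gf.1 i + w * gf.2 i + -τ * p.1 i) =
      ∑ i, l i * (s * gf.1 i + w * gf.2 i) - τ * ∑ i, l i * p.1 i := by
      rw [Finset.mul_sum, ← Finset.sum_sub_distrib]
      exact Finset.sum_congr rfl fun i _ => by ring
    rw [h3]
    have h4 := mul_lt_mul_of_pos_left hlt hτ
    have h5 := mul_le_mul_of_nonneg_left h2 hτ.le
    have h6 : ∀ X : ℝ, τ * (X / τ) = X := fun X => by field_simp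
    rw [mul_zero, mul_add, mul_sub, mul_sub, h6] at h4
    linarith

/-- The dual comparison, integrated over the components along `e` and `u`. -/
theorem pi_stdGaussian_witnessSet_compl_le (he : ‖e‖ = 1) (hu : ‖u‖ = 1)
    (heu : (inner ℝ e u : ℝ) = 0) (s w : ℝ) {τ : ℝ} (hτ : 0 < τ) :
    (Measure.pi fun _ : Fin m => stdGaussian (EuclideanSpace ℝ (Fin n)))
      (witnessSet e u s w τ)ᶜ ≤
    2 * auxMeasure m m n {p | τ * √(orthSq e u p.2.2) - τ <
      boxDist p.1.1 (fun i => s * p.1.1 i + w * p.1.2 i + -τ * p.2.1 i)} := by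
  have hmp := measurePreserving_rows m he hu heu
  have hS := (isClosed_witnessSet (m := m) (e := e) (u := u) s w τ).measurableSet.compl
  rw [← hmp.measure_preimage hS.nullMeasurableSet]
  exact measure_prod_le_of_sections _ _ _ (hmp.measurable hS) fun gf =>
    stdGaussian_witnessSet_compl_le he hu heu s w hτ gf

end Witness

/-! ### High-probability events for a fixed signal and initial guess -/

section Fixed

variable {n : ℕ}

/-- A signal and an initial guess in an orthonormal frame adapted to them. -/
theorem exists_frame (hn : 2 ≤ n) {ξ x₀ : EuclideanSpace ℝ (Fin n)} (hξ : ξ ≠ 0) (hx₀ : x₀ ≠ 0)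
    {ρ : ℝ} (hρ : (inner ℝ x₀ ξ : ℝ) = ρ * (‖x₀‖ * ‖ξ‖)) :
    ∃ e u : EuclideanSpace ℝ (Fin n), ‖e‖ = 1 ∧ ‖u‖ = 1 ∧ (inner ℝ e u : ℝ) = 0 ∧
      ξ = ‖ξ‖ • e ∧ x₀ = ‖x₀‖ • (ρ • e + √(1 - ρ ^ 2) • u) := by
  have hξ' : ‖ξ‖ ≠ 0 := norm_ne_zero_iff.2 hξ
  have hx' : ‖x₀‖ ≠ 0 := norm_ne_zero_iff.2 hx₀
  obtain ⟨e, he⟩ : ∃ e, e = ‖ξ‖⁻¹ • ξ := ⟨_, rfl⟩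
  obtain ⟨y, hy⟩ : ∃ y, y = ‖x₀‖⁻¹ • x₀ - ρ • e := ⟨_, rfl⟩
  have he1 : ‖e‖ = 1 := by rw [he, norm_smul, norm_inv, norm_norm, inv_mul_cancel₀ hξ']
  have hξe : ξ = ‖ξ‖ • e := by rw [he, smul_smul, mul_inv_cancel₀ hξ', one_smul]
  have hex : (inner ℝ e (‖x₀‖⁻¹ • x₀) : ℝ) = ρ := by
    rw [he, real_inner_smul_left, real_inner_smul_right, real_inner_comm, hρ]
    field_simp
  have hey : (inner ℝ e y : ℝ) = 0 := by
    rw [hy, inner_sub_right, hex, real_inner_smul_right, real_inner_self_eq_norm_sq, he1]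
    ring
  have hxy : x₀ = ‖x₀‖ • (ρ • e + y) := by
    rw [hy, add_sub_cancel, smul_smul, mul_inv_cancel₀ hx', one_smul]
  have hny : ‖y‖ ^ 2 = 1 - ρ ^ 2 := by
    rw [hy, norm_sub_sq_real, real_inner_smul_right, real_inner_comm, hex, norm_smul, norm_smul,
      he1, norm_inv, norm_norm, inv_mul_cancel₀ hx', Real.norm_eq_abs, mul_one, sq_abs]
    ring
  have hs : √(1 - ρ ^ 2) = ‖y‖ := by rw [← hny, Real.sqrt_sq (norm_nonneg _)]
  rcases eq_or_ne y 0 with h0 | h0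
  · obtain ⟨z, hz, hz0⟩ : ∃ z : EuclideanSpace ℝ (Fin n), (inner ℝ e z : ℝ) = 0 ∧ z ≠ 0 := by
      have hker : LinearMap.ker (innerₛₗ ℝ e) ≠ ⊥ := LinearMap.ker_ne_bot_of_finrank_lt (by
        rw [finrank_euclideanSpace_fin, Module.finrank_self]; omega)
      obtain ⟨z, hz, hz0⟩ := Submodule.exists_mem_ne_zero_of_ne_bot hker
      exact ⟨z, by simpa using hz, hz0⟩
    refine ⟨e, ‖z‖⁻¹ • z, he1, ?_, ?_, hξe, ?_⟩
    · rw [norm_smul, norm_inv, norm_norm, inv_mul_cancel₀ (norm_ne_zero_iff.2 hz0)]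
    · rw [real_inner_smul_right, hz, mul_zero]
    · rw [hs, h0, norm_zero, zero_smul]
      rwa [h0] at hxy
  · have hy' : ‖y‖ ≠ 0 := norm_ne_zero_iff.2 h0
    refine ⟨e, ‖y‖⁻¹ • y, he1, ?_, ?_, hξe, ?_⟩
    · rw [norm_smul, norm_inv, norm_norm, inv_mul_cancel₀ hy']
    · rw [real_inner_smul_right, hey, mul_zero]
    · rw [hs, smul_smul, mul_inv_cancel₀ hy', one_smul]
      exact hxy

/-- The error set is invariant under rescaling of the signal and of the initial guess. -/
theorem errorSet_smul {m : ℕ} {e d : EuclideanSpace ℝ (Fin n)} {R c : ℝ} (hR : 0 < R)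
    (hc : 0 < c) (ε : ℝ) : (errorSet (R • e) (c • d) (ε * R) :
      Set (Fin m → EuclideanSpace ℝ (Fin n))) = errorSet e d ε := by
  ext a
  refine exists_congr fun v => and_congr_right fun _ => and_congr ?_ (forall_congr' fun i => ?_)
  · rw [real_inner_smul_left, mul_nonneg_iff_of_pos_left hc]
  · rw [mul_comm ε R, ← smul_smul, ← smul_add, real_inner_smul_right, real_inner_smul_right,
      abs_mul, abs_mul, mul_le_mul_iff_right₀ (abs_pos.2 hR.ne')]

variable {α : ℝ} {m : ℕ → ℕ}

/-- At or above the critical similarity, error directions at a fixed relative distance are unlikely,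
uniformly in the signal and the initial guess. -/
theorem eventually_errorSet_le (hα : 2 < α)
    (hm : Tendsto (fun n : ℕ => (m n : ℝ) / (n : ℝ)) atTop (𝓝 α)) {ρ : ℝ} (hρ : 0 < ρ)
    (hρ1 : ρ ≤ 1) (hρc : criticalCosine α ≤ ρ) {ε : ℝ} (hε : 0 < ε) {η : ENNReal} (hη : 0 < η) :
    ∀ᶠ n in atTop, ∀ ξ x₀ : EuclideanSpace ℝ (Fin n), ξ ≠ 0 → x₀ ≠ 0 →
      (inner ℝ x₀ ξ : ℝ) = ρ * (‖x₀‖ * ‖ξ‖) →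
      (Measure.pi fun _ : Fin (m n) => stdGaussian (EuclideanSpace ℝ (Fin n)))
        (errorSet ξ x₀ (ε * ‖ξ‖)) ≤ η := by
  have h := tendsto_auxMeasure_exists_boxDist_lt hα hm (isCompact_errorParams ρ ε)
    (fun x hx => hx.2.1) fun x hx => sq_lt_mul_meanSqDist hα hρ hρ1 hρc hx.2.1
      (by
        rintro ⟨h1, h2, h3⟩
        have := hx.1
        rw [h1, h2, h3] at this
        have h4 := pow_pos hε 2
        norm_num at this
        linarith) hx.2.2
  have h2 := ENNReal.Tendsto.const_mul h (Or.inr (ENNReal.ofNat_ne_top (n := 2)))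
  rw [mul_zero] at h2
  filter_upwards [h2.eventually (gt_mem_nhds hη), eventually_ge_atTop 2] with n hlt hn
  intro ξ x₀ hξ hx₀ hcos
  obtain ⟨e, u, he, hu, heu, hξe, hx₀e⟩ := exists_frame hn hξ hx₀ hcos
  have hR := norm_pos_iff.2 hξ
  have hc := norm_pos_iff.2 hx₀
  generalize ‖ξ‖ = R at hR hξe
  generalize ‖x₀‖ = c at hc hx₀e
  rw [hξe, hx₀e, errorSet_smul hR hc]
  exact (pi_stdGaussian_errorSet_le he hu heu ρ hε.le).trans hlt.le

/-- The sensing vectors for which some feasible point of norm at most `R ‖ξ‖` has objective value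
at least `b ‖x₀‖ ‖ξ‖`. -/
def valueSet {m : ℕ} (ξ x₀ : EuclideanSpace ℝ (Fin n)) (R b : ℝ) :
    Set (Fin m → EuclideanSpace ℝ (Fin n)) :=
  {a | ∃ v, ‖v‖ ≤ R ∧ b * ‖x₀‖ ≤ (inner ℝ x₀ v : ℝ) ∧
    ∀ i, |(inner ℝ (a i) (‖ξ‖ • v) : ℝ)| ≤ |(inner ℝ (a i) ξ : ℝ)|}

theorem isClosed_setOf_mem_valueSet (m : ℕ) (R b : ℝ) :
    IsClosed {p : (EuclideanSpace ℝ (Fin n) × EuclideanSpace ℝ (Fin n)) ×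
      (Fin m → EuclideanSpace ℝ (Fin n)) | p.2 ∈ valueSet p.1.1 p.1.2 R b} := by
  have h := isClosed_exists_mem
    (Y := (EuclideanSpace ℝ (Fin n) × EuclideanSpace ℝ (Fin n)) ×
      (Fin m → EuclideanSpace ℝ (Fin n)))
    (isCompact_closedBall (0 : EuclideanSpace ℝ (Fin n)) R)
    (C := {q | b * ‖q.2.1.2‖ ≤ (inner ℝ q.2.1.2 q.1 : ℝ) ∧
      ∀ i, |(inner ℝ (q.2.2 i) (‖q.2.1.1‖ • q.1) : ℝ)| ≤ |(inner ℝ (q.2.2 i) q.2.1.1 : ℝ)|})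
    (IsClosed.and (isClosed_le (by fun_prop) (by fun_prop)) (isClosed_forall fun i =>
      isClosed_le (by fun_prop) (by fun_prop)))
  convert h using 1
  ext p
  simp [valueSet]

/-- Below the critical similarity, a feasible point with a markedly larger objective value than the
signal is likely to exist, uniformly in the signal and the initial guess. -/
theorem exists_eventually_valueSet_compl_le (hα : 2 < α)
    (hm : Tendsto (fun n : ℕ => (m n : ℝ) / (n : ℝ)) atTop (𝓝 α)) {ρ : ℝ} (hρ : 0 < ρ)
    (hρc : ρ < criticalCosine α) :
    ∃ R κ : ℝ, 0 < κ ∧ ∀ η : ENNReal, 0 < η → ∀ᶠ n in atTop,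
      ∀ ξ x₀ : EuclideanSpace ℝ (Fin n), ξ ≠ 0 → x₀ ≠ 0 →
      (inner ℝ x₀ ξ : ℝ) = ρ * (‖x₀‖ * ‖ξ‖) →
      (Measure.pi fun _ : Fin (m n) => stdGaussian (EuclideanSpace ℝ (Fin n)))
        (valueSet ξ x₀ R (ρ + κ))ᶜ ≤ η := by
  obtain ⟨s, w, τ, hτ, hlt, hobj⟩ := exists_mul_meanSqDist_lt_sq hα hρ hρc
  refine ⟨|s| + |w| + τ, ρ * s + √(1 - ρ ^ 2) * w - ρ, by linarith, fun η hη => ?_⟩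
  have hη2 : 0 < η / 2 := ENNReal.div_pos hη.ne' (by simp)
  filter_upwards [eventually_auxMeasure_lt_boxDist_le hα hm hτ hlt hη2,
    eventually_ge_atTop 2] with n haux hn
  intro ξ x₀ hξ hx₀ hcos
  obtain ⟨e, u, he, hu, heu, hξe, hx₀e⟩ := exists_frame hn hξ hx₀ hcos
  have hsum : ∀ v : EuclideanSpace ℝ (Fin n), ‖v‖ = 1 → ∑ i, v i ^ 2 = 1 := fun v hv => by
    have := EuclideanSpace.norm_sq_eq v
    rw [hv] at this
    simpa using this.symm
  have h1 := (pi_stdGaussian_witnessSet_compl_le (m := m n) he hu heu s w hτ).trans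
    (mul_le_mul_right (haux e u (hsum e he) (hsum u hu)) 2)
  rw [ENNReal.mul_div_cancel (by simp) (by simp)] at h1
  refine (measure_mono (Set.compl_subset_compl.2 ?_)).trans h1
  rintro a ⟨r, hr, ha⟩
  refine ⟨s • e + w • u + orthPart e u r, ?_, ?_, fun i => ?_⟩
  · refine (norm_add₃_le).trans ?_
    rw [norm_smul, norm_smul, he, hu, mul_one, mul_one, Real.norm_eq_abs, Real.norm_eq_abs]
    linarith [norm_orthPart_le he hu heu r]
  · have hue : (inner ℝ u e : ℝ) = 0 := by rw [real_inner_comm]; exact heu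
    have hval : (inner ℝ x₀ (s • e + w • u + orthPart e u r) : ℝ) =
        ‖x₀‖ * (ρ * s + √(1 - ρ ^ 2) * w) := by
      generalize ‖x₀‖ = c at hx₀e
      rw [hx₀e]
      simp only [inner_add_left, inner_add_right, real_inner_smul_left, real_inner_smul_right,
        real_inner_self_eq_norm_sq, he, hu, heu, hue, inner_left_orthPart he heu,
        inner_right_orthPart hu heu]
      ring
    rw [hval, add_sub_cancel, mul_comm]
  · rw [real_inner_smul_right, abs_mul, abs_norm]
    have h2 : |(inner ℝ (a i) ξ : ℝ)| = ‖ξ‖ * |(inner ℝ (a i) e : ℝ)| := by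
      conv_lhs => rw [hξe, real_inner_smul_right, abs_mul, abs_norm]
    rw [h2]
    exact mul_le_mul_of_nonneg_left (ha i) (norm_nonneg _)

end Fixed

/-! ### Consequences for the solutions of the program -/

section Deterministic

variable {m n : ℕ} {a : Fin m → EuclideanSpace ℝ (Fin n)} {ξ x₀ : EuclideanSpace ℝ (Fin n)}

theorem self_mem_feasible : ξ ∈ feasible a (measurements a ξ) := fun _ => le_rfl

theorem convex_feasible (y : Fin m → ℝ) : Convex ℝ (feasible a y) := by
  intro z hz z' hz' p q hp hq hpq i
  have h1 := abs_add_le (p * inner ℝ (a i) z : ℝ) (q * inner ℝ (a i) z')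
  rw [abs_mul, abs_mul, abs_of_nonneg hp, abs_of_nonneg hq] at h1
  have h2 := mul_le_mul_of_nonneg_left (hz i) hp
  have h3 := mul_le_mul_of_nonneg_left (hz' i) hq
  have h4 : p * y i + q * y i = y i := by rw [← add_mul, hpq, one_mul]
  rw [inner_add_right, real_inner_smul_right, real_inner_smul_right]
  linarith

theorem isClosed_feasible (y : Fin m → ℝ) : IsClosed (feasible a y) :=
  isClosed_forall fun i => isClosed_le (by fun_prop) (by fun_prop)

/-- If no direction is an error direction at distance `r`, solutions exist and all lie within
distance `r` of the signal. -/
theorem exists_isSolution_and_norm_lt {r : ℝ} (hr : 0 < r) (ha : a ∉ errorSet ξ x₀ r) :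
    (∃ z, IsSolution a (measurements a ξ) x₀ z) ∧
      ∀ z, IsSolution a (measurements a ξ) x₀ z → ‖ξ - z‖ < r := by
  have hball : ∀ z ∈ feasible a (measurements a ξ), (inner ℝ x₀ ξ : ℝ) ≤ inner ℝ x₀ z →
      ‖ξ - z‖ < r := by
    intro z hz hobj
    by_contra! hle
    have hpos : 0 < ‖ξ - z‖ := hr.trans_le hle
    refine ha ⟨‖ξ - z‖⁻¹ • (z - ξ), ?_, ?_, ?_⟩
    · rw [norm_smul, norm_inv, norm_norm, norm_sub_rev z ξ, inv_mul_cancel₀ hpos.ne']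
    · rw [real_inner_smul_right, inner_sub_right]
      exact mul_nonneg (inv_nonneg.2 hpos.le) (by linarith)
    · have h := convex_feasible (measurements a ξ) (self_mem_feasible (a := a) (ξ := ξ)) hz
        (show 0 ≤ 1 - r / ‖ξ - z‖ from sub_nonneg.2 ((div_le_one hpos).2 hle))
        (show 0 ≤ r / ‖ξ - z‖ by positivity) (sub_add_cancel _ _)
      have hpt : ξ + r • ‖ξ - z‖⁻¹ • (z - ξ) =
          (1 - r / ‖ξ - z‖) • ξ + (r / ‖ξ - z‖) • z := by
        rw [smul_smul, ← div_eq_mul_inv]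
        module
      rw [hpt]
      exact h
  refine ⟨?_, fun z hz => hball z hz.1 (hz.2 ξ self_mem_feasible)⟩
  have hC : IsCompact (feasible a (measurements a ξ) ∩ {z | (inner ℝ x₀ ξ : ℝ) ≤ inner ℝ x₀ z}) := by
    refine Metric.isCompact_of_isClosed_isBounded ((isClosed_feasible _).inter
      (isClosed_le (by fun_prop) (by fun_prop))) ?_
    refine (Metric.isBounded_ball (x := ξ) (r := r)).subset fun z hz => ?_
    rw [mem_ball_iff_norm, norm_sub_rev]
    exact hball z hz.1 hz.2
  obtain ⟨z, hz, hmax⟩ := hC.exists_isMaxOn ⟨ξ, self_mem_feasible, le_refl (inner ℝ x₀ ξ : ℝ)⟩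
    (f := fun z => (inner ℝ x₀ z : ℝ)) (by fun_prop)
  refine ⟨z, hz.1, fun w hw => ?_⟩
  rcases le_total (inner ℝ x₀ ξ : ℝ) (inner ℝ x₀ w) with h | h
  · exact hmax ⟨hw, h⟩
  · exact h.trans hz.2

/-- If no direction is an error direction for the initial guess `ξ` itself, then the sensing
vectors span the space, so that the program has a solution whatever its objective. -/
theorem exists_isSolution_of_notMem_errorSet (r : ℝ) (ha : a ∉ errorSet ξ ξ r) :
    ∃ z, IsSolution a (measurements a ξ) x₀ z := by
  obtain ⟨T, hT⟩ : ∃ T : EuclideanSpace ℝ (Fin n) →ₗ[ℝ] (Fin m → ℝ),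
      T = LinearMap.pi fun i => innerₛₗ ℝ (a i) := ⟨_, rfl⟩
  have hTa : ∀ z i, T z i = (inner ℝ (a i) z : ℝ) := fun z i => by rw [hT]; rfl
  have hker : LinearMap.ker T = ⊥ := by
    rw [LinearMap.ker_eq_bot']
    intro z hz
    by_contra h0
    have hort : ∀ i, (inner ℝ (a i) z : ℝ) = 0 := fun i => by rw [← hTa, hz]; rfl
    have hn : ‖z‖ ≠ 0 := norm_ne_zero_iff.2 h0
    have key : ∀ c : ℝ, |c| = 1 → ¬ 0 ≤ (inner ℝ ξ ((c * ‖z‖⁻¹) • z) : ℝ) := fun c hc hnn =>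
      ha ⟨(c * ‖z‖⁻¹) • z, by
        rw [norm_smul, Real.norm_eq_abs, abs_mul, hc, abs_inv, abs_norm, one_mul,
          inv_mul_cancel₀ hn], hnn, fun i => by
        rw [inner_add_right, real_inner_smul_right, real_inner_smul_right, hort, mul_zero,
          mul_zero, add_zero]⟩
    have k1 := key 1 (by norm_num)
    have k2 := key (-1) (by norm_num)
    rw [real_inner_smul_right] at k1 k2
    push Not at k1 k2
    linarith
  obtain ⟨C, -, hC⟩ := LinearMap.exists_antilipschitzWith T hker
  have hcomp : IsCompact (feasible a (measurements a ξ)) := by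
    refine Metric.isCompact_of_isClosed_isBounded (isClosed_feasible _) ?_
    refine (Metric.isBounded_closedBall (x := (0 : EuclideanSpace ℝ (Fin n)))
      (r := C * ‖T ξ‖)).subset fun z hz => ?_
    rw [mem_closedBall_zero_iff]
    have h1 := hC.le_mul_dist z 0
    rw [map_zero, dist_zero_right, dist_zero_right] at h1
    refine h1.trans (mul_le_mul_of_nonneg_left ?_ C.2)
    refine (pi_norm_le_iff_of_nonneg (norm_nonneg _)).2 fun i => ?_
    refine le_trans ?_ (norm_le_pi_norm (T ξ) i)
    rw [hTa, hTa]
    exact hz i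
  obtain ⟨z, hz, hmax⟩ := hcomp.exists_isMaxOn ⟨ξ, self_mem_feasible⟩
    (f := fun z => (inner ℝ x₀ z : ℝ)) (by fun_prop)
  exact ⟨z, hz, fun w hw => hmax hw⟩

theorem nmse_nonneg (ξ z : EuclideanSpace ℝ (Fin n)) : 0 ≤ nmse ξ z :=
  div_nonneg (le_min (sq_nonneg _) (sq_nonneg _)) (sq_nonneg _)

theorem nmse_neg (ξ z : EuclideanSpace ℝ (Fin n)) : nmse (-ξ) z = nmse ξ z := by
  have h1 : ‖-ξ - z‖ = ‖ξ + z‖ := by rw [← norm_neg]; congr 1; abel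
  have h2 : ‖-ξ + z‖ = ‖ξ - z‖ := by rw [← norm_neg]; congr 1; abel
  rw [nmse, nmse, h1, h2, norm_neg, min_comm]

theorem measurements_neg (a : Fin m → EuclideanSpace ℝ (Fin n)) (ξ : EuclideanSpace ℝ (Fin n)) :
    measurements a (-ξ) = measurements a ξ := by
  ext i
  simp [measurements]

theorem nmse_lt_of_norm_lt {z : EuclideanSpace ℝ (Fin n)} {ε : ℝ} (hξ : ξ ≠ 0)
    (h : ‖ξ - z‖ < ε * ‖ξ‖) : nmse ξ z < ε ^ 2 := by
  have hpos := norm_pos_iff.2 hξ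
  rw [nmse, div_lt_iff₀ (by positivity), ← mul_pow]
  exact (min_le_left _ _).trans_lt (pow_lt_pow_left₀ h (norm_nonneg _) two_ne_zero)

/-- A point whose objective value exceeds that of `ξ` and of `-ξ` is far from both. -/
theorem sq_le_nmse_of_le_inner {z : EuclideanSpace ℝ (Fin n)} {ρ κ : ℝ} (hκ : 0 < κ) (hξ : ξ ≠ 0)
    (hx₀ : x₀ ≠ 0) (hρ : |(inner ℝ x₀ ξ : ℝ)| = ρ * (‖x₀‖ * ‖ξ‖))
    (hz : (ρ + κ) * (‖x₀‖ * ‖ξ‖) ≤ (inner ℝ x₀ z : ℝ)) : κ ^ 2 ≤ nmse ξ z := by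
  have hpos := norm_pos_iff.2 hξ
  have hpos' := norm_pos_iff.2 hx₀
  rw [nmse, le_div_iff₀ (by positivity), ← mul_pow, le_min_iff]
  have key : ∀ y : EuclideanSpace ℝ (Fin n), κ * (‖x₀‖ * ‖ξ‖) ≤ |(inner ℝ x₀ y : ℝ)| →
      (κ * ‖ξ‖) ^ 2 ≤ ‖y‖ ^ 2 := fun y hy => by
    refine pow_le_pow_left₀ (by positivity) ?_ 2
    have h1 := hy.trans (abs_real_inner_le_norm x₀ y)
    refine le_of_mul_le_mul_left ?_ hpos'
    linarith
  have h1 := le_abs_self (inner ℝ x₀ ξ : ℝ)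
  have h2 := neg_abs_le (inner ℝ x₀ ξ : ℝ)
  refine ⟨key _ ?_, key _ ?_⟩
  · rw [inner_sub_right]
    refine le_trans ?_ (neg_le_abs _)
    linarith
  · rw [inner_add_right]
    refine le_trans ?_ (le_abs_self _)
    linarith

end Deterministic

/-! ### Transfer to random signals -/

/-- Sections of small measure give events of small probability, by independence. -/
theorem measure_mem_le_of_indepFun {Ω X Y : Type*} [MeasurableSpace Ω] [MeasurableSpace X]
    [MeasurableSpace Y] {μ : Measure Ω} [IsProbabilityMeasure μ] {U : Ω → X} {V : Ω → Y}
    (hU : AEMeasurable U μ) (hV : AEMeasurable V μ) (hUV : IndepFun U V μ) {B : Set (X × Y)}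
    (hB : MeasurableSet B) {η : ENNReal}
    (h : ∀ᵐ ω ∂μ, μ.map V {y | (U ω, y) ∈ B} ≤ η) : μ {ω | (U ω, V ω) ∈ B} ≤ η := by
  have : IsProbabilityMeasure (μ.map V) := Measure.isProbabilityMeasure_map hV
  have h1 : μ {ω | (U ω, V ω) ∈ B} = (μ.map fun ω => (U ω, V ω)) B :=
    (Measure.map_apply_of_aemeasurable (hU.prodMk hV) hB).symm
  rw [h1, (indepFun_iff_map_prod_eq_prod_map_map hU hV).1 hUV, Measure.prod_apply hB,
    lintegral_map' (measurable_measure_prodMk_left hB).aemeasurable hU]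
  refine (lintegral_mono_ae (g := fun _ => η) h).trans ?_
  simp

theorem map_eq_pi_stdGaussian {Ω : Type*} [MeasurableSpace Ω] {μ : Measure Ω}
    [IsProbabilityMeasure μ] {m n : ℕ} {a : Fin m → Ω → EuclideanSpace ℝ (Fin n)}
    (ha_law : ∀ i, HasLaw (a i) (stdGaussian (EuclideanSpace ℝ (Fin n))) μ)
    (ha_indep : iIndepFun a μ) :
    μ.map (fun ω i => a i ω) = Measure.pi fun _ => stdGaussian (EuclideanSpace ℝ (Fin n)) := by
  rw [(iIndepFun_iff_map_fun_eq_pi_map fun i => (ha_law i).aemeasurable).1 ha_indep]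
  simp only [(ha_law _).map_eq]

/-- The representative of `±ξ` that is positively correlated with the initial guess. -/
def align {n : ℕ} (p : EuclideanSpace ℝ (Fin n) × EuclideanSpace ℝ (Fin n)) :
    EuclideanSpace ℝ (Fin n) × EuclideanSpace ℝ (Fin n) :=
  if 0 ≤ (inner ℝ p.2 p.1 : ℝ) then p else (-p.1, p.2)

theorem measurable_align (n : ℕ) : Measurable (align (n := n)) :=
  Measurable.ite (measurableSet_le (by fun_prop) (by fun_prop)) measurable_id (by fun_prop)

/-- The aligned signal has the same measurements, the same error, and the prescribed correlation
with the initial guess. -/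
theorem align_spec {n : ℕ} {ξ x₀ : EuclideanSpace ℝ (Fin n)} {ρ : ℝ} (hρ : 0 < ρ)
    (hcos : cosineSimilarity x₀ ξ = ρ) :
    ∃ ξ' : EuclideanSpace ℝ (Fin n), align (ξ, x₀) = (ξ', x₀) ∧ ξ' ≠ 0 ∧ x₀ ≠ 0 ∧
      (inner ℝ x₀ ξ' : ℝ) = ρ * (‖x₀‖ * ‖ξ'‖) ∧ (∀ z, nmse ξ' z = nmse ξ z) ∧
      ∀ (m : ℕ) (a : Fin m → EuclideanSpace ℝ (Fin n)), measurements a ξ' = measurements a ξ := by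
  have hx₀ : x₀ ≠ 0 := by
    rintro rfl
    rw [cosineSimilarity] at hcos
    simp at hcos
    exact hρ.ne hcos
  have hξ : ξ ≠ 0 := by
    rintro rfl
    rw [cosineSimilarity] at hcos
    simp at hcos
    exact hρ.ne hcos
  have hpos : ‖x₀‖ * ‖ξ‖ ≠ 0 := mul_ne_zero (norm_ne_zero_iff.2 hx₀) (norm_ne_zero_iff.2 hξ)
  have habs : |(inner ℝ x₀ ξ : ℝ)| = ρ * (‖x₀‖ * ‖ξ‖) := by
    rw [← hcos, cosineSimilarity, div_mul_cancel₀ _ hpos]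
  by_cases h : 0 ≤ (inner ℝ x₀ ξ : ℝ)
  · refine ⟨ξ, if_pos h, hξ, hx₀, ?_, fun _ => rfl, fun _ _ => rfl⟩
    rw [← habs, abs_of_nonneg h]
  · refine ⟨-ξ, if_neg h, neg_ne_zero.2 hξ, hx₀, ?_, nmse_neg ξ, fun _ a => measurements_neg a ξ⟩
    rw [norm_neg, ← habs, abs_of_neg (not_le.1 h), inner_neg_right]

theorem cosineSimilarity_le_one {n : ℕ} (x y : EuclideanSpace ℝ (Fin n)) :
    cosineSimilarity x y ≤ 1 := by
  refine div_le_one_of_le₀ (abs_real_inner_le_norm x y) (by positivity)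

theorem criticalCosine_lt_one {α : ℝ} (hα : 2 < α) : criticalCosine α < 1 := by
  have := one_sub_criticalCosine_sq_pos hα
  nlinarith [criticalCosine_nonneg (α := α)]

end PhaseMax

end

/-! ### The phase transition -/

open PhaseMax in
theorem theorem3
    {Ω : ℕ → Type*} [∀ n, MeasurableSpace (Ω n)]
    (μ : ∀ n, Measure (Ω n)) [∀ n, IsProbabilityMeasure (μ n)]
    -- the oversampling ratio `m / n` tends to `α > 2`
    (α : ℝ) (hα : 2 < α) (m : ℕ → ℕ)
    (hm : Tendsto (fun n : ℕ => (m n : ℝ) / (n : ℝ)) atTop (𝓝 α))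
    -- the sensing vectors are i.i.d. standard Gaussian in `ℝⁿ`
    (a : ∀ n, Fin (m n) → Ω n → EuclideanSpace ℝ (Fin n))
    (ha_law : ∀ n i, HasLaw (a n i) (stdGaussian (EuclideanSpace ℝ (Fin n))) (μ n))
    (ha_indep : ∀ n, iIndepFun (a n) (μ n))
    -- the target signal and the initial guess, independent of the sensing vectors
    (ξ xinit : ∀ n, Ω n → EuclideanSpace ℝ (Fin n))
    (hξ : ∀ n, AEMeasurable (ξ n) (μ n)) (hxinit : ∀ n, AEMeasurable (xinit n) (μ n))
    (h_indep : ∀ n, IndepFun (fun ω => (ξ n ω, xinit n ω)) (fun ω i => a n i ω) (μ n))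
    -- the input cosine similarity has the fixed value `ρ > 0` (possible only if `n` is not
    -- too small)
    (ρ : ℝ) (hρ : 0 < ρ)
    (hcos : ∀ᶠ n in atTop, ∀ᵐ ω ∂(μ n), PhaseMax.cosineSimilarity (xinit n ω) (ξ n ω) = ρ)
    -- `xhat` is any choice of an optimal solution of PhaseMax, wherever there is one
    (xhat : ∀ n, Ω n → EuclideanSpace ℝ (Fin n))
    (hxhat : ∀ n, ∀ᵐ ω ∂(μ n),
      (∃ z, PhaseMax.IsSolution (fun i => a n i ω)
        (PhaseMax.measurements (fun i => a n i ω) (ξ n ω)) (xinit n ω) z) →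
      PhaseMax.IsSolution (fun i => a n i ω)
        (PhaseMax.measurements (fun i => a n i ω) (ξ n ω)) (xinit n ω) (xhat n ω)) :
    PhaseMax.TendstoInProb μ (fun n ω => PhaseMax.nmse (ξ n ω) (xhat n ω)) 0 ↔
      PhaseMax.criticalCosine α ≤ ρ := by
  have hlaw := fun n => map_eq_pi_stdGaussian (ha_law n) (ha_indep n)
  have hpair := fun n => (hξ n).prodMk (hxinit n)
  have hmeas : ∀ n, AEMeasurable (fun ω i => a n i ω) (μ n) := fun n =>
    aemeasurable_pi_lambda _ fun i => (ha_law n i).aemeasurable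
  constructor
  · intro hlim
    by_contra! hρc
    -- three events of probability at most `1 / 4` would cover the whole space: no feasible point
    -- with a larger objective value, no solution at all, and a small error
    obtain ⟨R, κ, hκ, hval⟩ := exists_eventually_valueSet_compl_le hα hm hρ hρc
    have h4 : (0 : ENNReal) < 4⁻¹ := by simp
    -- the initial guess `ξ` itself has cosine similarity `1`, which is above the critical value
    have hspan := eventually_errorSet_le hα hm one_pos le_rfl (criticalCosine_lt_one hα).le
      one_pos h4
    have hsmall := (hlim (κ ^ 2 / 2) (by positivity)).eventually (gt_mem_nhds h4)
    obtain ⟨n, hn1, hn2, hn3, hn4⟩ :=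
      (hcos.and ((hval 4⁻¹ h4).and (hspan.and hsmall))).exists
    have e1 : μ n {ω | ((ξ n ω, xinit n ω), fun i => a n i ω) ∈ {p : (EuclideanSpace ℝ (Fin n) ×
        EuclideanSpace ℝ (Fin n)) × (Fin (m n) → EuclideanSpace ℝ (Fin n)) |
        p.2 ∈ (valueSet (align p.1).1 (align p.1).2 R (ρ + κ))ᶜ}} ≤ 4⁻¹ := by
      refine measure_mem_le_of_indepFun (hpair n) (hmeas n) (h_indep n) ?_ ?_
      · exact (((measurable_align n).comp measurable_fst).prodMk measurable_snd)
          (isClosed_setOf_mem_valueSet (m n) R (ρ + κ)).measurableSet.compl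
      · filter_upwards [hn1] with ω hω
        obtain ⟨ξ', h1, h2, h3, h5, -, -⟩ := align_spec hρ hω
        rw [hlaw]
        refine (measure_mono fun b hb => ?_).trans (hn2 ξ' (xinit n ω) h2 h3 h5)
        change b ∈ (valueSet (align (ξ n ω, xinit n ω)).1 (align (ξ n ω, xinit n ω)).2 R
          (ρ + κ))ᶜ at hb
        rwa [h1] at hb
    have e2 : μ n {ω | ((ξ n ω, xinit n ω), fun i => a n i ω) ∈ {p : (EuclideanSpace ℝ (Fin n) ×
        EuclideanSpace ℝ (Fin n)) × (Fin (m n) → EuclideanSpace ℝ (Fin n)) |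
        p.2 ∈ errorSet (align p.1).1 (align p.1).1 (1 * ‖(align p.1).1‖)}} ≤ 4⁻¹ := by
      refine measure_mem_le_of_indepFun (hpair n) (hmeas n) (h_indep n) ?_ ?_
      · have hal : Measurable fun p : (EuclideanSpace ℝ (Fin n) × EuclideanSpace ℝ (Fin n)) ×
            (Fin (m n) → EuclideanSpace ℝ (Fin n)) => align p.1 :=
          (measurable_align n).comp measurable_fst
        exact ((hal.fst.prodMk hal.fst).prodMk measurable_snd)
          (isClosed_setOf_mem_errorSet (m n) 1).measurableSet
      · filter_upwards [hn1] with ω hω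
        obtain ⟨ξ', h1, h2, h3, h5, -, -⟩ := align_spec hρ hω
        rw [hlaw]
        refine (measure_mono fun b hb => ?_).trans (hn3 ξ' ξ' h2 h2
          (by rw [real_inner_self_eq_norm_sq]; ring))
        change b ∈ errorSet (align (ξ n ω, xinit n ω)).1 (align (ξ n ω, xinit n ω)).1
          (1 * ‖(align (ξ n ω, xinit n ω)).1‖) at hb
        rwa [h1] at hb
    have hall : (1 : ENNReal) ≤ 4⁻¹ + (4⁻¹ + 4⁻¹) := by
      rw [← measure_univ (μ := μ n)]
      refine le_trans ?_ (add_le_add e1 (add_le_add e2 hn4.le))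
      refine le_trans ?_ ((measure_union_le _ _).trans
        (add_le_add_right (measure_union_le _ _) _))
      refine measure_mono_ae ?_
      filter_upwards [hn1, hxhat n] with ω hω hsol _
      obtain ⟨ξ', h1, h2, h3, h5, hnm, hms⟩ := align_spec hρ hω
      by_contra hcon
      change ¬ (_ ∨ _ ∨ _) at hcon
      simp only [Set.mem_ofPred_eq, h1, not_or, Set.mem_compl_iff, not_not] at hcon
      obtain ⟨⟨v, hv, hobj, hfeas⟩, hne, hle⟩ := hcon
      rw [← hms] at hsol
      have hs := hsol (exists_isSolution_of_notMem_errorSet _ hne)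
      have hge := hs.2 (‖ξ'‖ • v) hfeas
      have hbig := sq_le_nmse_of_le_inner (z := xhat n ω) hκ h2 h3
        (by rw [h5, abs_of_nonneg (by positivity)]) (by
          rw [real_inner_smul_right] at hge
          have := mul_le_mul_of_nonneg_left hobj (norm_nonneg ξ')
          linarith)
      rw [hnm] at hbig
      rw [sub_zero, abs_of_nonneg (nmse_nonneg _ _)] at hle
      have := pow_pos hκ 2
      linarith
    have hlt : (4⁻¹ : ENNReal) + (4⁻¹ + 4⁻¹) < 1 := by
      have hof : (4⁻¹ : ENNReal) = ENNReal.ofReal 4⁻¹ := by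
        rw [ENNReal.ofReal_inv_of_pos (by norm_num), ENNReal.ofReal_ofNat]
      rw [hof, ← ENNReal.ofReal_add (by norm_num) (by norm_num),
        ← ENNReal.ofReal_add (by norm_num) (by norm_num), ENNReal.ofReal_lt_one]
      norm_num
    exact absurd hall hlt.not_ge
  · intro hρc ε hε
    have hρ1 : ρ ≤ 1 := by
      obtain ⟨n, hn⟩ := hcos.exists
      obtain ⟨ω, hω⟩ := hn.exists
      exact hω ▸ cosineSimilarity_le_one _ _
    rw [ENNReal.tendsto_nhds_zero]
    intro η hη
    have hsε : 0 < √ε := Real.sqrt_pos.2 hε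
    filter_upwards [hcos, eventually_errorSet_le hα hm hρ hρ1 hρc hsε hη] with n hn1 hn2
    have e1 : μ n {ω | ((ξ n ω, xinit n ω), fun i => a n i ω) ∈ {p : (EuclideanSpace ℝ (Fin n) ×
        EuclideanSpace ℝ (Fin n)) × (Fin (m n) → EuclideanSpace ℝ (Fin n)) |
        p.2 ∈ errorSet (align p.1).1 (align p.1).2 (√ε * ‖(align p.1).1‖)}} ≤ η := by
      refine measure_mem_le_of_indepFun (hpair n) (hmeas n) (h_indep n) ?_ ?_
      · exact (((measurable_align n).comp measurable_fst).prodMk measurable_snd)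
          (isClosed_setOf_mem_errorSet (m n) √ε).measurableSet
      · filter_upwards [hn1] with ω hω
        obtain ⟨ξ', h1, h2, h3, h5, -, -⟩ := align_spec hρ hω
        rw [hlaw]
        refine (measure_mono fun b hb => ?_).trans (hn2 ξ' (xinit n ω) h2 h3 h5)
        change b ∈ errorSet (align (ξ n ω, xinit n ω)).1 (align (ξ n ω, xinit n ω)).2
          (√ε * ‖(align (ξ n ω, xinit n ω)).1‖) at hb
        rwa [h1] at hb
    refine le_trans (measure_mono_ae ?_) e1
    filter_upwards [hn1, hxhat n] with ω hω hsol hbig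
    obtain ⟨ξ', h1, h2, h3, h5, hnm, hms⟩ := align_spec hρ hω
    by_contra hcon
    change ¬ (_ ∈ errorSet (align (ξ n ω, xinit n ω)).1 (align (ξ n ω, xinit n ω)).2
      (√ε * ‖(align (ξ n ω, xinit n ω)).1‖)) at hcon
    rw [h1] at hcon
    rw [← hms] at hsol
    obtain ⟨hex, hnear⟩ := exists_isSolution_and_norm_lt
      (mul_pos hsε (norm_pos_iff.2 h2)) hcon
    have hlt := nmse_lt_of_norm_lt h2 (hnear _ (hsol hex))
    rw [hnm, Real.sq_sqrt hε.le] at hlt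
    change ε < |nmse (ξ n ω) (xhat n ω) - 0| at hbig
    rw [sub_zero, abs_of_nonneg (nmse_nonneg _ _)] at hbig
    linarith
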